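/- **Setting.** Let $W$ be a finite-dimensional complex weak Hopf algebra with antipode $S$ that has a cocommutative Haar integral (no $*$-structure is needed; in particular $W$ may be any $C^*$ weak Hopf algebra whose Haar integral is cocommutative), and let $\hat W=\operatorname{Hom}(W,\mathbb C)$ be the dual weak Hopf algebra. Write $\varepsilon_L(h)=\sum\varepsilon(1^{(1)}h)1^{(2)}$, $\varepsilon_R(h)=\sum 1^{(1)}\varepsilon(h1^{(2)})$, $W_L=\varepsilon_L(W)$, $W_R=\varepsilon_R(W)$. An element is cocommutative if $\Delta^{\rm op}$ and $\Delta$ agree on it. Let $D(W)^\vee\subset W\otimes\hat W\cong(\hat W\otimes W)^\vee$ be the space of elements that vanish, under $\langle g\otimes\psi,\varphi\otimes h\rangle=\varphi(g)\psi(h)$, on all $\varphi\otimes xh-\varphi\cdot\varepsilon(\,\bullet\, x)\otimes h$ with $x\in W_L$ and all $\varphi\otimes yh-\varphi\cdot\varepsilon(y\,\bullet)\otimes h$ with $y\in W_R$ (that is, the dual of the quantum double $D(W)$). On $W\otimes\hat W$ consider the coproduct $$\Delta(h\otimes\varphi)=\sum_k\sum(h^{(1)}\otimes\hat k)\otimes\bigl(S^{-1}(k^{(3)})h^{(2)}k^{(1)}\otimes\varphi(k^{(2)}\,\bullet)\bigr),$$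 with $\{k\},\{\hat k\}$ dual bases of $W$ and $\hat W$. **Lattice.** Take a finite cellulation of a closed oriented surface with directed edges $E$; the dual edge $\tilde e$ is $e$ turned counterclockwise by $\pi/2$. The total space is $\bigotimes_{e\in E}W$. A site is a corner $s=(v,f)$, a vertex $v$ with an adjacent face $f$ (a vertex may be a corner of a face several times, which gives several sites). On an edge put $$L_+^hx=hx,\quad L_-^hx=xS^{-1}(h),\quad \tilde L_-^hx=xh,\quad \tilde L_+^hx=S^{-1}(h)x,$$ $$T_+^\varphi x=\sum\varphi(x^{(2)})x^{(1)},\quad T_-^\varphi x=\sum\varphi(S(x^{(1)}))x^{(2)},\quad \tilde T_-^\varphi x=\sum\varphi(x^{(1)})x^{(2)},\quad \tilde T_+^\varphi x=\sum\varphi(S(x^{(2)}))x^{(1)}.$$ For a site $s=(v,f)$, $A^h(s)$ applies $h^{(1)},h^{(2)},\dots$ to the edge ends at $v$ in counterclockwise order from $s$, by $L_-$ on outgoing and by $L_+$ on incoming edges; $B^\varphi(s)$ applies $\varphi^{(1)},\varphi^{(2)},\dots$ to the sides of $f$ in counterclockwise order from $s$, by $T_-$ where the edge runs counterclockwise around $f$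 and by $T_+$ otherwise. **Ribbons.** A direct triangle $\tau$ joins two sites of one face that are consecutive along an edge; a dual triangle $\tilde\tau$ joins two sites of one vertex that are consecutive across an edge. An index $R$ or $L$ tells whether the edge (for $\tilde\tau$, the dual edge) lies to the right or to the left, an exponent $\pm$ whether its direction agrees with that of the triangle. A ribbon $\rho$ is a nonempty sequence of triangles $\tau_1,\tau_2,\dots$, each ending at the site where the next one starts, with pairwise non-overlapping triangles (disjoint interiors), either all of the kinds $\tau_L,\tilde\tau_R$ (type A) or all of the kinds $\tau_R,\tilde\tau_L$ (type B). Its first and last sites are $\partial_0\rho,\partial_1\rho$. On the edge of a triangle, the operator $F^{h,\varphi}$ is $\varepsilon(h)T_-^\varphi$ for $\tau_R^+$, $\varepsilon(h)T_+^\varphi$ for $\tau_R^-$, $\varepsilon(h)\tilde T_-^\varphi$ for $\tau_L^-$, $\varepsilon(h)\tilde T_+^\varphi$ for $\tau_L^+$, $\varphi(1)L_-^h$ for $\tilde\tau_R^+$, $\varphi(1)L_+^h$ for $\tilde\tau_R^-$, $\varphi(1)\tilde L_-^h$ for $\tilde\tau_L^-$, $\varphi(1)\tilde L_+^h$ for $\tilde\tau_L^+$.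 It is extended linearly to $F^t$, $t\in W\otimes\hat W$, and $F^t(\rho)=\sum F^{t^{(1)}}(\tau_1)F^{t^{(2)}}(\rho')$ for $\rho=\tau_1\cup\rho'$, with the coproduct above. **Proposition.** Let $\rho$ be a ribbon, $t\in D(W)^\vee$ (for instance $t=g\otimes\psi$), $h\in W$ and $\varphi\in\hat W$ cocommutative, and $s=(v,f)$ a site. If $v$ is not the vertex of $\partial_0\rho$ or of $\partial_1\rho$, then $$A^h(s)\,F^{t}(\rho)=F^{t}(\rho)\,A^h(s).$$ If $f$ is not the face of $\partial_0\rho$ or of $\partial_1\rho$, then $$B^\varphi(s)\,F^{t}(\rho)=F^{t}(\rho)\,B^\varphi(s).$$ -/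

import Mathlib

open scoped TensorProduct
open Module (Dual)

noncomputable section

/-! ### Weak Hopf algebras -/

namespace WeakHopf

open Coalgebra

/-- The left counital map `ε_L(h) = Σ ε(1⁽¹⁾ h) 1⁽²⁾`. -/
def epsL (W : Type*) [Ring W] [Algebra ℂ W] [Coalgebra ℂ W] (h : W) : W :=
  TensorProduct.lid ℂ W
    ((counit (R := ℂ) (A := W)).rTensor W (comul (R := ℂ) (1 : W) * (h ⊗ₜ[ℂ] (1 : W))))

/-- The right counital map `ε_R(h) = Σ 1⁽¹⁾ ε(h 1⁽²⁾)`. -/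
def epsR (W : Type*) [Ring W] [Algebra ℂ W] [Coalgebra ℂ W] (h : W) : W :=
  TensorProduct.rid ℂ W
    ((counit (R := ℂ) (A := W)).lTensor W (((1 : W) ⊗ₜ[ℂ] h) * comul (R := ℂ) (1 : W)))

/-- The iterated comultiplication `k ↦ Σ k⁽¹⁾ ⊗ (k⁽²⁾ ⊗ k⁽³⁾)`. -/
def comul₂ (W : Type*) [Ring W] [Algebra ℂ W] [Coalgebra ℂ W] : W →ₗ[ℂ] W ⊗[ℂ] (W ⊗[ℂ] W) :=
  (comul (R := ℂ) (A := W)).lTensor W ∘ₗ comul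

end WeakHopf

/-- Complex weak Hopf algebras (finite-dimensionality is a separate hypothesis). -/
class WeakHopfAlgebra (W : Type*) [Ring W] [Algebra ℂ W] extends Coalgebra ℂ W where
  /-- `Δ(uv) = Δ(u) Δ(v)` -/
  comul_mul : ∀ u v : W, comul (u * v) = comul u * comul v
  /-- `Δ₂(1) = (Δ(1) ⊗ 1) (1 ⊗ Δ(1))` -/
  comul_one_left : WeakHopf.comul₂ W 1 =
    TensorProduct.assoc ℂ W W W (comul 1 ⊗ₜ[ℂ] (1 : W)) * ((1 : W) ⊗ₜ[ℂ] comul 1)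
  /-- `Δ₂(1) = (1 ⊗ Δ(1)) (Δ(1) ⊗ 1)` -/
  comul_one_right : WeakHopf.comul₂ W 1 =
    ((1 : W) ⊗ₜ[ℂ] comul 1) * TensorProduct.assoc ℂ W W W (comul 1 ⊗ₜ[ℂ] (1 : W))
  /-- `ε(uvw) = Σ ε(u v⁽¹⁾) ε(v⁽²⁾ w)` -/
  counit_mul_left : ∀ u v w : W, counit (u * v * w) =
    LinearMap.mul' ℂ ℂ (TensorProduct.map (counit ∘ₗ LinearMap.mulLeft ℂ u)
      (counit ∘ₗ LinearMap.mulRight ℂ w) (comul v))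
  /-- `ε(uvw) = Σ ε(u v⁽²⁾) ε(v⁽¹⁾ w)` -/
  counit_mul_right : ∀ u v w : W, counit (u * v * w) =
    LinearMap.mul' ℂ ℂ (TensorProduct.map (counit ∘ₗ LinearMap.mulLeft ℂ u)
      (counit ∘ₗ LinearMap.mulRight ℂ w) (TensorProduct.comm ℂ W W (comul v)))
  /-- the antipode `S` -/
  antipode : W →ₗ[ℂ] W
  /-- `Σ h⁽¹⁾ S(h⁽²⁾) = ε_L(h)` -/
  mul_antipode : ∀ h : W,
    LinearMap.mul' ℂ W (antipode.lTensor W (comul h)) = WeakHopf.epsL W h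
  /-- `Σ S(h⁽¹⁾) h⁽²⁾ = ε_R(h)` -/
  antipode_mul : ∀ h : W,
    LinearMap.mul' ℂ W (antipode.rTensor W (comul h)) = WeakHopf.epsR W h
  /-- `Σ S(h⁽¹⁾) h⁽²⁾ S(h⁽³⁾) = S(h)` -/
  antipode_mul_antipode : ∀ h : W,
    (LinearMap.mul' ℂ W ∘ₗ TensorProduct.map antipode
      (LinearMap.mul' ℂ W ∘ₗ antipode.lTensor W)) (WeakHopf.comul₂ W h) = antipode h

namespace WeakHopf

open Coalgebra

section Algebra

variable (W : Type*) [Ring W] [Algebra ℂ W] [WeakHopfAlgebra W]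

/-- The inverse `S⁻¹` of the antipode (a theorem says that `S` is bijective when `W` is
finite-dimensional, so that the junk value of `Ring.inverse` is not taken). -/
def antipodeInv : W →ₗ[ℂ] W :=
  Ring.inverse (WeakHopfAlgebra.antipode (W := W) : Module.End ℂ W)

variable {W}

/-- Haar integrals: two-sided integrals that are normalized on both sides. -/
structure IsHaarIntegral (l : W) : Prop where
  left_integral : ∀ x : W, x * l = epsL W x * l
  right_integral : ∀ x : W, l * x = l * epsR W x
  left_normalized : epsL W l = 1
  right_normalized : epsR W l = 1

/-- `h ∈ Cocom(W)`, i.e. `Δᵒᵖ(h) = Δ(h)`. -/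
def IsCocommutative (h : W) : Prop :=
  TensorProduct.comm ℂ W W (comul h) = comul h

/-- The product of `Ŵ`: `(φψ)(x) = Σ φ(x⁽¹⁾) ψ(x⁽²⁾)`. -/
def dualMul (φ ψ : Dual ℂ W) : Dual ℂ W :=
  TensorProduct.dualDistrib ℂ W W (φ ⊗ₜ[ℂ] ψ) ∘ₗ comul

variable (W)

/-- The coproduct of `Ŵ`, dual to the product of `W`: `⟨Δ̂(φ), x ⊗ y⟩ = φ(xy)`. -/
def dualComul [FiniteDimensional ℂ W] : Dual ℂ W →ₗ[ℂ] Dual ℂ W ⊗[ℂ] Dual ℂ W :=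
  (TensorProduct.dualDistribEquiv ℂ W W).symm.toLinearMap ∘ₗ (LinearMap.mul' ℂ W).dualMap

variable {W}

/-- `φ ∈ Cocom(Ŵ)`. -/
def IsDualCocommutative [FiniteDimensional ℂ W] (φ : Dual ℂ W) : Prop :=
  TensorProduct.comm ℂ (Dual ℂ W) (Dual ℂ W) (dualComul W φ) = dualComul W φ

/-- `x ⇀ φ = Σ φ⁽¹⁾ ⟨φ⁽²⁾, x⟩`, the functional `z ↦ φ(z x)`. -/
def harpoonLeft (x : W) (φ : Dual ℂ W) : Dual ℂ W := φ ∘ₗ LinearMap.mulRight ℂ x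

/-- `φ ↼ x = Σ ⟨φ⁽¹⁾, x⟩ φ⁽²⁾`, the functional `z ↦ φ(x z)`. -/
def harpoonRight (φ : Dual ℂ W) (x : W) : Dual ℂ W := φ ∘ₗ LinearMap.mulLeft ℂ x

/-! ### The dual of the quantum double -/

variable (W)

/-- The subspace `J` of `Ŵᶜᵒᵖ ⊗ W` with `D(W) = (Ŵᶜᵒᵖ ⊗ W) / J`. -/
def doubleIdeal : Submodule ℂ (Dual ℂ W ⊗[ℂ] W) :=
  Submodule.span ℂ
    ({z | ∃ (φ : Dual ℂ W) (h : W), ∃ x ∈ Set.range (epsL W),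
        z = φ ⊗ₜ[ℂ] (x * h) - dualMul φ (harpoonLeft x counit) ⊗ₜ[ℂ] h} ∪
     {z | ∃ (φ : Dual ℂ W) (h : W), ∃ y ∈ Set.range (epsR W),
        z = φ ⊗ₜ[ℂ] (y * h) - dualMul φ (harpoonRight counit y) ⊗ₜ[ℂ] h})

/-- The identification of `W ⊗ Ŵ` with the dual of `Ŵ ⊗ W`:
`⟨g ⊗ ψ, φ ⊗ h⟩ = φ(g) ψ(h)`. -/
def doublePairing : W ⊗[ℂ] Dual ℂ W →ₗ[ℂ] Dual ℂ (Dual ℂ W ⊗[ℂ] W) :=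
  TensorProduct.dualDistrib ℂ (Dual ℂ W) W ∘ₗ (Dual.eval ℂ W).rTensor (Dual ℂ W)

/-- `D(W)^∨`, as the subspace of `W ⊗ Ŵ` of the elements that vanish on `J`. -/
def doubleDual : Submodule ℂ (W ⊗[ℂ] Dual ℂ W) :=
  (doubleIdeal W).dualAnnihilator.comap (doublePairing W)

/-- `k₁ ⊗ k₂ ⊗ k₃ ↦ (g ⊗ φ ↦ S⁻¹(k₃) g k₁ ⊗ φ(k₂ •))`. -/
def twist : W ⊗[ℂ] (W ⊗[ℂ] W) →ₗ[ℂ] Module.End ℂ (W ⊗[ℂ] Dual ℂ W) :=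
  TensorProduct.homTensorHomMap (.id ℂ) W (Dual ℂ W) W (Dual ℂ W) ∘ₗ
    TensorProduct.map
      (TensorProduct.lift
        (LinearMap.mk₂ ℂ
          (fun k₁ k₃ : W =>
            (LinearMap.mulLeft ℂ (antipodeInv W k₃) ∘ₗ LinearMap.mulRight ℂ k₁ :
              Module.End ℂ W))
          (by intros; ext; simp [mul_add]) (by intros; ext; simp)
          (by intros; ext; simp [add_mul]) (by intros; ext; simp)))
      (Dual.transpose (R := ℂ) (M := W) (M' := W) ∘ₗ LinearMap.mul ℂ W) ∘ₗ
    (TensorProduct.assoc ℂ W W W).symm.toLinearMap ∘ₗ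
    (TensorProduct.comm ℂ W W).toLinearMap.lTensor W

/-- The coproduct of `W ⊗ Ŵ = (Ŵᶜᵒᵖ ⊗ W)^∨`:
`Δ(h ⊗ φ) = Σ_k Σ (h⁽¹⁾ ⊗ k̂) ⊗ (S⁻¹(k⁽³⁾) h⁽²⁾ k⁽¹⁾ ⊗ φ(k⁽²⁾ •))`, where `k` runs through a basis
of `W` and `k̂` through the dual basis of `Ŵ`. -/
def ribbonComul [FiniteDimensional ℂ W] :
    W ⊗[ℂ] Dual ℂ W →ₗ[ℂ] (W ⊗[ℂ] Dual ℂ W) ⊗[ℂ] (W ⊗[ℂ] Dual ℂ W) :=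
  ∑ i, TensorProduct.map
      ((TensorProduct.mk ℂ W (Dual ℂ W)).flip ((Module.finBasis ℂ W).coord i))
      (twist W (comul₂ W (Module.finBasis ℂ W i))) ∘ₗ
    (TensorProduct.assoc ℂ W W (Dual ℂ W)).toLinearMap ∘ₗ
    (comul (R := ℂ) (A := W)).rTensor (Dual ℂ W)

/-! ### The actions on one edge -/

/-- `L₊ʰ x = h x` -/
def Lplus : W →ₗ[ℂ] Module.End ℂ W := LinearMap.mul ℂ W

/-- `L₋ʰ x = x S⁻¹(h)` -/
def Lminus : W →ₗ[ℂ] Module.End ℂ W := (LinearMap.mul ℂ W).flip ∘ₗ antipodeInv W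

/-- `L̃₋ʰ x = x h` -/
def tLminus : W →ₗ[ℂ] Module.End ℂ W := (LinearMap.mul ℂ W).flip

/-- `L̃₊ʰ x = S⁻¹(h) x` -/
def tLplus : W →ₗ[ℂ] Module.End ℂ W := LinearMap.mul ℂ W ∘ₗ antipodeInv W

/-- `T₊^φ x = Σ φ(x⁽²⁾) x⁽¹⁾` -/
def Tplus : Dual ℂ W →ₗ[ℂ] Module.End ℂ W where
  toFun φ := (TensorProduct.rid ℂ W).toLinearMap ∘ₗ φ.lTensor W ∘ₗ comul
  map_add' φ ψ := by simp [LinearMap.lTensor_add, LinearMap.comp_add, LinearMap.add_comp]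
  map_smul' c φ := by simp [LinearMap.lTensor_smul, LinearMap.comp_smul, LinearMap.smul_comp]

/-- `T̃₋^φ x = Σ φ(x⁽¹⁾) x⁽²⁾` -/
def tTminus : Dual ℂ W →ₗ[ℂ] Module.End ℂ W where
  toFun φ := (TensorProduct.lid ℂ W).toLinearMap ∘ₗ φ.rTensor W ∘ₗ comul
  map_add' φ ψ := by simp [LinearMap.rTensor_add, LinearMap.comp_add, LinearMap.add_comp]
  map_smul' c φ := by simp [LinearMap.rTensor_smul, LinearMap.comp_smul, LinearMap.smul_comp]

/-- `T₋^φ x = Σ φ(S(x⁽¹⁾)) x⁽²⁾` -/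
def Tminus : Dual ℂ W →ₗ[ℂ] Module.End ℂ W :=
  tTminus W ∘ₗ (WeakHopfAlgebra.antipode (W := W)).dualMap

/-- `T̃₊^φ x = Σ φ(S(x⁽²⁾)) x⁽¹⁾` -/
def tTplus : Dual ℂ W →ₗ[ℂ] Module.End ℂ W :=
  Tplus W ∘ₗ (WeakHopfAlgebra.antipode (W := W)).dualMap

end Algebra

/-- `c ↦ Σ f₁(c⁽¹⁾) f₂(c⁽²⁾) ⋯ fₙ(c⁽ⁿ⁾)` for a coproduct `δ` and a nonempty list `[f₁, …, fₙ]`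
(with junk value `0` on the empty list). -/
def sweedlerProd {C A : Type*} [AddCommGroup C] [Module ℂ C] [Ring A] [Algebra ℂ A]
    (δ : C →ₗ[ℂ] C ⊗[ℂ] C) : List (C →ₗ[ℂ] A) → (C →ₗ[ℂ] A)
  | [] => 0
  | [f] => f
  | f :: g :: l =>
      LinearMap.mul' ℂ A ∘ₗ TensorProduct.map f (sweedlerProd δ (g :: l)) ∘ₗ δ

/-! ### Directed cellulations of closed oriented surfaces -/

/-- An end of a directed edge: `(e, false)` is the end of `e` at its starting vertex and
`(e, true)` the end of `e` at its terminal vertex. An end is also read as the edge travelled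
away from that end (along its direction for `(e, false)`, against it for `(e, true)`). -/
abbrev Dart (E : Type*) := E × Bool

/-- The same edge travelled in the other sense. -/
def Dart.rev {E : Type*} : Equiv.Perm (Dart E) :=
  (Equiv.refl E).prodCongr ⟨not, not, Bool.not_not, Bool.not_not⟩

/-- A directed cellulation of a closed oriented surface, as a rotation system: `rot` sends an
edge end to the next one counterclockwise around the same vertex. -/
structure Cellulation (E : Type*) where
  rot : Equiv.Perm (Dart E)

/-- The sites are the corners of the cellulation (a vertex together with an adjacent face): the
site `d` is the corner at the vertex of `d` which lies between `d` and the next end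
counterclockwise; its face is the one to the left of `d`. -/
abbrev Site (E : Type*) := Dart E

namespace Cellulation

variable {E : Type*} (L : Cellulation E)

/-- The next edge along the boundary of the face to the left of a dart (counterclockwise around
the face): cross the edge, then turn as far left as possible. -/
def next : Equiv.Perm (Dart E) := Dart.rev.trans L.rot⁻¹

/-- The vertices are the cycles of `rot`. -/
def Vertex : Type _ := Quotient (Equiv.Perm.SameCycle.setoid L.rot)

/-- The faces are the cycles of `next`. -/
def Face : Type _ := Quotient (Equiv.Perm.SameCycle.setoid L.next)

/-- The vertex of a site. -/
def vertex (s : Site E) : L.Vertex := Quotient.mk _ s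

/-- The face of a site. -/
def face (s : Site E) : L.Face := Quotient.mk _ s

/-- The edge ends around the vertex of `s`, counterclockwise, with the origin at `s`. -/
def star (s : Site E) : List (Dart E) :=
  (List.range (Function.minimalPeriod L.rot s)).map fun i => (L.rot ^ (i + 1)) s

/-- The edges around the face of `s`, counterclockwise, with the origin at `s`. -/
def boundary (s : Site E) : List (Dart E) :=
  (List.range (Function.minimalPeriod L.next s)).map fun i => (L.next ^ i) s

end Cellulation

/-- Triangles. A direct triangle runs along an edge inside a face, a dual triangle runs across an
edge around a vertex. `R` and `L` tell whether the (dual) edge is on the right or on the left. -/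
inductive Triangle (E : Type*)
  /-- along `d`, in the face to the left of `d` -/
  | directR (d : Dart E)
  /-- against `d`, in the face to the left of `d` -/
  | directL (d : Dart E)
  /-- across `d`, counterclockwise around the vertex of `d` -/
  | dualR (d : Dart E)
  /-- across `d`, clockwise around the vertex of `d` -/
  | dualL (d : Dart E)

namespace Triangle

variable {E : Type*}

/-- The starting site. -/
def source (L : Cellulation E) : Triangle E → Site E
  | directR d => d
  | directL d => L.next d
  | dualR d => L.rot⁻¹ d
  | dualL d => d

/-- The ending site. -/
def target (L : Cellulation E) : Triangle E → Site E
  | directR d => L.next d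
  | directL d => d
  | dualR d => d
  | dualL d => L.rot⁻¹ d

/-- The part of the surface covered by a triangle. The barycentric subdivision cuts the surface
into pieces, two for each edge end `d`: one to the left of `d` (`(d, true)`) and one to its right
(`(d, false)`). -/
def region : Triangle E → Set (Dart E × Bool)
  | directR d | directL d => {(d, true), (Dart.rev d, false)}
  | dualR d | dualL d => {(d, true), (d, false)}

end Triangle

/-- The two types of ribbons. -/
inductive RibbonType
  | A
  | B

/-- Type A: left-handed direct and right-handed dual triangles.
Type B: right-handed direct and left-handed dual triangles. -/
def Triangle.HasType {E : Type*} : Triangle E → RibbonType → Prop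
  | directR _, c => c = .B
  | directL _, c => c = .A
  | dualR _, c => c = .A
  | dualL _, c => c = .B

/-- A ribbon: a nonempty sequence of consecutive triangles without self-overlap, of type A or B. -/
structure Ribbon {E : Type*} (L : Cellulation E) where
  type : RibbonType
  triangles : List (Triangle E)
  ne_nil : triangles ≠ []
  consecutive : triangles.IsChain fun τ τ' => τ.target L = τ'.source L
  hasType : ∀ τ ∈ triangles, τ.HasType type
  no_overlap : triangles.Pairwise fun τ τ' => Disjoint τ.region τ'.region

namespace Ribbon

variable {E : Type*} {L : Cellulation E}

/-- The starting site `∂₀ρ`. -/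
def initialSite (ρ : Ribbon L) : Site E := (ρ.triangles.head ρ.ne_nil).source L

/-- The ending site `∂₁ρ`. -/
def finalSite (ρ : Ribbon L) : Site E := (ρ.triangles.getLast ρ.ne_nil).target L

end Ribbon

/-! ### The operators of the lattice model -/

section Operators

variable (W : Type*) [Ring W] [Algebra ℂ W] [WeakHopfAlgebra W]
variable {E : Type*} [DecidableEq E]

/-- The total space `⨂_{e} W`. -/
abbrev TotalSpace (E : Type*) : Type _ := ⨂[ℂ] _ : E, W

/-- An operator acting on the tensor factor of the edge `e`. -/
def onEdge (e : E) : Module.End ℂ W →ₗ[ℂ] Module.End ℂ (TotalSpace W E) :=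
  (PiTensorProduct.mapMultilinear ℂ (fun _ : E => W) (fun _ : E => W)).toLinearMap
    (fun _ => LinearMap.id) e

/-- The action of `W` at an edge end, from the vertex: `L₋` at the start, `L₊` at the
terminal end. -/
def vertexAct (d : Dart E) : W →ₗ[ℂ] Module.End ℂ (TotalSpace W E) :=
  onEdge W d.1 ∘ₗ (bif d.2 then Lplus W else Lminus W)

/-- The action of `Ŵ` on the edge of `d`, from the face to the left of `d`: that face is the
ending face of the dual edge when `d` is the edge in its own direction (`T₋`), and the starting
face otherwise (`T₊`). -/
def faceAct (d : Dart E) : Dual ℂ W →ₗ[ℂ] Module.End ℂ (TotalSpace W E) :=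
  onEdge W d.1 ∘ₗ (bif d.2 then Tplus W else Tminus W)

variable {W}

/-- The vertex operator `Aʰ(s)`. -/
def vertexOp (L : Cellulation E) (s : Site E) (h : W) : Module.End ℂ (TotalSpace W E) :=
  sweedlerProd comul ((L.star s).map (vertexAct W)) h

/-- The face operator `B^φ(s)`. -/
def faceOp [FiniteDimensional ℂ W] (L : Cellulation E) (s : Site E) (φ : Dual ℂ W) :
    Module.End ℂ (TotalSpace W E) :=
  sweedlerProd (dualComul W) ((L.boundary s).map (faceAct W)) φ

variable (W)

/-- `h ⊗ φ ↦ ε(h) T^φ` on the edge `e`. -/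
def directOp (e : E) (T : Dual ℂ W →ₗ[ℂ] Module.End ℂ W) :
    W ⊗[ℂ] Dual ℂ W →ₗ[ℂ] Module.End ℂ (TotalSpace W E) :=
  onEdge W e ∘ₗ T ∘ₗ (TensorProduct.lid ℂ (Dual ℂ W)).toLinearMap ∘ₗ
    (counit (R := ℂ) (A := W)).rTensor (Dual ℂ W)

/-- `h ⊗ φ ↦ ε̂(φ) Kʰ` on the edge `e`, where `ε̂(φ) = φ(1)`. -/
def dualOp (e : E) (K : W →ₗ[ℂ] Module.End ℂ W) :
    W ⊗[ℂ] Dual ℂ W →ₗ[ℂ] Module.End ℂ (TotalSpace W E) :=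
  onEdge W e ∘ₗ K ∘ₗ (TensorProduct.rid ℂ W).toLinearMap ∘ₗ
    (Dual.eval ℂ W 1).lTensor W

/-- The triangle operators `F^{h,φ}(τ)`. The direction of the triangle and of its (dual) edge
agree exactly in the cases `directR (e, false)`, `directL (e, true)`, `dualR (e, false)` and
`dualL (e, true)`; the dual edge is the edge turned counterclockwise by `π/2`. -/
def triangleOp : Triangle E → (W ⊗[ℂ] Dual ℂ W →ₗ[ℂ] Module.End ℂ (TotalSpace W E))
  | .directR (e, false) => directOp W e (Tminus W)
  | .directR (e, true) => directOp W e (Tplus W)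
  | .directL (e, false) => directOp W e (tTminus W)
  | .directL (e, true) => directOp W e (tTplus W)
  | .dualR (e, false) => dualOp W e (Lminus W)
  | .dualR (e, true) => dualOp W e (Lplus W)
  | .dualL (e, false) => dualOp W e (tLminus W)
  | .dualL (e, true) => dualOp W e (tLplus W)

variable {W}

/-- The ribbon operator `F^t(ρ)`, linear in `t ∈ W ⊗ Ŵ` (with `F^{h,φ}(ρ)` at `t = h ⊗ φ`):
`F^t(τ₁ ∪ ρ') = Σ F^{t⁽¹⁾}(τ₁) F^{t⁽²⁾}(ρ')` for the coproduct of `(Ŵᶜᵒᵖ ⊗ W)^∨`. -/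
def ribbonOp [FiniteDimensional ℂ W] {L : Cellulation E} (ρ : Ribbon L)
    (t : W ⊗[ℂ] Dual ℂ W) : Module.End ℂ (TotalSpace W E) :=
  sweedlerProd (ribbonComul W) (ρ.triangles.map (triangleOp W)) t

end Operators

end WeakHopf

end

/-! The idea is to study the whole map `t ↦ F^t` at once. Every triangle acts on operator-valued
maps `Q` on `W ⊗ Ŵ` by the star product of its operator with `Q` (`starOp`). The product of these
star operators, applied to the scalar-valued map `starUnit`, is the ribbon operator up to the
idempotent `lam 1`, and this idempotent fixes `D(W)^∨` (`prod_starOp_starUnit`, `lam_one_of_mem`).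
Star operators always commute with right multiplication by an operator `x`, and on a scalar-valued
map left and right multiplication by `x` agree. So it is enough that the product of the star
operators commutes with left multiplication by `A^h(s)` or `B^φ(s)` (`commute_ribbonOp`).

The star operators become explicit once `W ⊗ Ŵ` is given an action `lam` (which reverses products)
and a coaction `coact` of `W`, tied together by a Yetter–Drinfeld condition (`coact_lam`). A dual
triangle multiplies by an edge operator labelled by the coaction (`starVertex`). A direct triangle
sums over dual bases and uses the action (`starFace`). Passing such an operator through one factor
`α x` of a vertex or face operator either changes nothing or leaves a trace `ν` on the label `t`:
`ν` is precomposition with `lam` for vertex operators and with the contracted coaction `coactDual`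
for face operators. There are three kinds of nontrivial relation. Turning across `x` carries `ν`
from one side of `α x` to the other; these relations are the exchange laws `coact_exchange` and
`coact_exchange'`. Moving away along the edge of `x` emits `ν`, and arriving along an edge absorbs
it; these relations come from identities on a single copy of `W` (`fOp_mul_vOp`, `sum_fOp_mul_vOp`
and their variants).

What remains is combinatorics of a path and a circle of edge ends or face sides. A product over an
arc commutes with the path operator if the path starts outside the arc, and picks up one `ν` in
front if it starts at the head of the arc (`transport_arc`). Since triangles do not overlap, no gap
of the circle is entered twice, so arcs can be cut at the visited gaps. If neither end of the path
lies on the circle, every emitted `ν` is absorbed again (`transport_circle`). Closing the circle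
requires cyclic rotation of the product, and this is what cocommutativity of `h` or `φ` provides.
The relations live in the convolution ring `Hom(C, B)` with `C = W` or `C = Ŵ`, where the Sweedler
legs of `h` or `φ` become factors of an ordinary product.

All exchange laws need `S² = 1`, which a cocommutative Haar integral forces
(`antipode_antipode_of_haar`). Conjugation with `S` exchanges the two directions of an edge. The two
cases in which the ribbon runs against the order of the Sweedler legs are reduced to the other two
by passing to the co-opposite coalgebra. -/

noncomputable section

namespace WeakHopf

open Coalgebra WeakHopfAlgebra TensorProduct WithConv

set_option linter.unusedSectionVars false

section Shortcuts

variable {M N : Type*} [AddCommMonoid M] [AddCommMonoid N] [Module ℂ M] [Module ℂ N]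

instance linearMap_zeroHomClass : ZeroHomClass (M →ₗ[ℂ] N) M N := inferInstance
instance linearMap_addHomClass : AddHomClass (M →ₗ[ℂ] N) M N := inferInstance
instance linearEquiv_zeroHomClass : ZeroHomClass (M ≃ₗ[ℂ] N) M N := inferInstance
instance linearEquiv_addHomClass : AddHomClass (M ≃ₗ[ℂ] N) M N := inferInstance

instance tensor_nonUnitalNonAssocSemiring {A B : Type*} [Ring A] [Algebra ℂ A] [Ring B]
    [Algebra ℂ B] : NonUnitalNonAssocSemiring (A ⊗[ℂ] B) := inferInstance

end Shortcuts

/-! ### Counital maps and the legs of `Δ(1)`. -/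

section Basics

variable {W : Type*} [Ring W] [Algebra ℂ W] [WeakHopfAlgebra W]

variable (W) in
/-- The left counital map as a linear map. -/
def eL : W →ₗ[ℂ] W :=
  (TensorProduct.lid ℂ W).toLinearMap ∘ₗ (counit (R := ℂ) (A := W)).rTensor W ∘ₗ
    LinearMap.mulLeft ℂ (comul (R := ℂ) (1 : W)) ∘ₗ (TensorProduct.mk ℂ W W).flip 1

variable (W) in
/-- The right counital map as a linear map. -/
def eR : W →ₗ[ℂ] W :=
  (TensorProduct.rid ℂ W).toLinearMap ∘ₗ (counit (R := ℂ) (A := W)).lTensor W ∘ₗ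
    LinearMap.mulRight ℂ (comul (R := ℂ) (1 : W)) ∘ₗ TensorProduct.mk ℂ W W 1

variable (W) in
/-- The antipode of `W`. -/
abbrev S : W →ₗ[ℂ] W := WeakHopfAlgebra.antipode (W := W)

variable (W) in
/-- The comultiplication of `W`. -/
abbrev Δ : W →ₗ[ℂ] W ⊗[ℂ] W := comul (R := ℂ) (A := W)

variable (W) in
/-- The counit of `W`. -/
abbrev ε : W →ₗ[ℂ] ℂ := counit (R := ℂ) (A := W)

lemma epsL_eq (h : W) : epsL W h = eL W h := rfl
lemma epsR_eq (h : W) : epsR W h = eR W h := rfl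

lemma eL_def (h : W) : eL W h = TensorProduct.lid ℂ W ((ε W).rTensor W (Δ W 1 * (h ⊗ₜ[ℂ] 1))) := rfl
lemma eR_def (h : W) : eR W h = TensorProduct.rid ℂ W ((ε W).lTensor W ((1 ⊗ₜ[ℂ] h) * Δ W 1)) := rfl

lemma comul_one_mul_comul (h : W) : Δ W 1 * Δ W h = Δ W h := by
  rw [← comul_mul, one_mul]

lemma comul_mul_comul_one (h : W) : Δ W h * Δ W 1 = Δ W h := by
  rw [← comul_mul, mul_one]

lemma assoc_rTensor_comul (h : W) :
    TensorProduct.assoc ℂ W W W ((Δ W).rTensor W (Δ W h)) = (Δ W).lTensor W (Δ W h) :=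
  coassoc_apply h

lemma lTensor_counit_assoc_rTensor_comul (z : W ⊗[ℂ] W) :
    ((TensorProduct.lid ℂ W).toLinearMap ∘ₗ (ε W).rTensor W).lTensor W
      (TensorProduct.assoc ℂ W W W ((Δ W).rTensor W z)) = z := by
  induction z using TensorProduct.induction_on with
  | zero => simp
  | add x y hx hy => simp_all
  | tmul a b =>
    have : ∀ u : W ⊗[ℂ] W, ((TensorProduct.lid ℂ W).toLinearMap ∘ₗ (ε W).rTensor W).lTensor W
      (TensorProduct.assoc ℂ W W W (u ⊗ₜ b)) =
        TensorProduct.rid ℂ W ((ε W).lTensor W u) ⊗ₜ b := by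
      intro u
      induction u using TensorProduct.induction_on with
      | zero => simp
      | add x y hx hy => simp_all [add_tmul]
      | tmul c d => simp [smul_tmul']
    simp only [LinearMap.rTensor_tmul, this]
    simp

lemma rTensor_counit_lTensor_comul (z : W ⊗[ℂ] W) :
    ((TensorProduct.rid ℂ W).toLinearMap ∘ₗ (ε W).lTensor W).rTensor W
      ((TensorProduct.assoc ℂ W W W).symm ((Δ W).lTensor W z)) = z := by
  induction z using TensorProduct.induction_on with
  | zero => simp
  | add x y hx hy => simp_all
  | tmul a b =>
    have : ∀ u : W ⊗[ℂ] W, ((TensorProduct.rid ℂ W).toLinearMap ∘ₗ (ε W).lTensor W).rTensor W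
      ((TensorProduct.assoc ℂ W W W).symm (a ⊗ₜ u)) =
        a ⊗ₜ TensorProduct.lid ℂ W ((ε W).rTensor W u) := by
      intro u
      induction u using TensorProduct.induction_on with
      | zero => simp
      | add x y hx hy => simp_all [tmul_add]
      | tmul c d => simp [smul_tmul']
    simp only [LinearMap.lTensor_tmul, this]
    simp

lemma assoc_mul (x y : (W ⊗[ℂ] W) ⊗[ℂ] W) : TensorProduct.assoc ℂ W W W (x * y) =
    TensorProduct.assoc ℂ W W W x * TensorProduct.assoc ℂ W W W y :=
  map_mul (Algebra.TensorProduct.assoc ℂ ℂ ℂ W W W) x y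

/-- `Σ h⁽¹⁾ ⊗ ε_L(h⁽²⁾) = Σ 1⁽¹⁾ h ⊗ 1⁽²⁾` -/
lemma lTensor_eL (h : W) : (eL W).lTensor W (Δ W h) = Δ W 1 * (h ⊗ₜ[ℂ] 1) := by
  have h1 : ∀ z : W ⊗[ℂ] W, TensorProduct.assoc ℂ W W W ((Δ W).rTensor W z) *
      TensorProduct.assoc ℂ W W W (Δ W h ⊗ₜ 1) =
      TensorProduct.assoc ℂ W W W ((Δ W).rTensor W (z * (h ⊗ₜ[ℂ] 1))) := by
    intro z
    induction z using TensorProduct.induction_on with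
    | zero => simp
    | add x y hx hy => simp_all [add_mul]
    | tmul a b => simp [comul_mul, ← assoc_mul]
  have h2 : ∀ z : W ⊗[ℂ] W, ((TensorProduct.lid ℂ W).toLinearMap ∘ₗ (ε W).rTensor W).lTensor W
      (((1 : W) ⊗ₜ[ℂ] Δ W 1) * TensorProduct.assoc ℂ W W W (z ⊗ₜ 1)) = (eL W).lTensor W z := by
    intro z
    induction z using TensorProduct.induction_on with
    | zero => simp
    | add x y hx hy => simp_all [add_tmul, mul_add]
    | tmul a b => simp [eL_def]
  -- Of the two factorizations of `Δ₂(1)`, the one with `Δ(1) ⊗ 1` on the right is needed here,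
  -- because `Δ(h) ⊗ 1` absorbs that factor.
  have h3 : TensorProduct.assoc ℂ W W W (Δ W 1 ⊗ₜ[ℂ] (1 : W)) *
      TensorProduct.assoc ℂ W W W (Δ W h ⊗ₜ 1) = TensorProduct.assoc ℂ W W W (Δ W h ⊗ₜ 1) := by
    simp [← assoc_mul, comul_one_mul_comul]
  rw [← h2, ← h3, ← mul_assoc, ← comul_one_right, comul₂, LinearMap.comp_apply,
    ← assoc_rTensor_comul, h1, lTensor_counit_assoc_rTensor_comul]

/-- `Σ ε_R(h⁽¹⁾) ⊗ h⁽²⁾ = Σ 1⁽¹⁾ ⊗ h 1⁽²⁾` -/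
lemma rTensor_eR (h : W) : (eR W).rTensor W (Δ W h) = (1 ⊗ₜ[ℂ] h) * Δ W 1 := by
  have h1 : ∀ z : W ⊗[ℂ] W, ((1 : W) ⊗ₜ[ℂ] Δ W h) * (Δ W).lTensor W z =
      (Δ W).lTensor W ((1 ⊗ₜ[ℂ] h) * z) := by
    intro z
    induction z using TensorProduct.induction_on with
    | zero => simp
    | add x y hx hy => simp_all [mul_add]
    | tmul a b => simp [comul_mul]
  have h2 : ∀ z : W ⊗[ℂ] W, ((TensorProduct.rid ℂ W).toLinearMap ∘ₗ (ε W).lTensor W).rTensor W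
      ((TensorProduct.assoc ℂ W W W).symm (((1 : W) ⊗ₜ[ℂ] z) *
        TensorProduct.assoc ℂ W W W (Δ W 1 ⊗ₜ 1))) = (eR W).rTensor W z := by
    intro z
    induction z using TensorProduct.induction_on with
    | zero => simp
    | add x y hx hy => simp_all [tmul_add, add_mul]
    | tmul a b =>
      have : ((1 : W) ⊗ₜ[ℂ] (a ⊗ₜ[ℂ] b)) = TensorProduct.assoc ℂ W W W ((1 ⊗ₜ a) ⊗ₜ b) := by simp
      rw [this, ← assoc_mul]
      simp [eR_def]
  have h3 : ((1 : W) ⊗ₜ[ℂ] Δ W h) * ((1 : W) ⊗ₜ[ℂ] Δ W 1) = (1 : W) ⊗ₜ[ℂ] Δ W h := by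
    simp [comul_mul_comul_one]
  rw [← h2, ← h3, mul_assoc, ← comul_one_right, comul₂, LinearMap.comp_apply, h1,
    rTensor_counit_lTensor_comul]

lemma lTensor_eL_one : (eL W).lTensor W (Δ W 1) = Δ W 1 := by
  rw [lTensor_eL, ← Algebra.TensorProduct.one_def, mul_one]

lemma rTensor_eR_one : (eR W).rTensor W (Δ W 1) = Δ W 1 := by
  rw [rTensor_eR, ← Algebra.TensorProduct.one_def, one_mul]

/-- `Δ(1) ∈ W_R ⊗ W_L` -/
lemma map_eR_eL_one : TensorProduct.map (eR W) (eL W) (Δ W 1) = Δ W 1 := by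
  rw [← LinearMap.lTensor_comp_rTensor, LinearMap.comp_apply, rTensor_eR_one, lTensor_eL_one]

/-- This is the weak multiplicativity `ε(zh) = Σ ε(z1⁽²⁾) ε(1⁽¹⁾h)`: inside `ε`, a factor on the
right may be replaced by its projection to `W_L`. -/
lemma counit_mul_eL (z h : W) : ε W (z * eL W h) = ε W (z * h) := by
  have := counit_mul_right z 1 h
  rw [mul_one] at this
  rw [this, eL_def]
  generalize (comul (R := ℂ) (1 : W)) = u
  induction u using TensorProduct.induction_on with
  | zero => simp
  | add x y hx hy => simp_all [mul_add, add_mul]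
  | tmul a b => simp [mul_comm]

lemma counit_eR_mul (z h : W) : ε W (eR W z * h) = ε W (z * h) := by
  have := counit_mul_right z 1 h
  rw [mul_one] at this
  rw [this, eR_def]
  generalize (comul (R := ℂ) (1 : W)) = u
  induction u using TensorProduct.induction_on with
  | zero => simp
  | add x y hx hy => simp_all [mul_add, add_mul]
  | tmul a b => simp

/-- The elements of `W_L` commute with those of `W_R`. -/
lemma eL_mul_eR (h k : W) : eL W h * eR W k = eR W k * eL W h := by
  -- Both factorizations of `Δ₂(1)` are contracted with `ε(• h)` on the first leg and `ε(k •)` on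
  -- the third. The middle leg then carries the two products, in the two orders.
  have key := (comul_one_left (W := W)).symm.trans comul_one_right
  apply_fun (TensorProduct.lid ℂ W).toLinearMap ∘ₗ TensorProduct.map (ε W ∘ₗ LinearMap.mulRight ℂ h)
    ((TensorProduct.rid ℂ W).toLinearMap ∘ₗ
      (ε W ∘ₗ LinearMap.mulLeft ℂ k).lTensor W) at key
  have e1 : ∀ u v : W ⊗[ℂ] W, ((TensorProduct.lid ℂ W).toLinearMap ∘ₗ
      TensorProduct.map (ε W ∘ₗ LinearMap.mulRight ℂ h) ((TensorProduct.rid ℂ W).toLinearMap ∘ₗ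
      (ε W ∘ₗ LinearMap.mulLeft ℂ k).lTensor W))
        (TensorProduct.assoc ℂ W W W (u ⊗ₜ[ℂ] (1 : W)) * ((1 : W) ⊗ₜ[ℂ] v)) =
      TensorProduct.lid ℂ W ((ε W).rTensor W (u * (h ⊗ₜ[ℂ] 1))) *
        TensorProduct.rid ℂ W ((ε W).lTensor W ((1 ⊗ₜ[ℂ] k) * v)) := by
    intro u v
    induction u using TensorProduct.induction_on with
    | zero => simp
    | add x y hx hy => simp_all [add_mul, add_tmul]
    | tmul a b =>
      induction v using TensorProduct.induction_on with
      | zero => simp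
      | add x y hx hy => simp_all [mul_add, tmul_add]
      | tmul c d => simp
  have e2 : ∀ u v : W ⊗[ℂ] W, ((TensorProduct.lid ℂ W).toLinearMap ∘ₗ
      TensorProduct.map (ε W ∘ₗ LinearMap.mulRight ℂ h) ((TensorProduct.rid ℂ W).toLinearMap ∘ₗ
      (ε W ∘ₗ LinearMap.mulLeft ℂ k).lTensor W))
        (((1 : W) ⊗ₜ[ℂ] v) * TensorProduct.assoc ℂ W W W (u ⊗ₜ[ℂ] (1 : W))) =
      TensorProduct.rid ℂ W ((ε W).lTensor W ((1 ⊗ₜ[ℂ] k) * v)) *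
      TensorProduct.lid ℂ W ((ε W).rTensor W (u * (h ⊗ₜ[ℂ] 1))) := by
    intro u v
    induction u using TensorProduct.induction_on with
    | zero => simp
    | add x y hx hy => simp_all [add_mul, mul_add, add_tmul]
    | tmul a b =>
      induction v using TensorProduct.induction_on with
      | zero => simp
      | add x y hx hy => simp_all [mul_add, add_mul, tmul_add]
      | tmul c d => simp [smul_smul, mul_comm]
  rw [e1, e2] at key
  exact key

/-- Contracting the first leg of `Δ₂(1)` with `ε(• h)` leaves `Δ(ε_L(h))`. This and its three
companions say that an element of `W_L` only enters the first leg of a coproduct and one of `W_R`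
only the second, on either side. -/
lemma comul_eL_left (h : W) : Δ W (eL W h) = Δ W 1 * (eL W h ⊗ₜ[ℂ] 1) := by
  have key := comul_one_right (W := W)
  rw [comul₂, LinearMap.comp_apply] at key
  apply_fun (TensorProduct.lid ℂ (W ⊗[ℂ] W)).toLinearMap ∘ₗ
    (ε W ∘ₗ LinearMap.mulRight ℂ h).rTensor (W ⊗[ℂ] W) at key
  have e1 : ∀ u : W ⊗[ℂ] W, ((TensorProduct.lid ℂ (W ⊗[ℂ] W)).toLinearMap ∘ₗ
    (ε W ∘ₗ LinearMap.mulRight ℂ h).rTensor (W ⊗[ℂ] W)) ((Δ W).lTensor W u) =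
      Δ W (TensorProduct.lid ℂ W ((ε W).rTensor W (u * (h ⊗ₜ[ℂ] 1)))) := by
    intro u
    induction u using TensorProduct.induction_on with
    | zero => simp
    | add x y hx hy => simp_all [add_mul]
    | tmul a b => simp
  have e2 : ∀ u : W ⊗[ℂ] W, ((TensorProduct.lid ℂ (W ⊗[ℂ] W)).toLinearMap ∘ₗ
    (ε W ∘ₗ LinearMap.mulRight ℂ h).rTensor (W ⊗[ℂ] W))
      (((1 : W) ⊗ₜ[ℂ] Δ W 1) * TensorProduct.assoc ℂ W W W (u ⊗ₜ[ℂ] (1 : W))) =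
      Δ W 1 * (TensorProduct.lid ℂ W ((ε W).rTensor W (u * (h ⊗ₜ[ℂ] 1))) ⊗ₜ 1) := by
    intro u
    induction u using TensorProduct.induction_on with
    | zero => simp
    | add x y hx hy => simp_all [add_mul, mul_add, add_tmul]
    | tmul a b => simp [← smul_tmul']
  rw [e1, e2] at key
  exact key

lemma comul_eL_right (h : W) : Δ W (eL W h) = (eL W h ⊗ₜ[ℂ] 1) * Δ W 1 := by
  have key := comul_one_left (W := W)
  rw [comul₂, LinearMap.comp_apply] at key
  apply_fun (TensorProduct.lid ℂ (W ⊗[ℂ] W)).toLinearMap ∘ₗ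
    (ε W ∘ₗ LinearMap.mulRight ℂ h).rTensor (W ⊗[ℂ] W) at key
  have e1 : ∀ u : W ⊗[ℂ] W, ((TensorProduct.lid ℂ (W ⊗[ℂ] W)).toLinearMap ∘ₗ
    (ε W ∘ₗ LinearMap.mulRight ℂ h).rTensor (W ⊗[ℂ] W)) ((Δ W).lTensor W u) =
      Δ W (TensorProduct.lid ℂ W ((ε W).rTensor W (u * (h ⊗ₜ[ℂ] 1)))) := by
    intro u
    induction u using TensorProduct.induction_on with
    | zero => simp
    | add x y hx hy => simp_all [add_mul]
    | tmul a b => simp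
  have e2 : ∀ u : W ⊗[ℂ] W, ((TensorProduct.lid ℂ (W ⊗[ℂ] W)).toLinearMap ∘ₗ
    (ε W ∘ₗ LinearMap.mulRight ℂ h).rTensor (W ⊗[ℂ] W))
      (TensorProduct.assoc ℂ W W W (u ⊗ₜ[ℂ] (1 : W)) * ((1 : W) ⊗ₜ[ℂ] Δ W 1)) =
      (TensorProduct.lid ℂ W ((ε W).rTensor W (u * (h ⊗ₜ[ℂ] 1))) ⊗ₜ 1) * Δ W 1 := by
    intro u
    induction u using TensorProduct.induction_on with
    | zero => simp
    | add x y hx hy => simp_all [add_mul, mul_add, add_tmul]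
    | tmul a b => simp [← smul_tmul']
  rw [e1, e2] at key
  exact key

lemma comul_eR_aux (k : W) (u : W ⊗[ℂ] W) :
    (TensorProduct.map (LinearMap.id : W →ₗ[ℂ] W) ((TensorProduct.rid ℂ W).toLinearMap ∘ₗ
      (ε W ∘ₗ LinearMap.mulLeft ℂ k).lTensor W))
      (TensorProduct.assoc ℂ W W W ((Δ W).rTensor W u)) =
      Δ W (TensorProduct.rid ℂ W ((ε W).lTensor W ((1 ⊗ₜ[ℂ] k) * u))) := by
  induction u using TensorProduct.induction_on with
  | zero => simp
  | add x y hx hy => simp_all [mul_add]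
  | tmul a b =>
    have : ∀ z : W ⊗[ℂ] W, (TensorProduct.map (LinearMap.id : W →ₗ[ℂ] W)
      ((TensorProduct.rid ℂ W).toLinearMap ∘ₗ (ε W ∘ₗ LinearMap.mulLeft ℂ k).lTensor W))
      (TensorProduct.assoc ℂ W W W (z ⊗ₜ b)) = ε W (k * b) • z := by
      intro z
      induction z using TensorProduct.induction_on with
      | zero => simp
      | add x y hx hy => simp_all [add_tmul]
      | tmul c d => simp
    simp [this]

lemma comul_eR_left (k : W) : Δ W (eR W k) = (1 ⊗ₜ[ℂ] eR W k) * Δ W 1 := by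
  have key := comul_one_right (W := W)
  rw [comul₂, LinearMap.comp_apply, ← assoc_rTensor_comul] at key
  apply_fun (TensorProduct.map (LinearMap.id : W →ₗ[ℂ] W) ((TensorProduct.rid ℂ W).toLinearMap ∘ₗ
      (ε W ∘ₗ LinearMap.mulLeft ℂ k).lTensor W)) at key
  have e2 : ∀ u v : W ⊗[ℂ] W, (TensorProduct.map (LinearMap.id : W →ₗ[ℂ] W)
      ((TensorProduct.rid ℂ W).toLinearMap ∘ₗ (ε W ∘ₗ LinearMap.mulLeft ℂ k).lTensor W))
      (((1 : W) ⊗ₜ[ℂ] u) * TensorProduct.assoc ℂ W W W (v ⊗ₜ[ℂ] (1 : W))) =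
      (1 ⊗ₜ (TensorProduct.rid ℂ W ((ε W).lTensor W ((1 ⊗ₜ[ℂ] k) * u)))) * v := by
    intro u v
    induction v using TensorProduct.induction_on with
    | zero => simp
    | add x y hx hy => simp_all [mul_add, add_tmul]
    | tmul a b =>
      induction u using TensorProduct.induction_on with
      | zero => simp
      | add x y hx hy => simp_all [mul_add, add_mul, tmul_add]
      | tmul c d => simp
  rw [comul_eR_aux, e2] at key
  exact key

lemma comul_eR_right (k : W) : Δ W (eR W k) = Δ W 1 * (1 ⊗ₜ[ℂ] eR W k) := by
  have key := comul_one_left (W := W)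
  rw [comul₂, LinearMap.comp_apply, ← assoc_rTensor_comul] at key
  apply_fun (TensorProduct.map (LinearMap.id : W →ₗ[ℂ] W) ((TensorProduct.rid ℂ W).toLinearMap ∘ₗ
      (ε W ∘ₗ LinearMap.mulLeft ℂ k).lTensor W)) at key
  have e2 : ∀ u v : W ⊗[ℂ] W, (TensorProduct.map (LinearMap.id : W →ₗ[ℂ] W)
      ((TensorProduct.rid ℂ W).toLinearMap ∘ₗ (ε W ∘ₗ LinearMap.mulLeft ℂ k).lTensor W))
      (TensorProduct.assoc ℂ W W W (v ⊗ₜ[ℂ] (1 : W)) * ((1 : W) ⊗ₜ[ℂ] u)) =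
      v * (1 ⊗ₜ (TensorProduct.rid ℂ W ((ε W).lTensor W ((1 ⊗ₜ[ℂ] k) * u)))) := by
    intro u v
    induction v using TensorProduct.induction_on with
    | zero => simp
    | add x y hx hy => simp_all [add_mul, add_tmul]
    | tmul a b =>
      induction u using TensorProduct.induction_on with
      | zero => simp
      | add x y hx hy => simp_all [mul_add, tmul_add]
      | tmul c d => simp
  rw [comul_eR_aux, e2] at key
  exact key

lemma comul_eL_mul (h z : W) : Δ W (eL W h * z) = (eL W h ⊗ₜ[ℂ] 1) * Δ W z := by
  rw [comul_mul, comul_eL_right, mul_assoc, comul_one_mul_comul]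

lemma comul_mul_eL (h z : W) : Δ W (z * eL W h) = Δ W z * (eL W h ⊗ₜ[ℂ] 1) := by
  rw [comul_mul, comul_eL_left, ← mul_assoc, comul_mul_comul_one]

lemma comul_eR_mul (h z : W) : Δ W (eR W h * z) = (1 ⊗ₜ[ℂ] eR W h) * Δ W z := by
  rw [comul_mul, comul_eR_left, mul_assoc, comul_one_mul_comul]

lemma comul_mul_eR (h z : W) : Δ W (z * eR W h) = Δ W z * (1 ⊗ₜ[ℂ] eR W h) := by
  rw [comul_mul, comul_eR_right, ← mul_assoc, comul_mul_comul_one]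

end Basics

/-! ### Constants in a convolution ring. -/

section ConvolutionConstants

variable {C A : Type*} [AddCommGroup C] [Module ℂ C] [Coalgebra ℂ C] [Ring A] [Algebra ℂ A]

variable (C) in
/-- The constant `a` in a convolution ring. -/
def convConst (a : A) : WithConv (C →ₗ[ℂ] A) :=
  toConv (LinearMap.toSpanSingleton ℂ A a ∘ₗ counit)

/-- The counit law removes the leg spent on the constant, so operators that do not depend on `h` can
be moved through Sweedler products as ring elements. -/
lemma convConst_mul_apply (a : A) (f : WithConv (C →ₗ[ℂ] A)) (h : C) :
    (convConst C a * f) h = a * f h := by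
  have e : ∀ z : C ⊗[ℂ] C, LinearMap.mul' ℂ A (TensorProduct.map (convConst C a).ofConv f.ofConv z) =
      a * f (TensorProduct.lid ℂ C ((counit (R := ℂ) (A := C)).rTensor C z)) := by
    intro z
    induction z using TensorProduct.induction_on with
    | zero => simp
    | add x y hx hy => simp only [map_add, hx, hy, mul_add]
    | tmul a b => simp [convConst]
  rw [LinearMap.convMul_apply, e]
  simp

lemma mul_convConst_apply (a : A) (f : WithConv (C →ₗ[ℂ] A)) (h : C) :
    (f * convConst C a) h = f h * a := by
  have e : ∀ z : C ⊗[ℂ] C, LinearMap.mul' ℂ A (TensorProduct.map f.ofConv (convConst C a).ofConv z) =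
      f (TensorProduct.rid ℂ C ((counit (R := ℂ) (A := C)).lTensor C z)) * a := by
    intro z
    induction z using TensorProduct.induction_on with
    | zero => simp
    | add x y hx hy => simp only [map_add, hx, hy, add_mul]
    | tmul a b => simp [convConst]
  rw [LinearMap.convMul_apply, e]
  simp

lemma convConst_mul_comm (a : A) (f : WithConv (C →ₗ[ℂ] A)) (hf : ∀ h, a * f h = f h * a) :
    convConst C a * f = f * convConst C a := by
  ext h
  rw [convConst_mul_apply, mul_convConst_apply, hf]

lemma convConst_mul_convConst (a b : A) :
    convConst C a * convConst C b = convConst C (a * b) := by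
  ext h
  rw [convConst_mul_apply]
  simp [convConst]

lemma convConst_one : convConst C (1 : A) = 1 := by
  ext h
  simp [convConst, Algebra.algebraMap_eq_smul_one]

end ConvolutionConstants

/-! ### Antimultiplicativity of the antipode. -/

section Antipode

variable {W : Type*} [Ring W] [Algebra ℂ W] [WeakHopfAlgebra W]

/-- Write `Δ(h) = Δ(1)Δ(h)` and expand `ε(a 1⁽¹⁾ h⁽¹⁾)` by weak multiplicativity. The new leg of `1`
multiplies `h⁽¹⁾` inside `ε`, and the counit law for `Δ(1⁽²⁾h)` removes it. -/
lemma counit_left_comul (a h : W) :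
    TensorProduct.lid ℂ W ((ε W ∘ₗ LinearMap.mulLeft ℂ a).rTensor W (Δ W h)) =
      TensorProduct.lid ℂ W ((ε W ∘ₗ LinearMap.mulLeft ℂ a).rTensor W (Δ W 1 * (1 ⊗ₜ h))) := by
  have e1 : ∀ u v : W ⊗[ℂ] W, (ε W ∘ₗ LinearMap.mulLeft ℂ a).rTensor W (u * v) =
      TensorProduct.map (ε W ∘ₗ LinearMap.mulLeft ℂ a)
        ((TensorProduct.lid ℂ W).toLinearMap ∘ₗ (ε W).rTensor W)
        (TensorProduct.assoc ℂ W W W ((Δ W).rTensor W u) * (1 ⊗ₜ v)) := by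
    intro u v
    induction v using TensorProduct.induction_on with
    | zero => simp
    | add x y hx hy => simp only [map_add, hx, hy, mul_add, tmul_add]
    | tmul q q' =>
      induction u using TensorProduct.induction_on with
      | zero => simp
      | add x y hx hy => simp only [map_add, hx, hy, add_mul]
      | tmul p p' =>
        simp only [Algebra.TensorProduct.tmul_mul_tmul, LinearMap.rTensor_tmul,
          LinearMap.comp_apply, LinearMap.mulLeft_apply, ← mul_assoc, counit_mul_left]
        generalize (comul (R := ℂ) p) = w
        induction w using TensorProduct.induction_on with
        | zero => simp
        | add x y hx hy => simp only [map_add, hx, hy, add_mul, add_tmul]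
        | tmul c d =>
          simp only [TensorProduct.map_tmul, LinearMap.mul'_apply, LinearMap.comp_apply,
            LinearMap.mulLeft_apply, LinearMap.mulRight_apply, TensorProduct.assoc_tmul,
            Algebra.TensorProduct.tmul_mul_tmul, LinearEquiv.coe_coe, LinearMap.rTensor_tmul,
            TensorProduct.lid_tmul, mul_one, mul_comm (counit (a * c))]
          rw [← smul_eq_mul, smul_tmul]
  have e2 : ∀ u : W ⊗[ℂ] W, (Δ W).lTensor W u * ((1 : W) ⊗ₜ Δ W h) =
      (Δ W).lTensor W (u * (1 ⊗ₜ h)) := by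
    intro u
    induction u using TensorProduct.induction_on with
    | zero => simp
    | add x y hx hy => simp only [map_add, hx, hy, add_mul]
    | tmul p p' => simp [comul_mul]
  have e3 : ∀ u : W ⊗[ℂ] W, TensorProduct.map (ε W ∘ₗ LinearMap.mulLeft ℂ a)
        ((TensorProduct.lid ℂ W).toLinearMap ∘ₗ (ε W).rTensor W) ((Δ W).lTensor W u) =
      (ε W ∘ₗ LinearMap.mulLeft ℂ a).rTensor W u := by
    intro u
    induction u using TensorProduct.induction_on with
    | zero => simp
    | add x y hx hy => simp only [map_add, hx, hy]
    | tmul p p' => simp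
  rw [← comul_one_mul_comul h, e1, assoc_rTensor_comul, e2, e3]

lemma counit_right_comul (b h : W) :
    TensorProduct.rid ℂ W ((ε W ∘ₗ LinearMap.mulRight ℂ b).lTensor W (Δ W h)) =
      TensorProduct.rid ℂ W ((ε W ∘ₗ LinearMap.mulRight ℂ b).lTensor W ((h ⊗ₜ 1) * Δ W 1)) := by
  have e1 : ∀ v u : W ⊗[ℂ] W, (ε W ∘ₗ LinearMap.mulRight ℂ b).lTensor W (u * v) =
      TensorProduct.map ((TensorProduct.rid ℂ W).toLinearMap ∘ₗ (ε W).lTensor W)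
        (ε W ∘ₗ LinearMap.mulRight ℂ b)
        ((u ⊗ₜ 1) * (TensorProduct.assoc ℂ W W W).symm ((Δ W).lTensor W v)) := by
    intro v u
    induction u using TensorProduct.induction_on with
    | zero => simp
    | add x y hx hy => simp only [map_add, hx, hy, add_mul, add_tmul]
    | tmul q q' =>
      induction v using TensorProduct.induction_on with
      | zero => simp
      | add x y hx hy => simp only [map_add, hx, hy, mul_add]
      | tmul p p' =>
        simp only [Algebra.TensorProduct.tmul_mul_tmul, LinearMap.lTensor_tmul,
          LinearMap.comp_apply, LinearMap.mulRight_apply, counit_mul_left]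
        generalize (comul (R := ℂ) p') = w
        induction w using TensorProduct.induction_on with
        | zero => simp
        | add x y hx hy => simp only [map_add, hx, hy, mul_add, tmul_add]
        | tmul c d =>
          simp only [TensorProduct.map_tmul, LinearMap.mul'_apply, LinearMap.comp_apply,
            LinearMap.mulLeft_apply, LinearMap.mulRight_apply, TensorProduct.assoc_symm_tmul,
            Algebra.TensorProduct.tmul_mul_tmul, LinearEquiv.coe_coe, LinearMap.lTensor_tmul,
            TensorProduct.rid_tmul, one_mul]
          rw [smul_tmul, smul_eq_mul]
  have e2 : ∀ u : W ⊗[ℂ] W, (Δ W h ⊗ₜ[ℂ] (1 : W)) * (Δ W).rTensor W u =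
      (Δ W).rTensor W ((h ⊗ₜ 1) * u) := by
    intro u
    induction u using TensorProduct.induction_on with
    | zero => simp
    | add x y hx hy => simp only [map_add, hx, hy, mul_add]
    | tmul p p' => simp [comul_mul]
  have e3 : ∀ u : W ⊗[ℂ] W, TensorProduct.map
        ((TensorProduct.rid ℂ W).toLinearMap ∘ₗ (ε W).lTensor W)
        (ε W ∘ₗ LinearMap.mulRight ℂ b) ((Δ W).rTensor W u) =
      (ε W ∘ₗ LinearMap.mulRight ℂ b).lTensor W u := by
    intro u
    induction u using TensorProduct.induction_on with
    | zero => simp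
    | add x y hx hy => simp only [map_add, hx, hy]
    | tmul p p' => simp
  rw [← comul_mul_comul_one h, e1, ← assoc_rTensor_comul, LinearEquiv.symm_apply_apply, e2, e3]

/-- `Σ ε_L(h⁽¹⁾) ⊗ h⁽²⁾ = Σ ε_L(1⁽¹⁾) ⊗ 1⁽²⁾ h` -/
lemma rTensor_eL (h : W) : (eL W).rTensor W (Δ W h) = (eL W).rTensor W (Δ W 1) * (1 ⊗ₜ h) := by
  have e1 : ∀ (u z z' : W ⊗[ℂ] W), (∀ a, TensorProduct.lid ℂ W
      ((ε W ∘ₗ LinearMap.mulLeft ℂ a).rTensor W z) =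
      TensorProduct.lid ℂ W ((ε W ∘ₗ LinearMap.mulLeft ℂ a).rTensor W z')) →
      ((TensorProduct.lid ℂ W).toLinearMap ∘ₗ (ε W).rTensor W ∘ₗ
        LinearMap.mulLeft ℂ u ∘ₗ (TensorProduct.mk ℂ W W).flip 1).rTensor W z =
      ((TensorProduct.lid ℂ W).toLinearMap ∘ₗ (ε W).rTensor W ∘ₗ
        LinearMap.mulLeft ℂ u ∘ₗ (TensorProduct.mk ℂ W W).flip 1).rTensor W z' := by
    intro u z z' hz
    induction u using TensorProduct.induction_on with
    | zero => simp
    | add x y hx hy =>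
      have : LinearMap.mulLeft ℂ (x + y) = LinearMap.mulLeft ℂ x + LinearMap.mulLeft ℂ y := by
        ext; simp [add_mul]
      simp only [this, LinearMap.add_comp, LinearMap.comp_add, LinearMap.rTensor_add,
        LinearMap.add_apply, hx, hy]
    | tmul a b =>
      have : ∀ z : W ⊗[ℂ] W, ((TensorProduct.lid ℂ W).toLinearMap ∘ₗ (ε W).rTensor W ∘ₗ
        LinearMap.mulLeft ℂ (a ⊗ₜ[ℂ] b) ∘ₗ (TensorProduct.mk ℂ W W).flip 1).rTensor W z =
        b ⊗ₜ TensorProduct.lid ℂ W ((ε W ∘ₗ LinearMap.mulLeft ℂ a).rTensor W z) := by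
        intro z
        induction z using TensorProduct.induction_on with
        | zero => simp
        | add x y hx hy => simp only [map_add, hx, hy, tmul_add]
        | tmul p q => simp [smul_tmul']
      rw [this, this, hz]
  have e2 : ∀ u : W ⊗[ℂ] W, (eL W).rTensor W (u * (1 ⊗ₜ h)) = (eL W).rTensor W u * (1 ⊗ₜ h) := by
    intro u
    induction u using TensorProduct.induction_on with
    | zero => simp
    | add x y hx hy => simp only [map_add, hx, hy, add_mul]
    | tmul p p' => simp
  rw [← e2]
  exact e1 _ _ _ fun a => counit_left_comul a h

/-- `Σ h⁽¹⁾ ⊗ ε_R(h⁽²⁾) = Σ h 1⁽¹⁾ ⊗ ε_R(1⁽²⁾)` -/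
lemma lTensor_eR (h : W) : (eR W).lTensor W (Δ W h) = (h ⊗ₜ 1) * (eR W).lTensor W (Δ W 1) := by
  have e1 : ∀ (u z z' : W ⊗[ℂ] W), (∀ b, TensorProduct.rid ℂ W
      ((ε W ∘ₗ LinearMap.mulRight ℂ b).lTensor W z) =
      TensorProduct.rid ℂ W ((ε W ∘ₗ LinearMap.mulRight ℂ b).lTensor W z')) →
      ((TensorProduct.rid ℂ W).toLinearMap ∘ₗ (ε W).lTensor W ∘ₗ
        LinearMap.mulRight ℂ u ∘ₗ TensorProduct.mk ℂ W W 1).lTensor W z =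
      ((TensorProduct.rid ℂ W).toLinearMap ∘ₗ (ε W).lTensor W ∘ₗ
        LinearMap.mulRight ℂ u ∘ₗ TensorProduct.mk ℂ W W 1).lTensor W z' := by
    intro u z z' hz
    induction u using TensorProduct.induction_on with
    | zero => simp
    | add x y hx hy =>
      have : LinearMap.mulRight ℂ (x + y) = LinearMap.mulRight ℂ x + LinearMap.mulRight ℂ y := by
        ext; simp [mul_add]
      simp only [this, LinearMap.add_comp, LinearMap.comp_add, LinearMap.lTensor_add,
        LinearMap.add_apply, hx, hy]
    | tmul a b =>
      have : ∀ z : W ⊗[ℂ] W, ((TensorProduct.rid ℂ W).toLinearMap ∘ₗ (ε W).lTensor W ∘ₗ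
        LinearMap.mulRight ℂ (a ⊗ₜ[ℂ] b) ∘ₗ TensorProduct.mk ℂ W W 1).lTensor W z =
        TensorProduct.rid ℂ W ((ε W ∘ₗ LinearMap.mulRight ℂ b).lTensor W z) ⊗ₜ a := by
        intro z
        induction z using TensorProduct.induction_on with
        | zero => simp
        | add x y hx hy => simp only [map_add, hx, hy, add_tmul]
        | tmul p q => simp [smul_tmul']
      rw [this, this, hz]
  have e2 : ∀ u : W ⊗[ℂ] W, (eR W).lTensor W ((h ⊗ₜ 1) * u) = (h ⊗ₜ 1) * (eR W).lTensor W u := by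
    intro u
    induction u using TensorProduct.induction_on with
    | zero => simp
    | add x y hx hy => simp only [map_add, hx, hy, mul_add]
    | tmul p p' => simp
  rw [← e2]
  exact e1 _ _ _ fun a => counit_right_comul a h

/-! ### The antipode -/

lemma conv_id_antipode :
    (toConv LinearMap.id * toConv (S W) : WithConv (W →ₗ[ℂ] W)) = toConv (eL W) := by
  ext h
  exact mul_antipode h

lemma conv_antipode_id :
    (toConv (S W) * toConv LinearMap.id : WithConv (W →ₗ[ℂ] W)) = toConv (eR W) := by
  ext h
  exact antipode_mul h

/-- This is `S * id * S = S`. Together with `S * id = ε_R` and `id * S = ε_L`, it makes `S` a weak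
inverse of the identity under convolution, in place of a true inverse. -/
lemma conv_antipode_eL :
    (toConv (S W) * toConv (eL W) : WithConv (W →ₗ[ℂ] W)) = toConv (S W) := by
  rw [← conv_id_antipode]
  ext h
  have e : ∀ z : W ⊗[ℂ] W, LinearMap.mul' ℂ W (TensorProduct.map (S W)
      (toConv LinearMap.id * toConv (S W) : WithConv (W →ₗ[ℂ] W)).ofConv z) =
      (LinearMap.mul' ℂ W ∘ₗ TensorProduct.map (S W) (LinearMap.mul' ℂ W ∘ₗ (S W).lTensor W))
        ((Δ W).lTensor W z) := by
    intro z
    induction z using TensorProduct.induction_on with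
    | zero => simp
    | add x y hx hy => simp only [map_add, hx, hy]
    | tmul a b => simp [LinearMap.lTensor]
  exact (e _).trans (antipode_mul_antipode h)

lemma conv_eR_antipode :
    (toConv (eR W) * toConv (S W) : WithConv (W →ₗ[ℂ] W)) = toConv (S W) := by
  rw [← conv_antipode_id, mul_assoc, conv_id_antipode, conv_antipode_eL]

/-- `ε_L(h x) = Σ h⁽¹⁾ x S(h⁽²⁾)` for `x ∈ W_L` -/
lemma eL_mul (h k : W) : eL W (h * k) =
    LinearMap.mul' ℂ W (TensorProduct.map (LinearMap.mulRight ℂ (eL W k)) (S W) (Δ W h)) := by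
  have e : eL W (h * k) = eL W (h * eL W k) := by
    rw [eL_def, eL_def]
    congr 1
    generalize (comul (R := ℂ) (1 : W)) = u
    induction u using TensorProduct.induction_on with
    | zero => simp
    | add x y hx hy => simp only [map_add, hx, hy, add_mul]
    | tmul a b => simp [← mul_assoc, counit_mul_eL]
  rw [e]
  refine (mul_antipode (h * eL W k)).symm.trans ?_
  rw [comul_mul_eL]
  generalize (comul (R := ℂ) h) = z
  induction z using TensorProduct.induction_on with
  | zero => simp
  | add x y hx hy => simp only [map_add, hx, hy, add_mul]
  | tmul a b => simp

/-- `ε_R(y k) = Σ S(k⁽¹⁾) y k⁽²⁾` for `y ∈ W_R` -/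
lemma eR_mul (h k : W) : eR W (h * k) =
    LinearMap.mul' ℂ W (TensorProduct.map (S W) (LinearMap.mulLeft ℂ (eR W h)) (Δ W k)) := by
  have e : eR W (h * k) = eR W (eR W h * k) := by
    rw [eR_def, eR_def]
    congr 1
    generalize (comul (R := ℂ) (1 : W)) = u
    induction u using TensorProduct.induction_on with
    | zero => simp
    | add x y hx hy => simp only [map_add, hx, hy, mul_add]
    | tmul a b => simp [mul_assoc, counit_eR_mul]
  rw [e]
  refine (antipode_mul (eR W h * k)).symm.trans ?_
  rw [comul_eR_mul]
  generalize (comul (R := ℂ) k) = z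
  induction z using TensorProduct.induction_on with
  | zero => simp
  | add x y hx hy => simp only [map_add, hx, hy, mul_add]
  | tmul a b => simp

-- Although `ε` need not be multiplicative, it is a coalgebra morphism, so `id ⊗ ε` and `ε ⊗ id` are
-- too. Precomposition with them respects convolution.
variable (W) in
def proj₁ : W ⊗[ℂ] W →ₗc[ℂ] W :=
  (Coalgebra.TensorProduct.rid ℂ ℂ W).toCoalgHom.comp
    (Coalgebra.TensorProduct.map (.id ℂ W) (counitCoalgHom ℂ W))

variable (W) in
def proj₂ : W ⊗[ℂ] W →ₗc[ℂ] W :=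
  (Coalgebra.TensorProduct.lid ℂ W).toCoalgHom.comp
    (Coalgebra.TensorProduct.map (counitCoalgHom ℂ W) (.id ℂ W))

lemma proj₁_tmul (h k : W) : proj₁ W (h ⊗ₜ k) = ε W k • h := rfl
lemma proj₂_tmul (h k : W) : proj₂ W (h ⊗ₜ k) = ε W h • k := rfl

/-- `f` on the first factor -/
def conv₁ (f : W →ₗ[ℂ] W) : WithConv (W ⊗[ℂ] W →ₗ[ℂ] W) := toConv (f ∘ₗ (proj₁ W).toLinearMap)

def conv₂ (f : W →ₗ[ℂ] W) : WithConv (W ⊗[ℂ] W →ₗ[ℂ] W) := toConv (f ∘ₗ (proj₂ W).toLinearMap)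

lemma conv₁_mul_conv₁ (f g : W →ₗ[ℂ] W) : conv₁ f * conv₁ g = conv₁ (toConv f * toConv g).ofConv := by
  apply WithConv.ext
  exact (LinearMap.convMul_comp_coalgHom_distrib (toConv f) (toConv g) (proj₁ W)).symm

lemma conv₂_mul_conv₂ (f g : W →ₗ[ℂ] W) : conv₂ f * conv₂ g = conv₂ (toConv f * toConv g).ofConv := by
  apply WithConv.ext
  exact (LinearMap.convMul_comp_coalgHom_distrib (toConv f) (toConv g) (proj₂ W)).symm

lemma conv₁_mul_conv₂ (f g : W →ₗ[ℂ] W) (h k : W) : (conv₁ f * conv₂ g) (h ⊗ₜ k) = f h * g k := by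
  have e : ∀ u v : W ⊗[ℂ] W, LinearMap.mul' ℂ W (TensorProduct.map
      (f ∘ₗ (proj₁ W).toLinearMap) (g ∘ₗ (proj₂ W).toLinearMap)
      (AlgebraTensorModule.tensorTensorTensorComm ℂ ℂ ℂ ℂ W W W W (u ⊗ₜ v))) =
      f (TensorProduct.rid ℂ W ((ε W).lTensor W u)) *
        g (TensorProduct.lid ℂ W ((ε W).rTensor W v)) := by
    intro u v
    induction u using TensorProduct.induction_on with
    | zero => simp
    | add x y hx hy => simp only [map_add, hx, hy, add_mul, add_tmul]
    | tmul a b =>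
      induction v using TensorProduct.induction_on with
      | zero => simp
      | add x y hx hy => simp only [map_add, hx, hy, mul_add, tmul_add]
      | tmul c d => simp [proj₁_tmul, proj₂_tmul, smul_smul, mul_comm]
  refine (e _ _).trans ?_
  simp

lemma conv₂_mul_conv₁ (f g : W →ₗ[ℂ] W) (h k : W) : (conv₂ f * conv₁ g) (h ⊗ₜ k) = f k * g h := by
  have e : ∀ u v : W ⊗[ℂ] W, LinearMap.mul' ℂ W (TensorProduct.map
      (f ∘ₗ (proj₂ W).toLinearMap) (g ∘ₗ (proj₁ W).toLinearMap)
      (AlgebraTensorModule.tensorTensorTensorComm ℂ ℂ ℂ ℂ W W W W (u ⊗ₜ v))) =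
      f (TensorProduct.rid ℂ W ((ε W).lTensor W v)) *
        g (TensorProduct.lid ℂ W ((ε W).rTensor W u)) := by
    intro u v
    induction u using TensorProduct.induction_on with
    | zero => simp
    | add x y hx hy => simp only [map_add, hx, hy, mul_add, add_tmul]
    | tmul a b =>
      induction v using TensorProduct.induction_on with
      | zero => simp
      | add x y hx hy => simp only [map_add, hx, hy, add_mul, tmul_add]
      | tmul c d => simp [proj₁_tmul, proj₂_tmul, smul_smul, mul_comm]
  refine (e _ _).trans ?_
  simp

lemma conv₁_mul_conv₂_mul_conv₁ (f g f' : W →ₗ[ℂ] W) (h k : W) :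
    (conv₁ f * conv₂ g * conv₁ f') (h ⊗ₜ k) =
      LinearMap.mul' ℂ W (TensorProduct.map (LinearMap.mulRight ℂ (g k) ∘ₗ f) f' (Δ W h)) := by
  have e : ∀ u v : W ⊗[ℂ] W, LinearMap.mul' ℂ W (TensorProduct.map
      (conv₁ f * conv₂ g).ofConv (f' ∘ₗ (proj₁ W).toLinearMap)
      (AlgebraTensorModule.tensorTensorTensorComm ℂ ℂ ℂ ℂ W W W W (u ⊗ₜ v))) =
      LinearMap.mul' ℂ W (TensorProduct.map (LinearMap.mulRight ℂ
        (g (TensorProduct.rid ℂ W ((ε W).lTensor W v))) ∘ₗ f) f' u) := by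
    intro u v
    induction v using TensorProduct.induction_on with
    | zero => simp
    | add x y hx hy =>
      have : ∀ a b : W, LinearMap.mulRight ℂ (a + b) =
        LinearMap.mulRight ℂ a + LinearMap.mulRight ℂ b := by intros; ext; simp [mul_add]
      simp only [map_add, hx, hy, tmul_add, this, LinearMap.add_comp, TensorProduct.map_add_left,
        LinearMap.add_apply]
    | tmul c d =>
      induction u using TensorProduct.induction_on with
      | zero => simp
      | add x y hx hy => simp only [map_add, hx, hy, add_tmul]
      | tmul a b =>
        simp [-LinearMap.convMul_apply, conv₁_mul_conv₂, proj₁_tmul]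
  refine (e _ _).trans ?_
  simp

lemma conv₂_mul_conv₁_mul_conv₂ (f g f' : W →ₗ[ℂ] W) (h k : W) :
    (conv₂ f * conv₁ g * conv₂ f') (h ⊗ₜ k) =
      LinearMap.mul' ℂ W (TensorProduct.map f (LinearMap.mulLeft ℂ (g h) ∘ₗ f') (Δ W k)) := by
  have e : ∀ u v : W ⊗[ℂ] W, LinearMap.mul' ℂ W (TensorProduct.map
      (conv₂ f * conv₁ g).ofConv (f' ∘ₗ (proj₂ W).toLinearMap)
      (AlgebraTensorModule.tensorTensorTensorComm ℂ ℂ ℂ ℂ W W W W (u ⊗ₜ v))) =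
      LinearMap.mul' ℂ W (TensorProduct.map f (LinearMap.mulLeft ℂ
        (g (TensorProduct.rid ℂ W ((ε W).lTensor W u))) ∘ₗ f') v) := by
    intro u v
    induction u using TensorProduct.induction_on with
    | zero => simp
    | add x y hx hy =>
      have : ∀ a b : W, LinearMap.mulLeft ℂ (a + b) =
        LinearMap.mulLeft ℂ a + LinearMap.mulLeft ℂ b := by intros; ext; simp [add_mul]
      simp only [map_add, hx, hy, add_tmul, this, LinearMap.add_comp, TensorProduct.map_add_right,
        LinearMap.add_apply]
    | tmul c d =>
      induction v using TensorProduct.induction_on with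
      | zero => simp
      | add x y hx hy => simp only [map_add, hx, hy, tmul_add]
      | tmul a b =>
        simp [-LinearMap.convMul_apply, conv₂_mul_conv₁, proj₂_tmul, mul_assoc]
  refine (e _ _).trans ?_
  simp

/-- The antipode is antimultiplicative. -/
theorem antipode_mul_rev (h k : W) : S W (h * k) = S W k * S W h := by
  -- Weak inverses are unique in the following sense. In `Hom(W ⊗ W, W)`, with `M` the product, `N =
  -- S ∘ M` and `P : h ⊗ k ↦ S(k)S(h)`, the identities `NMN = N`, `PMP = P`, `NM = PM` and `MN = MP`
  -- give `N = PMN = PMP = P`.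
  let M : WithConv (W ⊗[ℂ] W →ₗ[ℂ] W) := conv₁ .id * conv₂ .id
  let P : WithConv (W ⊗[ℂ] W →ₗ[ℂ] W) := conv₂ (S W) * conv₁ (S W)
  let N : WithConv (W ⊗[ℂ] W →ₗ[ℂ] W) := toConv (S W ∘ₗ LinearMap.mul' ℂ W)
  have hM : M = toConv (LinearMap.mul' ℂ W) := by
    apply WithConv.ext
    refine TensorProduct.ext' fun h k => ?_
    exact conv₁_mul_conv₂ _ _ _ _
  -- Multiplicativity of `Δ` makes precomposition with the product of `W` multiplicative for
  -- convolution. Preservation of units is not needed.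
  have hcomp : ∀ f g : W →ₗ[ℂ] W, (toConv (f ∘ₗ LinearMap.mul' ℂ W) *
      toConv (g ∘ₗ LinearMap.mul' ℂ W) : WithConv (W ⊗[ℂ] W →ₗ[ℂ] W)) =
      toConv ((toConv f * toConv g).ofConv ∘ₗ LinearMap.mul' ℂ W) := by
    intro f g
    have e : ∀ u v : W ⊗[ℂ] W, LinearMap.mul' ℂ W (TensorProduct.map
        (f ∘ₗ LinearMap.mul' ℂ W) (g ∘ₗ LinearMap.mul' ℂ W)
        (AlgebraTensorModule.tensorTensorTensorComm ℂ ℂ ℂ ℂ W W W W (u ⊗ₜ v))) =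
        LinearMap.mul' ℂ W (TensorProduct.map f g (u * v)) := by
      intro u v
      induction u using TensorProduct.induction_on with
      | zero => simp
      | add x y hx hy => simp only [map_add, hx, hy, add_mul, add_tmul]
      | tmul a b =>
        induction v using TensorProduct.induction_on with
        | zero => simp
        | add x y hx hy => simp only [map_add, hx, hy, mul_add, tmul_add]
        | tmul c d => simp
    apply WithConv.ext
    refine TensorProduct.ext' fun h k => ?_
    refine (e _ _).trans ?_
    rw [← comul_mul]
    rfl
  have hN : N * M * N = N := by
    have : (toConv LinearMap.id : WithConv (W →ₗ[ℂ] W)) * toConv (S W) = toConv (eL W) :=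
      conv_id_antipode
    rw [hM, ← LinearMap.id_comp (LinearMap.mul' ℂ W), mul_assoc, hcomp, this, hcomp,
      conv_antipode_eL]
  have hNM : N * M = P * M := by
    rw [hM, ← LinearMap.id_comp (LinearMap.mul' ℂ W), hcomp, conv_antipode_id,
      LinearMap.id_comp, ← hM]
    simp only [M, P]
    rw [mul_assoc, ← mul_assoc (conv₁ (S W)), conv₁_mul_conv₁, conv_antipode_id, ← mul_assoc]
    apply WithConv.ext
    refine TensorProduct.ext' fun h k => ?_
    refine Eq.trans ?_ (conv₂_mul_conv₁_mul_conv₂ _ _ _ _ _).symm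
    exact eR_mul h k
  have hMN : M * N = M * P := by
    rw [hM, ← LinearMap.id_comp (LinearMap.mul' ℂ W), hcomp, conv_id_antipode,
      LinearMap.id_comp, ← hM]
    simp only [M, P]
    rw [mul_assoc, ← mul_assoc (conv₂ _), conv₂_mul_conv₂, conv_id_antipode, ← mul_assoc]
    apply WithConv.ext
    refine TensorProduct.ext' fun h k => ?_
    refine Eq.trans ?_ (conv₁_mul_conv₂_mul_conv₁ _ _ _ _ _).symm
    exact eL_mul h k
  have hP : P * M * P = P := by
    -- Commutation of `W_L` with `W_R` is what brings each counital map next to the copy of `S` that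
    -- absorbs it.
    have hc : conv₁ (eR W) * conv₂ (eL W) = conv₂ (eL W) * conv₁ (eR W) := by
      apply WithConv.ext
      refine TensorProduct.ext' fun h k => ?_
      refine (conv₁_mul_conv₂ _ _ _ _).trans (Eq.trans ?_ (conv₂_mul_conv₁ _ _ _ _).symm)
      exact (eL_mul_eR k h).symm
    simp only [M, P]
    calc conv₂ (S W) * conv₁ (S W) * (conv₁ .id * conv₂ .id) * (conv₂ (S W) * conv₁ (S W))
        = conv₂ (S W) * (conv₁ (S W) * conv₁ .id) * (conv₂ .id * conv₂ (S W)) * conv₁ (S W) := by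
          simp only [mul_assoc]
      _ = conv₂ (S W) * (conv₁ (eR W) * conv₂ (eL W)) * conv₁ (S W) := by
          rw [conv₁_mul_conv₁, conv_antipode_id, conv₂_mul_conv₂, conv_id_antipode]
          simp only [mul_assoc]
      _ = (conv₂ (S W) * conv₂ (eL W)) * (conv₁ (eR W) * conv₁ (S W)) := by
          rw [hc]; simp only [mul_assoc]
      _ = _ := by
          rw [conv₁_mul_conv₁, conv_eR_antipode, conv₂_mul_conv₂, conv_antipode_eL]
  have hNP : N = P := by
    rw [← hN, hNM, mul_assoc, hMN, ← mul_assoc, hP]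
  have := congrArg (fun f => f.ofConv (h ⊗ₜ k)) hNP
  exact this.trans (conv₂_mul_conv₁ _ _ _ _)

end Antipode

/-! ### Anticomultiplicativity of the antipode, and `S² = 1`. -/

section AntipodeComul

variable {W : Type*} [Ring W] [Algebra ℂ W] [WeakHopfAlgebra W]

lemma eL_eL_mul (h k : W) : eL W (eL W h * k) = eL W h * eL W k := by
  refine (mul_antipode (eL W h * k)).symm.trans (Eq.trans ?_ (congrArg _ (mul_antipode k)))
  rw [comul_eL_mul]
  generalize (comul (R := ℂ) k) = z
  induction z using TensorProduct.induction_on with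
  | zero => simp
  | add x y hx hy => simp only [map_add, hx, hy, mul_add]
  | tmul a b => simp [mul_assoc]

lemma eR_mul_eR (h k : W) : eR W (k * eR W h) = eR W k * eR W h := by
  refine (antipode_mul (k * eR W h)).symm.trans
    (Eq.trans ?_ (congrArg (· * eR W h) (antipode_mul k)))
  rw [comul_mul_eR]
  generalize (comul (R := ℂ) k) = z
  induction z using TensorProduct.induction_on with
  | zero => simp
  | add x y hx hy => simp only [map_add, hx, hy, add_mul]
  | tmul a b => simp [mul_assoc]

lemma eL_one : eL W 1 = 1 := by
  rw [eL_def, ← Algebra.TensorProduct.one_def, mul_one]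
  simp

lemma eR_one : eR W 1 = 1 := by
  rw [eR_def, ← Algebra.TensorProduct.one_def, one_mul]
  simp

/-- `S(1) = Σ S(1⁽¹⁾) ε_L(1⁽²⁾)`, and `ε_L` does nothing on the second leg of `Δ(1)`; what is left
is `ε_R(1) = 1`. -/
lemma antipode_one : S W 1 = 1 := by
  have h1 : LinearMap.mul' ℂ W (TensorProduct.map (S W) (eL W) (Δ W 1)) = S W 1 :=
    congrArg (fun f => f.ofConv 1) (conv_antipode_eL (W := W))
  rw [← h1, ← LinearMap.comp_id (S W), ← LinearMap.id_comp (eL W), TensorProduct.map_comp,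
    LinearMap.comp_apply]
  have h2 : TensorProduct.map LinearMap.id (eL W) (Δ W 1) = Δ W 1 := lTensor_eL_one
  rw [h2]
  refine (antipode_mul (1 : W)).trans ?_
  rw [epsR_eq, eR_one]

/-- `Σ S(1⁽¹⁾) ⊗ 1⁽²⁾ = Σ ε_L(1⁽¹⁾) ⊗ 1⁽²⁾` -/
lemma rTensor_antipode_one : (S W).rTensor W (Δ W 1) = (eL W).rTensor W (Δ W 1) := by
  have h1 : S W = LinearMap.mul' ℂ W ∘ₗ TensorProduct.map (S W) (eL W) ∘ₗ Δ W :=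
    (congrArg WithConv.ofConv (conv_antipode_eL (W := W))).symm
  have e1 : ∀ z : W ⊗[ℂ] W, (S W).rTensor W z = (LinearMap.mul' ℂ W ∘ₗ
      TensorProduct.map (S W) (eL W)).rTensor W ((TensorProduct.assoc ℂ W W W).symm
        (TensorProduct.assoc ℂ W W W ((Δ W).rTensor W z))) := by
    intro z
    rw [LinearEquiv.symm_apply_apply, ← LinearMap.comp_apply, ← LinearMap.rTensor_comp]
    nth_rw 1 [h1]
    rfl
  have e2 : ∀ u v : W ⊗[ℂ] W, (LinearMap.mul' ℂ W ∘ₗ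
      TensorProduct.map (S W) (eL W)).rTensor W ((TensorProduct.assoc ℂ W W W).symm
        (TensorProduct.assoc ℂ W W W (TensorProduct.map (eR W) (eL W) u ⊗ₜ[ℂ] (1 : W)) *
          ((1 : W) ⊗ₜ[ℂ] v))) =
      (LinearMap.mul' ℂ W (TensorProduct.map (S W) LinearMap.id (TensorProduct.map (eR W) (eL W) u))
        ⊗ₜ 1) * (eL W).rTensor W v := by
    intro u v
    induction u using TensorProduct.induction_on with
    | zero => simp
    | add x y hx hy => simp only [map_add, hx, hy, add_mul, add_tmul]
    | tmul a b =>
      induction v using TensorProduct.induction_on with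
      | zero => simp
      | add x y hx hy => simp only [map_add, hx, hy, mul_add, tmul_add]
      | tmul c d => simp [eL_eL_mul, mul_assoc]
  -- Expand `S = S * ε_L` on the first leg and factor `Δ₂(1)` into two copies of `Δ(1)`. The second
  -- leg of the first copy lies in `W_L`, hence comes out of `ε_L`, and there `Σ S(1⁽¹⁾)1⁽²⁾ = 1`.
  rw [e1, assoc_rTensor_comul]
  have := comul_one_left (W := W)
  rw [comul₂, LinearMap.comp_apply] at this
  rw [this]
  nth_rw 1 [← map_eR_eL_one]
  rw [e2, map_eR_eL_one]
  have h3 : LinearMap.mul' ℂ W (TensorProduct.map (S W) LinearMap.id (Δ W 1)) = 1 :=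
    (antipode_mul (1 : W)).trans (by rw [epsR_eq, eR_one])
  rw [h3, ← Algebra.TensorProduct.one_def, one_mul]

/-- `Σ 1⁽¹⁾ ⊗ S(1⁽²⁾) = Σ 1⁽¹⁾ ⊗ ε_R(1⁽²⁾)` -/
lemma lTensor_antipode_one : (S W).lTensor W (Δ W 1) = (eR W).lTensor W (Δ W 1) := by
  have h1 : S W = LinearMap.mul' ℂ W ∘ₗ TensorProduct.map (eR W) (S W) ∘ₗ Δ W :=
    (congrArg WithConv.ofConv (conv_eR_antipode (W := W))).symm
  have e1 : ∀ z : W ⊗[ℂ] W, (S W).lTensor W z = (LinearMap.mul' ℂ W ∘ₗ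
      TensorProduct.map (eR W) (S W)).lTensor W ((Δ W).lTensor W z) := by
    intro z
    rw [← LinearMap.comp_apply, ← LinearMap.lTensor_comp]
    nth_rw 1 [h1]
    rfl
  have e2 : ∀ u v : W ⊗[ℂ] W, (LinearMap.mul' ℂ W ∘ₗ
      TensorProduct.map (eR W) (S W)).lTensor W
        (TensorProduct.assoc ℂ W W W (u ⊗ₜ[ℂ] (1 : W)) *
          ((1 : W) ⊗ₜ[ℂ] TensorProduct.map (eR W) (eL W) v)) =
      (eR W).lTensor W u * (1 ⊗ₜ LinearMap.mul' ℂ W (TensorProduct.map LinearMap.id (S W)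
        (TensorProduct.map (eR W) (eL W) v))) := by
    intro u v
    induction u using TensorProduct.induction_on with
    | zero => simp
    | add x y hx hy => simp only [map_add, hx, hy, add_mul, add_tmul]
    | tmul a b =>
      induction v using TensorProduct.induction_on with
      | zero => simp
      | add x y hx hy => simp only [map_add, hx, hy, mul_add, tmul_add]
      | tmul c d => simp [eR_mul_eR, mul_assoc]
  rw [e1]
  have := comul_one_left (W := W)
  rw [comul₂, LinearMap.comp_apply] at this
  rw [this]
  nth_rw 2 [← map_eR_eL_one]
  rw [e2, map_eR_eL_one]
  have h3 : LinearMap.mul' ℂ W (TensorProduct.map LinearMap.id (S W) (Δ W 1)) = 1 :=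
    (mul_antipode (1 : W)).trans (by rw [epsL_eq, eL_one])
  rw [h3, ← Algebra.TensorProduct.one_def, mul_one]

/-- `Σ h⁽¹⁾ S(h⁽²⁾) ⊗ h⁽³⁾ = Σ S(1⁽¹⁾) ⊗ 1⁽²⁾ h` -/
lemma rTensor_eL' (h : W) : (eL W).rTensor W (Δ W h) = (S W).rTensor W (Δ W 1) * (1 ⊗ₜ h) := by
  rw [rTensor_eL, rTensor_antipode_one]

/-- `Σ h⁽¹⁾ ⊗ S(h⁽²⁾) h⁽³⁾ = Σ h 1⁽¹⁾ ⊗ S(1⁽²⁾)` -/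
lemma lTensor_eR' (h : W) : (eR W).lTensor W (Δ W h) = (h ⊗ₜ 1) * (S W).lTensor W (Δ W 1) := by
  rw [lTensor_eR, lTensor_antipode_one]

/-- With two further copies of `Δ(1)` inside `ε_L` and `ε_R`, the middle `Δ(1)` disappears by `Σ
ε(a1⁽¹⁾) ε(1⁽²⁾d) = ε(ad)`. The two remaining copies are contracted to one through `ε_R`. -/
lemma map_eL_eR_one : TensorProduct.map (eL W) (eR W) (Δ W 1) =
    TensorProduct.comm ℂ W W (Δ W 1) := by
  have e : ∀ v w : W ⊗[ℂ] W, TensorProduct.map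
      ((TensorProduct.lid ℂ W).toLinearMap ∘ₗ (ε W).rTensor W ∘ₗ
        LinearMap.mulLeft ℂ v ∘ₗ (TensorProduct.mk ℂ W W).flip 1)
      ((TensorProduct.rid ℂ W).toLinearMap ∘ₗ (ε W).lTensor W ∘ₗ
        LinearMap.mulRight ℂ w ∘ₗ TensorProduct.mk ℂ W W 1) (Δ W 1) =
      TensorProduct.comm ℂ W W (((TensorProduct.rid ℂ W).toLinearMap ∘ₗ (ε W).lTensor W ∘ₗ
        LinearMap.mulRight ℂ w ∘ₗ TensorProduct.mk ℂ W W 1).rTensor W v) := by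
    intro v w
    induction v using TensorProduct.induction_on with
    | zero => simp
    | add x y hx hy =>
      have : LinearMap.mulLeft ℂ (x + y) = LinearMap.mulLeft ℂ x + LinearMap.mulLeft ℂ y := by
        ext; simp [add_mul]
      simp only [this, LinearMap.add_comp, LinearMap.comp_add, TensorProduct.map_add_left,
        LinearMap.add_apply, hx, hy, map_add]
    | tmul a b =>
      induction w using TensorProduct.induction_on with
      | zero => simp
      | add x y hx hy =>
        have : LinearMap.mulRight ℂ (x + y) = LinearMap.mulRight ℂ x + LinearMap.mulRight ℂ y := by
          ext; simp [mul_add]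
        simp only [this, LinearMap.add_comp, LinearMap.comp_add, TensorProduct.map_add_right,
          LinearMap.rTensor_add, LinearMap.add_apply, hx, hy, map_add]
      | tmul c d =>
        have h1 := counit_mul_left a 1 d
        rw [mul_one] at h1
        simp only [LinearMap.rTensor_tmul, TensorProduct.comm_tmul, LinearMap.comp_apply,
          TensorProduct.mk_apply, LinearMap.mulRight_apply, Algebra.TensorProduct.tmul_mul_tmul,
          LinearMap.lTensor_tmul, one_mul, LinearEquiv.coe_coe, TensorProduct.rid_tmul, h1]
        generalize (comul (R := ℂ) (1 : W)) = z
        induction z using TensorProduct.induction_on with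
        | zero => simp
        | add x y hx hy => simp only [map_add, hx, hy, add_smul, tmul_add]
        | tmul p q =>
          simp only [TensorProduct.map_tmul, LinearMap.comp_apply, LinearMap.flip_apply,
            TensorProduct.mk_apply, LinearMap.mulLeft_apply, LinearMap.mulRight_apply,
            Algebra.TensorProduct.tmul_mul_tmul, mul_one, one_mul, LinearMap.rTensor_tmul,
            LinearMap.lTensor_tmul, LinearEquiv.coe_coe, TensorProduct.lid_tmul,
            TensorProduct.rid_tmul, LinearMap.mul'_apply]
          rw [smul_tmul, smul_smul]
  refine (e (Δ W 1) (Δ W 1)).trans ?_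
  exact congrArg _ rTensor_eR_one

/-- On the legs of `Δ(1)` the antipode agrees with `ε_L` and with `ε_R` respectively, so this
reduces to `map_eL_eR_one`. -/
lemma map_antipode_one : TensorProduct.map (S W) (S W) (Δ W 1) =
    TensorProduct.comm ℂ W W (Δ W 1) := by
  rw [← map_eL_eR_one, ← LinearMap.lTensor_comp_rTensor, LinearMap.comp_apply,
    rTensor_antipode_one, ← LinearMap.comp_apply, LinearMap.lTensor_comp_rTensor,
    ← LinearMap.rTensor_comp_lTensor, LinearMap.comp_apply, lTensor_antipode_one,
    ← LinearMap.comp_apply, LinearMap.rTensor_comp_lTensor]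

variable (W) in
/-- `h ↦ f(h) ⊗ 1` in the convolution ring. -/
def convL (f : W →ₗ[ℂ] W) : WithConv (W →ₗ[ℂ] W ⊗[ℂ] W) :=
  toConv ((TensorProduct.mk ℂ W W).flip 1 ∘ₗ f)

variable (W) in
/-- `h ↦ 1 ⊗ f(h)` in the convolution ring. -/
def convR (f : W →ₗ[ℂ] W) : WithConv (W →ₗ[ℂ] W ⊗[ℂ] W) :=
  toConv (TensorProduct.mk ℂ W W 1 ∘ₗ f)

lemma convL_mul_convL (f g : W →ₗ[ℂ] W) :
    convL W f * convL W g = convL W (toConv f * toConv g).ofConv := by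
  ext h
  simp only [convL, LinearMap.convMul_apply, LinearMap.comp_apply]
  generalize (comul (R := ℂ) h) = z
  induction z using TensorProduct.induction_on with
  | zero => simp
  | add x y hx hy => simp only [map_add, hx, hy]
  | tmul p q => simp

lemma convR_mul_convR (f g : W →ₗ[ℂ] W) :
    convR W f * convR W g = convR W (toConv f * toConv g).ofConv := by
  ext h
  simp only [convR, LinearMap.convMul_apply, LinearMap.comp_apply]
  generalize (comul (R := ℂ) h) = z
  induction z using TensorProduct.induction_on with
  | zero => simp
  | add x y hx hy => simp only [map_add, hx, hy]
  | tmul p q => simp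

lemma convL_mul_convR_apply (f g : W →ₗ[ℂ] W) (h : W) :
    (convL W f * convR W g) h = TensorProduct.map f g (Δ W h) := by
  simp only [convL, convR, LinearMap.convMul_apply]
  generalize (comul (R := ℂ) h) = z
  induction z using TensorProduct.induction_on with
  | zero => simp
  | add x y hx hy => simp only [map_add, hx, hy]
  | tmul p q => simp

lemma convR_mul_convL_apply (f g : W →ₗ[ℂ] W) (h : W) :
    (convR W f * convL W g) h = TensorProduct.map g f (TensorProduct.comm ℂ W W (Δ W h)) := by
  simp only [convL, convR, LinearMap.convMul_apply]
  generalize (comul (R := ℂ) h) = z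
  induction z using TensorProduct.induction_on with
  | zero => simp
  | add x y hx hy => simp only [map_add, hx, hy]
  | tmul p q => simp

/-- The antipode is anticomultiplicative. -/
theorem comul_antipode (h : W) :
    Δ W (S W h) = TensorProduct.map (S W) (S W) (TensorProduct.comm ℂ W W (Δ W h)) := by
  -- The same weak-inverse argument, now in `Hom(W, W ⊗ W)`: `D` is `Δ`, `N` is `Δ ∘ S` and `P` is
  -- `h ↦ Σ S(h⁽²⁾) ⊗ S(h⁽¹⁾)`. Since `Δ(1)` need not be the unit of `W ⊗ W`, it has to be carried
  -- along as the constant `K`.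
  let D : WithConv (W →ₗ[ℂ] W ⊗[ℂ] W) := convL W .id * convR W .id
  let P : WithConv (W →ₗ[ℂ] W ⊗[ℂ] W) := convR W (S W) * convL W (S W)
  let N : WithConv (W →ₗ[ℂ] W ⊗[ℂ] W) := toConv (Δ W ∘ₗ S W)
  let K := convConst W (Δ W 1)
  have hD : D = toConv (Δ W) := by
    ext h
    rw [convL_mul_convR_apply]
    simp
  have hcomp : ∀ f g : W →ₗ[ℂ] W, (toConv (Δ W ∘ₗ f) * toConv (Δ W ∘ₗ g) :
      WithConv (W →ₗ[ℂ] W ⊗[ℂ] W)) = toConv (Δ W ∘ₗ (toConv f * toConv g).ofConv) := by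
    intro f g
    ext h
    simp only [LinearMap.convMul_apply, LinearMap.comp_apply]
    generalize (comul (R := ℂ) h) = z
    induction z using TensorProduct.induction_on with
    | zero => simp
    | add x y hx hy => simp only [map_add, hx, hy]
    | tmul p q => simp [comul_mul]
  have hRL : convL W (eR W) * convR W .id = convR W .id * K := by
    ext h
    rw [convL_mul_convR_apply, mul_convConst_apply]
    exact rTensor_eR h
  have hLR : convL W .id * convR W (eL W) = K * convL W .id := by
    ext h
    rw [convL_mul_convR_apply, convConst_mul_apply]
    exact lTensor_eL h
  have hPD : P * D = toConv (Δ W ∘ₗ eR W) := by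
    have : P * D = convR W (eR W) * K := by
      simp only [P, D]
      rw [mul_assoc, ← mul_assoc (convL W (S W)), convL_mul_convL, conv_antipode_id, hRL,
        ← mul_assoc, convR_mul_convR, conv_antipode_id]
    rw [this]
    ext h
    rw [mul_convConst_apply]
    exact (comul_eR_left h).symm
  have hDP : D * P = toConv (Δ W ∘ₗ eL W) := by
    have : D * P = K * convL W (eL W) := by
      simp only [P, D]
      rw [mul_assoc, ← mul_assoc (convR W _), convR_mul_convR, conv_id_antipode, ← mul_assoc,
        hLR, mul_assoc, convL_mul_convL, conv_id_antipode]
    rw [this]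
    ext h
    rw [convConst_mul_apply]
    exact (comul_eL_left h).symm
  have hND : N * D = P * D := by
    have := hcomp (S W) .id
    rw [conv_antipode_id] at this
    rw [hPD, hD]
    exact this
  have hDN : D * N = D * P := by
    have := hcomp .id (S W)
    rw [conv_id_antipode] at this
    rw [hDP, hD]
    exact this
  have hN : N * D * N = N := by
    rw [hND, hPD, hcomp, conv_eR_antipode]
  -- Writing `Δ(h) = Δ(h)Δ(1)` and applying the flip and `S ⊗ S` brings `Δ(1)` to the left, where it
  -- is idempotent.
  have hKP : K * P = P := by
    ext h
    simp only [P]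
    rw [convConst_mul_apply, convR_mul_convL_apply, ← comul_mul_comul_one h]
    have e : ∀ z u : W ⊗[ℂ] W, TensorProduct.map (S W) (S W) (TensorProduct.comm ℂ W W (z * u)) =
        TensorProduct.comm ℂ W W (TensorProduct.map (S W) (S W) u) *
          TensorProduct.map (S W) (S W) (TensorProduct.comm ℂ W W z) := by
      intro z u
      induction z using TensorProduct.induction_on with
      | zero => simp
      | add x y hx hy => simp only [map_add, hx, hy, add_mul, mul_add]
      | tmul p q =>
        induction u using TensorProduct.induction_on with
        | zero => simp
        | add x y hx hy => simp only [map_add, hx, hy, add_mul, mul_add]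
        | tmul p q => simp [antipode_mul_rev]
    have e' : TensorProduct.comm ℂ W W (TensorProduct.comm ℂ W W (Δ W 1)) = Δ W 1 :=
      (TensorProduct.comm ℂ W W).symm_apply_apply _
    rw [e, map_antipode_one, e', ← mul_assoc, ← comul_mul, one_mul]
  have hP : P * D * P = P := by
    have h1 : P * D = K * convR W (eR W) := by
      rw [hPD]
      ext h
      rw [convConst_mul_apply]
      exact comul_eR_right h
    rw [h1]
    simp only [P]
    rw [mul_assoc, ← mul_assoc (convR W _), convR_mul_convR, conv_eR_antipode]
    exact hKP
  have hNP : N = P := by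
    rw [← hN, mul_assoc, hDN, ← mul_assoc, hND, hP]
  have := congrArg (fun f => f.ofConv h) hNP
  exact this.trans (convR_mul_convL_apply _ _ _)

/-! ### Cocommutative Haar integrals -/

/-- `Σ l⁽¹⁾ ⊗ x l⁽²⁾ = Σ S(x) l⁽¹⁾ ⊗ l⁽²⁾` for left integrals `l`. -/
lemma comul_left_integral {l : W} (hl : ∀ x : W, x * l = epsL W x * l) (x : W) :
    (1 ⊗ₜ x) * Δ W l = (S W x ⊗ₜ 1) * Δ W l := by
  -- Both sides of `Δ(xl) = Δ(ε_L(x)l)` are convolved with `S` on the first leg. On the left `Σ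
  -- S(x⁽¹⁾)x⁽²⁾l⁽¹⁾ ⊗ x⁽³⁾l⁽²⁾` collapses to `Σ l⁽¹⁾ ⊗ xl⁽²⁾` through `ε_R`, and on the right `S *
  -- ε_L = S`.
  have h1 : convL W (S W) * toConv (Δ W ∘ₗ LinearMap.mulRight ℂ l) =
      convL W (S W) * toConv (Δ W ∘ₗ LinearMap.mulRight ℂ l ∘ₗ eL W) := by
    have h0 : Δ W ∘ₗ LinearMap.mulRight ℂ l = Δ W ∘ₗ LinearMap.mulRight ℂ l ∘ₗ eL W :=
      LinearMap.ext fun x => congrArg (Δ W) (hl x)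
    rw [h0]
  have h2 : toConv (Δ W ∘ₗ LinearMap.mulRight ℂ l) =
      convL W .id * convR W .id * convConst W (Δ W l) := by
    ext h
    rw [mul_convConst_apply, convL_mul_convR_apply]
    simp [comul_mul]
  have h3 : toConv (Δ W ∘ₗ LinearMap.mulRight ℂ l ∘ₗ eL W) =
      convL W (eL W) * convConst W (Δ W l) := by
    ext h
    rw [mul_convConst_apply]
    exact comul_eL_mul h l
  have hRL : convL W (eR W) * convR W .id = convR W .id * convConst W (Δ W 1) := by
    ext h
    rw [convL_mul_convR_apply, mul_convConst_apply]
    exact rTensor_eR h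
  rw [h2, h3, ← mul_assoc, ← mul_assoc, ← mul_assoc, convL_mul_convL, convL_mul_convL,
    conv_antipode_id, conv_antipode_eL, hRL, mul_assoc, convConst_mul_convConst,
    ← comul_mul, one_mul] at h1
  have := congrArg (fun f => f.ofConv x) h1
  dsimp only at this
  rw [mul_convConst_apply, mul_convConst_apply] at this
  exact this

/-- A cocommutative Haar integral forces `S² = 1`. -/
theorem antipode_antipode_of_haar {l : W} (hl : IsHaarIntegral l) (hc : IsCocommutative l) (x : W) :
    S W (S W x) = x := by
  have h1 := comul_left_integral hl.left_integral x
  have e : ∀ a b : W, ∀ z : W ⊗[ℂ] W, TensorProduct.comm ℂ W W ((a ⊗ₜ b) * z) =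
      (b ⊗ₜ a) * TensorProduct.comm ℂ W W z := by
    intro a b z
    induction z using TensorProduct.induction_on with
    | zero => simp
    | add x y hx hy => simp only [map_add, hx, hy, mul_add]
    | tmul p q => simp
  have hc' : TensorProduct.comm ℂ W W (Δ W l) = Δ W l := hc
  -- Cocommutativity of `l` allows the transfer `x ↦ S(x)` from leg to leg to be made in both
  -- directions, hence twice. Applying `S` to the second leg and multiplying then removes `l`,
  -- because `Σ l⁽¹⁾S(l⁽²⁾) = ε_L(l) = 1`.
  have h2 : (x ⊗ₜ 1) * Δ W l = (S W (S W x) ⊗ₜ 1) * Δ W l := by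
    have := congrArg (TensorProduct.comm ℂ W W) h1
    rw [e, e, hc'] at this
    rw [this, comul_left_integral hl.left_integral]
  have e2 : ∀ a : W, ∀ z : W ⊗[ℂ] W, LinearMap.mul' ℂ W ((S W).lTensor W ((a ⊗ₜ 1) * z)) =
      a * LinearMap.mul' ℂ W ((S W).lTensor W z) := by
    intro a z
    induction z using TensorProduct.induction_on with
    | zero => simp
    | add x y hx hy => simp only [map_add, hx, hy, mul_add]
    | tmul p q => simp [mul_assoc]
  have h3 : LinearMap.mul' ℂ W ((S W).lTensor W (Δ W l)) = 1 :=
    (mul_antipode l).trans hl.left_normalized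
  have := congrArg (fun z => LinearMap.mul' ℂ W ((S W).lTensor W z)) h2
  simp only [e2, h3, mul_one] at this
  exact this.symm

/-- `S` is its own two-sided inverse, hence a unit of `End W`, so `Ring.inverse` is a genuine
inverse. -/
lemma antipodeInv_eq (hS : ∀ x : W, S W (S W x) = x) : antipodeInv W = S W := by
  have h : (S W : Module.End ℂ W) * S W = 1 := LinearMap.ext hS
  have hu : IsUnit (S W : Module.End ℂ W) := ⟨⟨_, _, h, h⟩, rfl⟩
  have h2 := Ring.inverse_mul_cancel _ hu
  calc antipodeInv W = Ring.inverse (S W : Module.End ℂ W) * (S W * S W) := by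
        rw [h, mul_one]; rfl
    _ = S W := by rw [← mul_assoc, h2, one_mul]

end AntipodeComul

/-! ### Transport of cyclic products through paths -/

section Transport

/-- A path crosses the elements of `X`, on which a permutation `σ` acts: it either turns across
`x`, from the gap before `x` to the gap before `σ x`, or it moves along the edge of `x`, from the
gap before `x` to the gap after `rev x`. -/
inductive Step (X : Type*)
  | turn (x : X)
  | move (x : X)

variable {X G : Type*} [Monoid G]

namespace Step

/-- The element after the starting gap. -/
def src : Step X → X
  | turn x | move x => x

/-- The element after the final gap. -/
def tgt (σ : Equiv.Perm X) (rev : X → X) : Step X → X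
  | turn x => σ x
  | move x => σ (rev x)

/-- The condition for two steps not to overlap. -/
def Apart (rev : X → X) : Step X → Step X → Prop
  | turn x, turn y => x ≠ y
  | move x, move y => x ≠ y
  | turn x, move y => x ≠ y ∧ x ≠ rev y
  | move y, turn x => x ≠ y ∧ x ≠ rev y

/-- A step ends right after the element it crosses (`turn x`) or after the end at which it arrives
(`move y`, after `rev y`). Injectivity turns equal targets into an overlap. Hence no gap is entered
twice by a path without overlap. -/
lemma Apart.tgt_ne {σ : Equiv.Perm X} {rev : X → X} (hrev : Function.Injective rev) {s s' : Step X}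
    (h : s.Apart rev s') : s.tgt σ rev ≠ s'.tgt σ rev := by
  cases s <;> cases s' <;> simp only [Apart] at h <;> simp only [tgt, ne_eq, σ.injective.eq_iff]
  · exact h
  · exact h.2
  · exact fun e => h.2 e.symm
  · exact fun e => h (hrev e)

/-- A path of steps from the gap before `p` to the gap before `q`. -/
def Path (σ : Equiv.Perm X) (rev : X → X) : X → List (Step X) → X → Prop
  | p, [], q => p = q
  | p, s :: l, q => s.src = p ∧ Path σ rev (s.tgt σ rev) l q

end Step

/-- The commutation relations between the step operators `τ`, the operators `α` and `ν`. -/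
structure StepRelations (rev : X → X) (α : X → G) (ν : G) (τ : Step X → G) : Prop where
  turn_comm : ∀ x y, y ≠ x → Commute (τ (.turn x)) (α y)
  turn_braid : ∀ x, τ (.turn x) * (α x * ν) = ν * α x * τ (.turn x)
  move_comm : ∀ x y, y ≠ x → y ≠ rev x → Commute (τ (.move x)) (α y)
  move_out : ∀ x, τ (.move x) * α x = ν * α x * τ (.move x)
  move_in : ∀ x, τ (.move x) * (α (rev x) * ν) = α (rev x) * τ (.move x)

variable {σ : Equiv.Perm X} {rev : X → X} {α : X → G} {ν : G} {τ : Step X → G}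

lemma commute_list_prod {g : G} {c : List X} (h : ∀ y ∈ c, Commute g (α y)) :
    Commute g (c.map α).prod :=
  Commute.list_prod_right _ _ (by simpa using h)

lemma StepRelations.commute_of_apart_turn (R : StepRelations rev α ν τ) {x : X} {l : List (Step X)}
    (h : ∀ s ∈ l, Step.Apart rev (.turn x) s) : Commute (l.map τ).prod (α x) := by
  refine Commute.list_prod_left _ _ fun g hg => ?_
  obtain ⟨s, hs, rfl⟩ := List.mem_map.1 hg
  have := h s hs
  cases s with
  | turn y => exact R.turn_comm _ _ this
  | move y => exact R.move_comm _ _ this.1 this.2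

/-- The invariant is that `ν` stands in the product at the gap where the path currently is, so it
appears exactly when the path starts at the head of the arc. The hypotheses on targets say that the
path never enters either boundary gap of the arc, which is harmless because arcs are always cut at
gaps that have already been entered. The induction runs over the steps, for all arcs simultaneously,
since an arrival inside the arc cuts it in two. -/
theorem StepRelations.transport_arc (R : StepRelations rev α ν τ)
    (hrev : Function.Injective rev) (hne : ∀ x, rev x ≠ x) {q : X} :
    ∀ (l : List (Step X)) (p x : X) (c : List X), Step.Path σ rev p l q →
      l.Pairwise (Step.Apart rev) → (x :: c).IsChain (fun a b => σ a = b) → (x :: c).Nodup →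
      q ∉ x :: c → (∀ s ∈ l, s.tgt σ rev ≠ x) →
      (∀ s ∈ l, s.tgt σ rev ≠ σ ((x :: c).getLast (by simp))) → p ∉ c →
      (x ≠ p → Commute (l.map τ).prod ((x :: c).map α).prod) ∧
      (x = p → (l.map τ).prod * ((x :: c).map α).prod =
        ν * ((x :: c).map α).prod * (l.map τ).prod) := by
  intro l
  induction l with
  | nil =>
    intro p x c hp _ _ _ hq _ _ _
    obtain rfl : p = q := hp
    exact ⟨fun _ => by simp, fun h => absurd (h ▸ List.mem_cons_self) hq⟩
  | cons s l ih =>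
    intro p x c hp hl hc hnd hq hx hy hpc
    obtain ⟨rfl, hp⟩ := hp
    obtain ⟨hs, hl'⟩ := List.pairwise_cons.1 hl
    clear hl
    have hx' : ∀ s ∈ l, s.tgt σ rev ≠ x := fun s' h => hx s' (List.mem_cons_of_mem _ h)
    have hy' : ∀ s ∈ l, s.tgt σ rev ≠ σ ((x :: c).getLast (by simp)) :=
      fun s' h => hy s' (List.mem_cons_of_mem _ h)
    have hsx := hx s List.mem_cons_self
    have hsy := hy s List.mem_cons_self
    have hdist : ∀ s' ∈ l, s'.tgt σ rev ≠ s.tgt σ rev := fun s' h => ((hs s' h).tgt_ne hrev).symm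
    simp only [List.map_cons (f := τ), List.prod_cons (a := τ s)]
    -- an element whose successor is the next label can occur only inside the arc
    have hsplit : ∀ e, σ e = s.tgt σ rev → e ∈ x :: c → ∃ u t, x :: c = u ++ e :: s.tgt σ rev :: t := by
      intro e he hmem
      obtain ⟨u, t, hut⟩ := List.append_of_mem hmem
      cases t with
      | nil =>
        exfalso
        apply hsy
        simp only [hut, List.getLast_append_singleton, he]
      | cons b t =>
        rw [hut] at hc
        have hb : σ e = b := by
          have := (List.isChain_append.1 hc).2.1
          exact (List.isChain_cons_cons.1 this).1
        exact ⟨u, t, by rw [hut, ← he, hb]⟩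
    cases s with
    | turn p =>
      simp only [Step.src, Step.tgt] at *
      by_cases hxp : x = p
      · subst hxp
        refine ⟨fun h => absurd rfl h, fun _ => ?_⟩
        -- The turn leads from the head of the arc to the head of its tail. The tail yields `ν` by
        -- induction, and the braid relation carries this `ν` to the left of `α x`.
        obtain ⟨u, t, hut⟩ := hsplit x rfl List.mem_cons_self
        have hu : u = [] := by
          cases u with
          | nil => rfl
          | cons a u =>
            simp only [List.cons_append, List.cons.injEq] at hut
            rw [hut.2] at hnd
            simp at hnd
        subst hu
        simp only [List.nil_append, List.cons.injEq, true_and] at hut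
        subst hut
        have h1 := (ih (σ x) (σ x) t hp hl' (List.isChain_cons_cons.1 hc).2 hnd.of_cons
          (fun h => hq (List.mem_cons_of_mem _ h)) hdist (by simpa using hy')
          (List.nodup_cons.1 hnd.of_cons).1).2 rfl
        have h2 := R.commute_of_apart_turn hs
        have h3 : Commute (τ (.turn x)) (((σ x :: t).map α)).prod := commute_list_prod fun y hy =>
          R.turn_comm _ _ fun e => (List.nodup_cons.1 hnd).1 (e ▸ hy)
        have hb := R.turn_braid x
        rw [List.map_cons, List.prod_cons]
        generalize ((σ x :: t).map α).prod = A at *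
        generalize (l.map τ).prod = T at *
        calc τ (.turn x) * T * (α x * A) = τ (.turn x) * (T * α x) * A := by simp only [mul_assoc]
          _ = τ (.turn x) * α x * (T * A) := by rw [h2.eq]; simp only [mul_assoc]
          _ = (τ (.turn x) * (α x * ν)) * A * T := by rw [h1]; simp only [mul_assoc]
          _ = ν * α x * (τ (.turn x) * A) * T := by rw [hb]; simp only [mul_assoc]
          _ = ν * (α x * A) * (τ (.turn x) * T) := by rw [h3.eq]; simp only [mul_assoc]
      · refine ⟨fun _ => ?_, fun h => absurd h hxp⟩
        have hpm : p ∉ x :: c := by simp [hpc, Ne.symm hxp]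
        have hpc' : σ p ∉ c := by
          intro h
          obtain ⟨u, t, hut⟩ := List.append_of_mem h
          have hc' := hc
          rw [hut] at hc'
          have hl := List.getLast_mem (l := x :: u) (by simp)
          have : σ ((x :: u).getLast (by simp)) = σ p := by
            rw [← List.cons_append] at hc'
            exact (List.isChain_append.1 hc').2.2 _ (List.getLast_mem_getLast? _) _ (by simp)
          rw [σ.injective this] at hl
          apply hpm
          rw [hut, ← List.cons_append]
          exact List.mem_append_left _ hl
        have h1 := (ih (σ p) x c hp hl' hc hnd hq hx' hy' hpc').1 (Ne.symm hsx)
        have h3 : Commute (τ (.turn p)) (((x :: c).map α)).prod := commute_list_prod fun y hy =>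
          R.turn_comm _ _ fun e => hpm (e ▸ hy)
        exact h3.mul_left h1
    | move p =>
      simp only [Step.src, Step.tgt] at *
      have hbo := R.move_out p
      have hbi := R.move_in p
      by_cases he : rev p ∈ x :: c
      -- The move arrives right after `rev p`, so the arc is cut there. The later steps commute with
      -- the front part and emit `ν` from the rear part, and this `ν` is absorbed at `rev p` by
      -- `move_in`.
      · obtain ⟨u, t, hut⟩ := hsplit (rev p) rfl he
        have hnd' := hnd
        rw [hut] at hnd' hc
        obtain ⟨hndu, hndt, hdisj⟩ := List.nodup_append.1 hnd'
        have heu : rev p ∉ u := fun h => hdisj _ h _ List.mem_cons_self rfl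
        obtain ⟨het, hndt⟩ := List.nodup_cons.1 hndt
        have hct := (List.isChain_append.1 hc).2.1
        have hpm : ∀ y ∈ x :: c, y = p → y = x := by
          intro y hy hyp
          rcases List.mem_cons.1 hy with h | h
          · exact h
          · exact absurd (hyp ▸ h) hpc
        have ht1 : (l.map τ).prod * ((σ (rev p) :: t).map α).prod =
            ν * ((σ (rev p) :: t).map α).prod * (l.map τ).prod := by
          refine (ih (σ (rev p)) (σ (rev p)) t hp hl' (List.isChain_cons_cons.1 hct).2 hndt
            (fun h => hq ?_) hdist ?_ (List.nodup_cons.1 hndt).1).2 rfl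
          · rw [hut]
            exact List.mem_append_right _ (List.mem_cons_of_mem _ h)
          · intro s hs
            have := hy' s hs
            simpa [hut] using this
        have hu1 : Commute (l.map τ).prod (((u ++ [rev p]).map α)).prod := by
          have hcu : (u ++ [rev p]).IsChain (fun a b => σ a = b) := by
            have : u ++ rev p :: σ (rev p) :: t = (u ++ [rev p]) ++ σ (rev p) :: t := by simp
            rw [this] at hc
            exact (List.isChain_append.1 hc).1
          have hnu : (u ++ [rev p]).Nodup := by
            have : u ++ rev p :: σ (rev p) :: t = (u ++ [rev p]) ++ σ (rev p) :: t := by simp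
            rw [this] at hnd'
            exact (List.nodup_append.1 hnd').1
          have hσu : σ (rev p) ∉ u ++ [rev p] := by
            intro h
            rcases List.mem_append.1 h with h | h
            · exact hdisj _ h _ (List.mem_cons_of_mem _ List.mem_cons_self) rfl
            · exact het (List.mem_cons.2 (Or.inl (List.mem_singleton.1 h).symm))
          have hqu : q ∉ u ++ [rev p] := by
            intro h
            apply hq
            rw [hut]
            rcases List.mem_append.1 h with h | h
            · exact List.mem_append_left _ h
            · exact List.mem_append_right _ (by rw [List.mem_singleton.1 h]; exact List.mem_cons_self)
          cases u with
          | nil =>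
            exact (ih (σ (rev p)) (rev p) [] hp hl' hcu hnu hqu (by
                have : x = rev p := by simpa using congrArg List.head? hut
                rw [← this]; exact hx')
              (by simpa using hdist) (by simp)).1 (fun h => hσu (by rw [← h]; simp))
          | cons a u =>
            have hxa : x = a := by simpa using congrArg List.head? hut
            subst hxa
            refine (ih (σ (rev p)) x (u ++ [rev p]) hp hl' hcu hnu hqu hx' ?_
              (fun h => hσu (List.mem_cons_of_mem _ h))).1 (Ne.symm hsx)
            intro s hs
            simpa using hdist s hs
        have hct' : Commute (τ (.move p)) ((σ (rev p) :: t).map α).prod := by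
          refine commute_list_prod fun y hy => R.move_comm _ _ ?_ ?_
          · intro e
            have hyx := hpm y (by rw [hut]; exact List.mem_append_right _ (List.mem_cons_of_mem _ hy)) e
            cases u with
            | nil =>
              have : x = rev p := by simpa using congrArg List.head? hut
              exact hne p (by rw [← this, ← hyx, e])
            | cons a u =>
              have hxa : x = a := by simpa using congrArg List.head? hut
              exact hdisj a List.mem_cons_self y (List.mem_cons_of_mem _ hy) (by rw [hyx, hxa])
          · intro e
            exact het (e ▸ hy)
        rw [hut]
        have hprod : ((u ++ rev p :: σ (rev p) :: t).map α).prod =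
            (u.map α).prod * α (rev p) * ((σ (rev p) :: t).map α).prod := by
          simp [mul_assoc]
        have hprod' : ((u ++ [rev p]).map α).prod = (u.map α).prod * α (rev p) := by simp
        rw [hprod]
        rw [hprod'] at hu1
        generalize ((σ (rev p) :: t).map α).prod = B at *
        generalize (l.map τ).prod = T at *
        have key : τ (.move p) * T * ((u.map α).prod * α (rev p) * B) =
            τ (.move p) * (u.map α).prod * (α (rev p) * ν) * B * T := by
          calc τ (.move p) * T * ((u.map α).prod * α (rev p) * B)
              = τ (.move p) * (T * ((u.map α).prod * α (rev p))) * B := by simp only [mul_assoc]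
            _ = τ (.move p) * ((u.map α).prod * α (rev p)) * (T * B) := by
              rw [hu1.eq]; simp only [mul_assoc]
            _ = _ := by rw [ht1]; simp only [mul_assoc]
        have hfront : ∀ w : List X, (∀ y ∈ w, y ∈ u) → (p ∉ w) →
            Commute (τ (.move p)) (w.map α).prod := fun w hw hpw =>
          commute_list_prod fun y hy => R.move_comm _ _ (fun e => hpw (e ▸ hy))
            (fun e => heu (e ▸ hw y hy))
        -- If the move also leaves from the head of the arc, `move_out` emits a new `ν` in front,
        -- independently of the one absorbed at the cut.
        refine ⟨fun hxp => ?_, fun hxp => ?_⟩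
        · have hpu : p ∉ u := by
            intro h
            exact hxp (hpm p (by rw [hut]; exact List.mem_append_left _ h) rfl).symm
          have hcu := hfront u (fun _ h => h) hpu
          show τ (.move p) * T * _ = _ * (τ (.move p) * T)
          rw [key, hcu.eq, mul_assoc (u.map α).prod, hbi]
          calc (u.map α).prod * (α (rev p) * τ (.move p)) * B * T
              = (u.map α).prod * α (rev p) * (τ (.move p) * B) * T := by simp only [mul_assoc]
            _ = _ := by rw [hct'.eq]; simp only [mul_assoc]
        · cases u with
          | nil =>
            have : x = rev p := by simpa using congrArg List.head? hut
            exact absurd (this.symm.trans hxp) (hne p)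
          | cons a u =>
            have hxa : x = a := by simpa using congrArg List.head? hut
            subst hxa
            subst hxp
            have hcu := hfront u (fun _ h => List.mem_cons_of_mem _ h) (List.nodup_cons.1 hndu).1
            rw [key, List.map_cons, List.prod_cons]
            generalize (u.map α).prod = U at *
            calc τ (.move x) * (α x * U) * (α (rev x) * ν) * B * T
                = (τ (.move x) * α x) * U * (α (rev x) * ν) * B * T := by simp only [mul_assoc]
              _ = ν * α x * (τ (.move x) * U) * (α (rev x) * ν) * B * T := by
                rw [hbo]; simp only [mul_assoc]
              _ = ν * α x * U * (τ (.move x) * (α (rev x) * ν)) * B * T := by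
                rw [hcu.eq]; simp only [mul_assoc]
              _ = ν * α x * U * α (rev x) * (τ (.move x) * B) * T := by
                rw [hbi]; simp only [mul_assoc]
              _ = _ := by rw [hct'.eq]; simp only [mul_assoc]
      -- The target is not an inner element of the arc: its predecessor `rev p` would then belong to
      -- the arc. So the later steps commute with the whole arc, and a `ν` appears only if the move
      -- starts at its head.
      · have hpc' : σ (rev p) ∉ c := by
          intro h
          obtain ⟨u, t, hut⟩ := List.append_of_mem h
          have hc' := hc
          rw [hut] at hc'
          have hl := List.getLast_mem (l := x :: u) (by simp)
          have : σ ((x :: u).getLast (by simp)) = σ (rev p) := by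
            rw [← List.cons_append] at hc'
            exact (List.isChain_append.1 hc').2.2 _ (List.getLast_mem_getLast? _) _ (by simp)
          rw [σ.injective this] at hl
          apply he
          rw [hut, ← List.cons_append]
          exact List.mem_append_left _ hl
        have h1 := (ih (σ (rev p)) x c hp hl' hc hnd hq hx' hy' hpc').1 (Ne.symm hsx)
        have hce : rev p ∉ c := fun h => he (List.mem_cons_of_mem _ h)
        have hcc : Commute (τ (.move p)) (c.map α).prod :=
          commute_list_prod fun y hy => R.move_comm _ _ (fun e => hpc (e ▸ hy))
            (fun e => hce (e ▸ hy))
        refine ⟨fun hxp => ?_, fun hxp => ?_⟩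
        · have : Commute (τ (.move p)) ((x :: c).map α).prod := by
            rw [List.map_cons, List.prod_cons]
            refine Commute.mul_right (R.move_comm _ _ hxp ?_) hcc
            intro e
            exact he (by rw [← e]; exact List.mem_cons_self)
          exact this.mul_left h1
        · subst hxp
          rw [mul_assoc, h1.eq, List.map_cons, List.prod_cons]
          generalize (c.map α).prod = U at *
          generalize (l.map τ).prod = T at *
          calc τ (.move x) * (α x * U * T) = (τ (.move x) * α x) * U * T := by simp only [mul_assoc]
            _ = ν * α x * (τ (.move x) * U) * T := by rw [hbo]; simp only [mul_assoc]
            _ = _ := by rw [hcc.eq]; simp only [mul_assoc]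

/-- The path starts off the circle and can reach it only through a move. At that moment the circle
is cut open at the arrival gap, and `transport_arc` treats it as one arc. The relation `r` stands
for equality after evaluation at a cocommutative element: it allows rotation of the product and is
stable under multiplication by `M` on both sides, where `M` contains the step operators. -/
theorem StepRelations.transport_circle (R : StepRelations rev α ν τ)
    (hrev : Function.Injective rev) (hne : ∀ x, rev x ≠ x) {r : G → G → Prop}
    (hr : Equivalence r) {M : Submonoid G} (hτ : ∀ s, τ s ∈ M)
    (hmul : ∀ T ∈ M, ∀ T' ∈ M, ∀ Y Z, r Y Z → r (T * Y * T') (T * Z * T'))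
    (hν : ∀ c : List X, r (ν * (c.map α).prod) ((c.map α).prod * ν))
    (hrot : ∀ c₁ c₂ : List X, (c₁ ++ c₂).Nodup →
      r ((c₁ ++ c₂).map α).prod ((c₂ ++ c₁).map α).prod)
    {c : List X} (hc : c.IsChain (fun a b => σ a = b))
    (hlast : ∀ x ∈ c.getLast?, ∀ y ∈ c.head?, σ x = y) (hnd : c.Nodup)
    (hclosed : ∀ y, σ y ∈ c ↔ y ∈ c) {q : X} (hq : q ∉ c) :
    ∀ (l : List (Step X)) (p : X), Step.Path σ rev p l q → l.Pairwise (Step.Apart rev) → p ∉ c →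
      r ((l.map τ).prod * (c.map α).prod) ((c.map α).prod * (l.map τ).prod) := by
  intro l
  have hM : ∀ l : List (Step X), (l.map τ).prod ∈ M := fun l =>
    Submonoid.list_prod_mem _ fun g hg => by
      obtain ⟨s, -, rfl⟩ := List.mem_map.1 hg
      exact hτ s
  have hL : ∀ T ∈ M, ∀ Y Z, r Y Z → r (T * Y) (T * Z) := fun T hT Y Z h => by
    simpa using hmul T hT 1 M.one_mem Y Z h
  have hR : ∀ T ∈ M, ∀ Y Z, r Y Z → r (Y * T) (Z * T) := fun T hT Y Z h => by
    simpa using hmul 1 M.one_mem T hT Y Z h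
  induction l with
  | nil =>
    intro p _ _ _
    simpa using hr.refl _
  | cons s l ih =>
    intro p hp hl hpc
    obtain ⟨rfl, hp⟩ := hp
    obtain ⟨hs, hl'⟩ := List.pairwise_cons.1 hl
    simp only [List.map_cons (f := τ), List.prod_cons (a := τ s)]
    have hstep : Commute (τ s) (c.map α).prod → s.tgt σ rev ∉ c →
        r (τ s * (l.map τ).prod * (c.map α).prod) ((c.map α).prod * (τ s * (l.map τ).prod)) := by
      intro h1 h2
      have h3 := hL _ (hτ s) _ _ (ih _ hp hl' h2)
      rwa [← mul_assoc, ← mul_assoc, h1.eq, mul_assoc _ (τ s)] at h3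
    cases s with
    | turn p =>
      exact hstep (commute_list_prod fun y hy => R.turn_comm _ _ fun e => hpc (e ▸ hy))
        (fun h => hpc ((hclosed _).1 h))
    | move p =>
      by_cases he : rev p ∈ c
      -- The circle is rotated so that it begins right after `rev p` and ends with `rev p`. Both
      -- boundary gaps of this arc are then the gap just entered, which no later step enters again.
      · obtain ⟨u, t, rfl⟩ := List.append_of_mem he
        have hT : (t ++ (u ++ [rev p])).Nodup := by
          have : ((u ++ [rev p]) ++ t).Nodup := by simpa using hnd
          exact List.nodup_append_comm.1 this
        have hchain : (t ++ (u ++ [rev p])).IsChain (fun a b => σ a = b) := by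
          have h1 : ((u ++ [rev p]) ++ t).IsChain (fun a b => σ a = b) := by simpa using hc
          refine List.isChain_append.2 ⟨(List.isChain_append.1 h1).2.1,
            (List.isChain_append.1 h1).1, fun x hx y hy => hlast x ?_ y ?_⟩
          · rw [List.getLast?_append, List.getLast?_cons]
            cases t with
            | nil => simp at hx
            | cons b t =>
              have hx' : (b :: t).getLast? = some x := hx
              simp [hx']
          · cases u <;> simpa using hy
        have hhead : ∃ cc, t ++ (u ++ [rev p]) = σ (rev p) :: cc := by
          cases t with
          | nil =>
            cases u with
            | nil => exact ⟨[], by simpa using (hlast (rev p) (by simp) (rev p) (by simp)).symm⟩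
            | cons a u => exact ⟨u ++ [rev p], by
                simpa using (hlast (rev p) (by rw [List.getLast?_append]; simp) a (by simp)).symm⟩
          | cons b t =>
            refine ⟨t ++ (u ++ [rev p]), ?_⟩
            have := (List.isChain_cons_cons.1 (List.isChain_append.1 hc).2.1).1
            simp [this]
        obtain ⟨cc, hcc⟩ := hhead
        have htgt : ∀ s ∈ l, s.tgt σ rev ≠ σ (rev p) := fun s' h => ((hs s' h).tgt_ne hrev).symm
        have hlst : (σ (rev p) :: cc).getLast (by simp) = rev p := by
          simp only [← hcc, ← List.append_assoc, List.getLast_append_singleton]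
        have key := (R.transport_arc hrev hne l (σ (rev p)) (σ (rev p)) cc hp hl' (hcc ▸ hchain)
          (hcc ▸ hT) (by rw [← hcc]; exact fun h => hq (by simp at h ⊢; tauto))
          htgt (by rw [hlst]; exact htgt) (List.nodup_cons.1 (hcc ▸ hT)).1).2 rfl
        rw [← hcc] at key
        have hrot' : r ((u ++ rev p :: t).map α).prod ((t ++ (u ++ [rev p])).map α).prod := by
          have := hrot (u ++ [rev p]) t (by simpa using hnd)
          simpa using this
        have hcom : Commute (τ (.move p)) ((t ++ u).map α).prod := by
          refine commute_list_prod fun y hy => R.move_comm _ _ ?_ ?_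
          · rintro rfl
            exact hpc (by simp at hy ⊢; tauto)
          · rintro rfl
            rw [← List.append_assoc] at hT
            exact (List.nodup_append.1 hT).2.2 _ hy _ (List.mem_singleton_self _) rfl
        have hT' := hM l
        have h1 := hL _ (M.mul_mem (hτ (.move p)) hT') _ _ hrot'
        have h2 := hR _ (M.mul_mem (hτ (.move p)) hT') _ _ (hr.symm hrot')
        -- The `ν` emitted in front of the whole circle goes around it to the back, next to `α (rev
        -- p)`, where `move_in` absorbs it.
        have h3 := hmul _ (hτ (.move p)) _ hT' _ _ (hν (t ++ (u ++ [rev p])))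
        refine hr.trans h1 (hr.trans ?_ h2)
        have e1 : ((t ++ (u ++ [rev p])).map α).prod = ((t ++ u).map α).prod * α (rev p) := by
          simp [mul_assoc]
        have hbi := R.move_in p
        rw [e1] at key h3 ⊢
        generalize ((t ++ u).map α).prod = A at *
        generalize (l.map τ).prod = T at *
        have e2 : τ (.move p) * T * (A * α (rev p)) =
            τ (.move p) * (ν * (A * α (rev p))) * T := by
          rw [mul_assoc, key]; simp only [mul_assoc]
        have e3 : τ (.move p) * (A * α (rev p) * ν) * T = A * α (rev p) * (τ (.move p) * T) := by
          calc _ = τ (.move p) * A * (α (rev p) * ν) * T := by simp only [mul_assoc]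
            _ = A * (τ (.move p) * (α (rev p) * ν)) * T := by rw [hcom.eq]; simp only [mul_assoc]
            _ = _ := by rw [hbi]; simp only [mul_assoc]
        rwa [e2, ← e3]
      · exact hstep (commute_list_prod fun y hy => R.move_comm _ _ (fun e => hpc (e ▸ hy))
          (fun e => he (e ▸ hy))) (fun h => he ((hclosed _).1 h))

end Transport

/-! ### Convolution products of operator families. -/

section ConvolutionProducts

variable {C M N : Type*} [AddCommGroup C] [Module ℂ C] [Coalgebra ℂ C]
  [AddCommGroup M] [Module ℂ M] [AddCommGroup N] [Module ℂ N]

lemma commute_convMul {f g : WithConv (C →ₗ[ℂ] Module.End ℂ M)} {a : Module.End ℂ M} (hf : ∀ x, Commute (f x) a)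
    (hg : ∀ x, Commute (g x) a) (x : C) : Commute ((f * g) x) a := by
  rw [(ℛ ℂ x).convMul_apply]
  exact Commute.sum_left _ _ _ fun i _ => (hf _).mul_left (hg _)

lemma comp_convMul {D : M →ₗ[ℂ] N} {f g : WithConv (C →ₗ[ℂ] Module.End ℂ M)}
    {F G : WithConv (C →ₗ[ℂ] Module.End ℂ N)} (hf : ∀ x, D ∘ₗ f x = F x ∘ₗ D)
    (hg : ∀ x, D ∘ₗ g x = G x ∘ₗ D) (x : C) : D ∘ₗ (f * g) x = (F * G) x ∘ₗ D := by
  rw [(ℛ ℂ x).convMul_apply, (ℛ ℂ x).convMul_apply]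
  ext m
  have hf' : ∀ x m, D (f x m) = F x (D m) := fun x m => LinearMap.congr_fun (hf x) m
  have hg' : ∀ x m, D (g x m) = G x (D m) := fun x m => LinearMap.congr_fun (hg x) m
  simp [hf', hg']

/-- As for tensor products of representations: since `Δ` is multiplicative and the two families
commute, their convolution reverses products if each of them does. -/
lemma convMul_antimul {W : Type*} [Ring W] [Algebra ℂ W] [WeakHopfAlgebra W]
    {f g : WithConv (W →ₗ[ℂ] Module.End ℂ M)} (hf : ∀ x y, f (x * y) = f y * f x)
    (hg : ∀ x y, g (x * y) = g y * g x) (hc : ∀ x y, Commute (f x) (g y)) (x y : W) :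
    (f * g) (x * y) = (f * g) y * (f * g) x := by
  rw [LinearMap.convMul_apply, LinearMap.convMul_apply, LinearMap.convMul_apply, comul_mul]
  generalize (comul (R := ℂ) x) = z
  generalize (comul (R := ℂ) y) = w
  induction z using TensorProduct.induction_on with
  | zero => simp
  | add x y hx hy => simp only [map_add, hx, hy, add_mul, mul_add]
  | tmul a b =>
    induction w using TensorProduct.induction_on with
    | zero => simp
    | add x y hx hy => simp only [map_add, hx, hy, add_mul, mul_add]
    | tmul c d =>
      have hf' : f.ofConv (a * c) = f.ofConv c * f.ofConv a := hf a c
      have hg' : g.ofConv (b * d) = g.ofConv d * g.ofConv b := hg b d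
      have hc' : f.ofConv a * g.ofConv d = g.ofConv d * f.ofConv a := hc a d
      simp only [Algebra.TensorProduct.tmul_mul_tmul, TensorProduct.map_tmul,
        LinearMap.mul'_apply, hf', hg', mul_assoc]
      rw [← mul_assoc (f.ofConv a), hc']
      simp only [mul_assoc]

end ConvolutionProducts

/-! ### The action and the coaction of `W` on `W ⊗ Ŵ`. -/

section RibbonSpace

variable (W : Type*) [Ring W] [Algebra ℂ W] [WeakHopfAlgebra W]

/-- The space `W ⊗ Ŵ` labelling the ribbon operators. -/
abbrev RibbonSpace : Type _ := W ⊗[ℂ] Dual ℂ W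

/-- `g ⊗ ψ ↦ g k ⊗ ψ` -/
def actRight : WithConv (W →ₗ[ℂ] Module.End ℂ (RibbonSpace W)) :=
  toConv (LinearMap.rTensorHom (Dual ℂ W) ∘ₗ (LinearMap.mul ℂ W).flip)

/-- `g ⊗ ψ ↦ g ⊗ ψ(k •)` -/
def actDual : WithConv (W →ₗ[ℂ] Module.End ℂ (RibbonSpace W)) :=
  toConv (LinearMap.lTensorHom W ∘ₗ Dual.transpose (R := ℂ) (M := W) (M' := W) ∘ₗ
    LinearMap.mul ℂ W)

/-- `g ⊗ ψ ↦ S(k) g ⊗ ψ` -/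
def actLeft : WithConv (W →ₗ[ℂ] Module.End ℂ (RibbonSpace W)) :=
  toConv (LinearMap.rTensorHom (Dual ℂ W) ∘ₗ LinearMap.mul ℂ W ∘ₗ S W)

/-- `g ⊗ ψ ↦ Σ S(k⁽³⁾) g k⁽¹⁾ ⊗ ψ(k⁽²⁾ •)` -/
def lam : WithConv (W →ₗ[ℂ] Module.End ℂ (RibbonSpace W)) :=
  actRight W * actDual W * actLeft W

variable {W}

@[simp] lemma actRight_tmul (k g : W) (ψ : Dual ℂ W) : actRight W k (g ⊗ₜ ψ) = (g * k) ⊗ₜ ψ := rfl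

@[simp] lemma actDual_tmul (k g : W) (ψ : Dual ℂ W) :
    actDual W k (g ⊗ₜ ψ) = g ⊗ₜ (ψ ∘ₗ LinearMap.mulLeft ℂ k) := rfl

@[simp] lemma actLeft_tmul (k g : W) (ψ : Dual ℂ W) :
    actLeft W k (g ⊗ₜ ψ) = (S W k * g) ⊗ₜ ψ := rfl

lemma actRight_actDual (x y : W) : Commute (actRight W x) (actDual W y) := by
  refine TensorProduct.ext' fun g ψ => ?_
  simp

lemma actLeft_actDual (x y : W) : Commute (actLeft W x) (actDual W y) := by
  refine TensorProduct.ext' fun g ψ => ?_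
  simp

lemma actRight_actLeft (x y : W) : Commute (actRight W x) (actLeft W y) := by
  refine TensorProduct.ext' fun g ψ => ?_
  simp [mul_assoc]

lemma actRight_mul (x y : W) : actRight W (x * y) = actRight W y * actRight W x := by
  refine TensorProduct.ext' fun g ψ => ?_
  simp [mul_assoc]

lemma actDual_mul (x y : W) : actDual W (x * y) = actDual W y * actDual W x := by
  refine TensorProduct.ext' fun g ψ => ?_
  simp [LinearMap.mulLeft_mul, LinearMap.comp_assoc]

lemma actLeft_mul (x y : W) : actLeft W (x * y) = actLeft W y * actLeft W x := by
  refine TensorProduct.ext' fun g ψ => ?_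
  simp [antipode_mul_rev, mul_assoc]

/-- Three mutually commuting families that reverse products are convolved. Since `Δ₂(1)` need not be
`1 ⊗ 1 ⊗ 1`, this gives an idempotent `lam 1`, not necessarily the identity. -/
lemma lam_mul (x y : W) : lam W (x * y) = lam W y * lam W x := by
  have h1 : ∀ x y, (actRight W * actDual W) (x * y) =
      (actRight W * actDual W) y * (actRight W * actDual W) x :=
    convMul_antimul actRight_mul actDual_mul actRight_actDual
  have h2 : ∀ x y, Commute ((actRight W * actDual W) x) (actLeft W y) := fun x y =>
    commute_convMul (fun x => actRight_actLeft x y) (fun x => (actLeft_actDual y x).symm) x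
  unfold lam
  exact convMul_antimul h1 actLeft_mul h2 x y

lemma lam_one_mul (x : W) : lam W 1 * lam W x = lam W x := by rw [← lam_mul, mul_one]

lemma lam_mul_one (x : W) : lam W x * lam W 1 = lam W x := by rw [← lam_mul, one_mul]

/-- With `S⁻¹ = S`, the endomorphism in the ribbon coproduct becomes a convolution of three simple
actions, one for each leg of `k`. -/
lemma twist_comul₂ (hS : ∀ x : W, S W (S W x) = x) (k : W) : twist W (comul₂ W k) = lam W k := by
  have e : ∀ z : W ⊗[ℂ] (W ⊗[ℂ] W), twist W z = LinearMap.mul' ℂ _ (TensorProduct.map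
      (actRight W).ofConv (LinearMap.mul' ℂ _ ∘ₗ
        TensorProduct.map (actDual W).ofConv (actLeft W).ofConv) z) := by
    intro z
    induction z using TensorProduct.induction_on with
    | zero => simp
    | add x y hx hy => simp only [map_add, hx, hy]
    | tmul a z =>
      induction z using TensorProduct.induction_on with
      | zero => simp
      | add x y hx hy => simp only [map_add, hx, hy, tmul_add]
      | tmul b c =>
        refine TensorProduct.ext' fun g ψ => ?_
        simp [twist, antipodeInv_eq hS, actRight, actDual, actLeft, Dual.transpose_apply, mul_assoc]
  rw [e, lam, mul_assoc, LinearMap.convMul_apply, comul₂, LinearMap.comp_apply]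
  generalize (comul (R := ℂ) k) = z
  induction z using TensorProduct.induction_on with
  | zero => simp
  | add x y hx hy => simp only [map_add, hx, hy]
  | tmul a b => rfl

variable (W)

/-- `h ⊗ v ↦ h k ⊗ v` -/
def mulR : WithConv (W →ₗ[ℂ] Module.End ℂ (W ⊗[ℂ] RibbonSpace W)) :=
  toConv (LinearMap.rTensorHom (RibbonSpace W) ∘ₗ (LinearMap.mul ℂ W).flip)

/-- `h ⊗ v ↦ k h ⊗ v` -/
def mulL : WithConv (W →ₗ[ℂ] Module.End ℂ (W ⊗[ℂ] RibbonSpace W)) :=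
  toConv (LinearMap.rTensorHom (RibbonSpace W) ∘ₗ LinearMap.mul ℂ W)

variable {W} in
/-- `f(k)` acting on the second factor of `W ⊗ (W ⊗ Ŵ)`. -/
def onSnd (f : WithConv (W →ₗ[ℂ] Module.End ℂ (RibbonSpace W))) :
    WithConv (W →ₗ[ℂ] Module.End ℂ (W ⊗[ℂ] RibbonSpace W)) :=
  toConv (LinearMap.lTensorHom W ∘ₗ f.ofConv)

/-- `f(k)` precomposed with a linear map. -/
def convComp {M : Type*} [AddCommGroup M] [Module ℂ M] (f : WithConv (W →ₗ[ℂ] Module.End ℂ M))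
    (u : W →ₗ[ℂ] W) : WithConv (W →ₗ[ℂ] Module.End ℂ M) := toConv (f.ofConv ∘ₗ u)

/-- `g ⊗ ψ ↦ Σ g⁽¹⁾ ⊗ (g⁽²⁾ ⊗ ψ)` -/
def comulFst : RibbonSpace W →ₗ[ℂ] W ⊗[ℂ] RibbonSpace W :=
  (TensorProduct.assoc ℂ W W (Dual ℂ W)).toLinearMap ∘ₗ (Δ W).rTensor (Dual ℂ W)

/-- The coaction of `W` on `W ⊗ Ŵ`. -/
def coact : RibbonSpace W →ₗ[ℂ] W ⊗[ℂ] RibbonSpace W :=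
  (lam W 1).lTensor W ∘ₗ comulFst W

variable {W}

@[simp] lemma mulR_tmul (k h : W) (v : RibbonSpace W) : mulR W k (h ⊗ₜ v) = (h * k) ⊗ₜ v := rfl
@[simp] lemma mulL_tmul (k h : W) (v : RibbonSpace W) : mulL W k (h ⊗ₜ v) = (k * h) ⊗ₜ v := rfl
@[simp] lemma onSnd_tmul (f : WithConv (W →ₗ[ℂ] Module.End ℂ (RibbonSpace W))) (k h : W)
    (v : RibbonSpace W) : onSnd f k (h ⊗ₜ v) = h ⊗ₜ f k v := rfl
@[simp] lemma convComp_apply {M : Type*} [AddCommGroup M] [Module ℂ M]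
    (f : WithConv (W →ₗ[ℂ] Module.End ℂ M)) (u : W →ₗ[ℂ] W) (k : W) : convComp W f u k = f (u k) := rfl

lemma onSnd_mul (f g : WithConv (W →ₗ[ℂ] Module.End ℂ (RibbonSpace W))) :
    onSnd (f * g) = onSnd f * onSnd g := by
  ext k : 2
  refine TensorProduct.ext' fun h v => ?_
  change h ⊗ₜ (f * g) k v = (onSnd f * onSnd g) k (h ⊗ₜ v)
  rw [(ℛ ℂ k).convMul_apply, (ℛ ℂ k).convMul_apply]
  simp [LinearMap.sum_apply, tmul_sum]

lemma mulR_onSnd (x y : W) (f) : Commute (mulR W x) (onSnd f y) := by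
  refine TensorProduct.ext' fun g ψ => ?_
  simp

lemma mulL_onSnd (x y : W) (f) : Commute (mulL W x) (onSnd f y) := by
  refine TensorProduct.ext' fun g ψ => ?_
  simp

lemma mulR_mulL (x y : W) : Commute (mulR W x) (mulL W y) := by
  refine TensorProduct.ext' fun g ψ => ?_
  simp [mul_assoc]

lemma comulFst_actRight (x : W) :
    comulFst W ∘ₗ actRight W x = (mulR W * onSnd (actRight W)) x ∘ₗ comulFst W := by
  refine TensorProduct.ext' fun g ψ => ?_
  rw [LinearMap.convMul_apply]
  simp only [LinearMap.comp_apply, actRight_tmul, comulFst, LinearMap.rTensor_tmul, comul_mul]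
  generalize (comul (R := ℂ) g) = z
  generalize (comul (R := ℂ) x) = w
  induction z using TensorProduct.induction_on with
  | zero => simp
  | add x y hx hy => simp only [map_add, hx, hy, add_mul, add_tmul]
  | tmul a b =>
    induction w using TensorProduct.induction_on with
    | zero => simp
    | add x y hx hy => simp only [map_add, hx, hy, mul_add, add_tmul, LinearMap.add_apply]
    | tmul c d => simp [mulR, onSnd, actRight]

lemma comulFst_actDual (x : W) :
    comulFst W ∘ₗ actDual W x = onSnd (actDual W) x ∘ₗ comulFst W := by
  refine TensorProduct.ext' fun g ψ => ?_
  simp only [LinearMap.comp_apply, actDual_tmul, comulFst, LinearMap.rTensor_tmul]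
  generalize (comul (R := ℂ) g) = z
  induction z using TensorProduct.induction_on with
  | zero => simp
  | add x y hx hy => simp only [map_add, hx, hy, add_tmul]
  | tmul a b => rfl

lemma comulFst_actLeft (x : W) :
    comulFst W ∘ₗ actLeft W x =
      (onSnd (actLeft W) * convComp W (mulL W) (S W)) x ∘ₗ comulFst W := by
  refine TensorProduct.ext' fun g ψ => ?_
  rw [LinearMap.convMul_apply]
  simp only [LinearMap.comp_apply, actLeft_tmul, comulFst, LinearMap.rTensor_tmul, comul_mul,
    comul_antipode]
  generalize (comul (R := ℂ) g) = z
  generalize (comul (R := ℂ) x) = w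
  induction z using TensorProduct.induction_on with
  | zero => simp
  | add x y hx hy => simp only [map_add, hx, hy, mul_add, add_tmul]
  | tmul a b =>
    induction w using TensorProduct.induction_on with
    | zero => simp
    | add x y hx hy => simp only [map_add, hx, hy, add_mul, add_tmul, LinearMap.add_apply]
    | tmul c d => simp [mulL, onSnd, actLeft, convComp]

/-- Applying `Δ` to `S(k⁽³⁾) g k⁽¹⁾` splits the two outer legs of `k`. The outermost pieces act on
the new tensor factor, and the inner ones reassemble with the middle leg into `lam`. -/
lemma comulFst_lam (x : W) :
    comulFst W ∘ₗ lam W x =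
      (mulR W * onSnd (lam W) * convComp W (mulL W) (S W)) x ∘ₗ comulFst W := by
  have := comp_convMul (comp_convMul comulFst_actRight comulFst_actDual) comulFst_actLeft x
  simpa only [lam, onSnd_mul, mul_assoc] using this

lemma coact_lam_aux (x : W) : onSnd (lam W) 1 ∘ₗ
    (mulR W * onSnd (lam W) * convComp W (mulL W) (S W)) x =
      (mulR W * onSnd (lam W) * convComp W (mulL W) (S W)) x ∘ₗ onSnd (lam W) 1 := by
  refine (commute_convMul (commute_convMul (fun x => mulR_onSnd _ _ _) fun x => ?_)
    (fun x => mulL_onSnd _ _ _) x).symm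
  refine TensorProduct.ext' fun g ψ => ?_
  have h : lam W x * lam W 1 = lam W 1 * lam W x := by rw [lam_one_mul, lam_mul_one]
  simpa using congrArg (g ⊗ₜ[ℂ] ·) (LinearMap.congr_fun h ψ)

/-- The compatibility of the coaction with the action. -/
lemma coact_lam (x : W) :
    coact W ∘ₗ lam W x =
      (mulR W * onSnd (lam W) * convComp W (mulL W) (S W)) x ∘ₗ coact W := by
  change (onSnd (lam W) 1 ∘ₗ comulFst W) ∘ₗ lam W x = _ ∘ₗ (onSnd (lam W) 1 ∘ₗ comulFst W)
  rw [LinearMap.comp_assoc, comulFst_lam, ← LinearMap.comp_assoc, coact_lam_aux,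
    LinearMap.comp_assoc]

end RibbonSpace

/-! ### The coaction axioms and the exchange relations. -/

section YetterDrinfeld

variable {W : Type*} [Ring W] [Algebra ℂ W] [WeakHopfAlgebra W]

lemma linearMap_sum_comp {ι M N P : Type*} [AddCommGroup M] [Module ℂ M] [AddCommGroup N]
    [Module ℂ N] [AddCommGroup P] [Module ℂ P] (s : Finset ι) (f : ι → N →ₗ[ℂ] P) (g : M →ₗ[ℂ] N) :
    (∑ i ∈ s, f i) ∘ₗ g = ∑ i ∈ s, f i ∘ₗ g := by
  ext
  simp

lemma convMul_eq {M : Type*} [AddCommGroup M] [Module ℂ M]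
    (f g : WithConv (W →ₗ[ℂ] Module.End ℂ M)) (x : W) :
    (f * g) x = LinearMap.mul' ℂ _ (TensorProduct.map f.ofConv g.ofConv (Δ W x)) := rfl

lemma map_mul_tmul_one {M : Type*} [AddCommGroup M] [Module ℂ M]
    {f g : WithConv (W →ₗ[ℂ] Module.End ℂ M)} (hf : ∀ x y, f (x * y) = f y * f x) (x : W)
    (z : W ⊗[ℂ] W) : LinearMap.mul' ℂ _ (TensorProduct.map f.ofConv g.ofConv (z * (x ⊗ₜ 1))) =
      f x * LinearMap.mul' ℂ _ (TensorProduct.map f.ofConv g.ofConv z) := by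
  induction z using TensorProduct.induction_on with
  | zero => simp
  | add x y hx hy => simp only [map_add, hx, hy, add_mul, mul_add]
  | tmul a b =>
    have : f.ofConv (a * x) = f.ofConv x * f.ofConv a := hf a x
    simp [this, mul_assoc]

lemma map_mul_one_tmul {M : Type*} [AddCommGroup M] [Module ℂ M]
    {f g : WithConv (W →ₗ[ℂ] Module.End ℂ M)} (hg : ∀ x y, g (x * y) = g y * g x)
    (hc : ∀ x y, Commute (f x) (g y)) (x : W)
    (z : W ⊗[ℂ] W) : LinearMap.mul' ℂ _ (TensorProduct.map f.ofConv g.ofConv (z * (1 ⊗ₜ x))) =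
      g x * LinearMap.mul' ℂ _ (TensorProduct.map f.ofConv g.ofConv z) := by
  induction z using TensorProduct.induction_on with
  | zero => simp
  | add x y hx hy => simp only [map_add, hx, hy, add_mul, mul_add]
  | tmul a b =>
    have h1 : g.ofConv (b * x) = g.ofConv x * g.ofConv b := hg b x
    have h2 : f.ofConv a * g.ofConv x = g.ofConv x * f.ofConv a := hc a x
    simp only [Algebra.TensorProduct.tmul_mul_tmul, mul_one, TensorProduct.map_tmul,
      LinearMap.mul'_apply, h1]
    rw [← mul_assoc, h2, mul_assoc]

lemma onSnd_lam_mul (x y : W) :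
    onSnd (lam W) (x * y) = onSnd (lam W) y * onSnd (lam W) x := by
  refine TensorProduct.ext' fun g v => ?_
  simp [lam_mul]

/-- An element of `W_R` multiplying `k` from the left reaches only the last leg of `k`, hence acts
through left multiplication alone; in `lam_eL_mul`, elements of `W_L` reach only the first leg. -/
lemma lam_eR_mul (c k : W) : lam W (eR W c * k) = lam W k * actLeft W (eR W c) := by
  have e : ∀ z : W ⊗[ℂ] W, LinearMap.mul' ℂ _ (TensorProduct.map (actRight W * actDual W).ofConv
      (actLeft W).ofConv ((1 ⊗ₜ eR W c) * z)) = LinearMap.mul' ℂ _ (TensorProduct.map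
        (actRight W * actDual W).ofConv (actLeft W).ofConv z) * actLeft W (eR W c) := by
    intro z
    induction z using TensorProduct.induction_on with
    | zero => simp
    | add x y hx hy => simp only [map_add, hx, hy, add_mul, mul_add]
    | tmul a b =>
      have : (actLeft W).ofConv (eR W c * b) = (actLeft W).ofConv b * actLeft W (eR W c) :=
        actLeft_mul _ _
      simp [this, mul_assoc]
  rw [lam, convMul_eq, comul_eR_mul, e, convMul_eq]

lemma lam_eL_mul (c k : W) : lam W (eL W c * k) = lam W k * actRight W (eL W c) := by
  have hc : ∀ d, Commute ((actDual W * actLeft W) d) (actRight W (eL W c)) := fun d =>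
    commute_convMul (fun x => (actRight_actDual _ _).symm) (fun x => (actRight_actLeft _ _).symm) d
  have e : ∀ z : W ⊗[ℂ] W, LinearMap.mul' ℂ _ (TensorProduct.map (actRight W).ofConv
      (actDual W * actLeft W).ofConv ((eL W c ⊗ₜ 1) * z)) = LinearMap.mul' ℂ _ (TensorProduct.map
        (actRight W).ofConv (actDual W * actLeft W).ofConv z) * actRight W (eL W c) := by
    intro z
    induction z using TensorProduct.induction_on with
    | zero => simp
    | add x y hx hy => simp only [map_add, hx, hy, add_mul, mul_add]
    | tmul a b =>
      have h1 : (actRight W).ofConv (eL W c * a) = (actRight W).ofConv a * actRight W (eL W c) :=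
        actRight_mul _ _
      have h2 : (actDual W * actLeft W).ofConv b * actRight W (eL W c) =
        actRight W (eL W c) * (actDual W * actLeft W).ofConv b := hc b
      simp only [Algebra.TensorProduct.tmul_mul_tmul, one_mul, TensorProduct.map_tmul,
        LinearMap.mul'_apply, h1]
      rw [mul_assoc, mul_assoc, h2]
  rw [lam, mul_assoc, convMul_eq, comul_eL_mul, e, convMul_eq]

variable (W) in
/-- `h ↦ (k ↦ S(h) k ⊗ v)` -/
def mulLS : WithConv (W →ₗ[ℂ] Module.End ℂ (W ⊗[ℂ] RibbonSpace W)) := convComp W (mulL W) (S W)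

variable (W) in
/-- `h ↦ (k ↦ k S(h) ⊗ v)` -/
def mulRS : WithConv (W →ₗ[ℂ] Module.End ℂ (W ⊗[ℂ] RibbonSpace W)) := convComp W (mulR W) (S W)

/-- The first leg of `Δ(1)` lies in `W_R`, where `lam` is left multiplication by its antipode up to
`lam 1`. The whole operator thus multiplies `Δ(g)` by the flip of `(S ⊗ S)Δ(1)`, which is `Δ(1)` and
is absorbed. -/
lemma onSnd_lam_mul_mulLS_coact : (onSnd (lam W) * mulLS W) 1 ∘ₗ coact W = coact W := by
  have e : ∀ (ψ : Dual ℂ W) (w z : W ⊗[ℂ] W),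
      LinearMap.mul' ℂ _ (TensorProduct.map (onSnd (lam W)).ofConv (mulLS W).ofConv
        ((eR W).rTensor W w)) (onSnd (lam W) 1 (TensorProduct.assoc ℂ W W (Dual ℂ W) (z ⊗ₜ ψ))) =
      onSnd (lam W) 1 (TensorProduct.assoc ℂ W W (Dual ℂ W)
        ((TensorProduct.comm ℂ W W (TensorProduct.map (S W) (S W) ((eR W).rTensor W w)) * z)
          ⊗ₜ ψ)) := by
    intro ψ w z
    induction w using TensorProduct.induction_on with
    | zero => simp
    | add x y hx hy => simp only [map_add, hx, hy, add_mul, add_tmul, LinearMap.add_apply]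
    | tmul a b =>
      induction z using TensorProduct.induction_on with
      | zero => simp
      | add x y hx hy => simp only [map_add, hx, hy, mul_add, add_tmul]
      | tmul c d =>
        have h1 := LinearMap.congr_fun (lam_mul_one (eR W a)) (d ⊗ₜ ψ)
        have h2 := LinearMap.congr_fun (lam_eR_mul a 1) (d ⊗ₜ ψ)
        rw [mul_one] at h2
        simp only [LinearMap.rTensor_tmul, TensorProduct.map_tmul,
          LinearMap.mul'_apply, TensorProduct.comm_tmul, Algebra.TensorProduct.tmul_mul_tmul,
          TensorProduct.assoc_tmul]
        exact congrArg ((S W b * c) ⊗ₜ[ℂ] ·) (h1.trans h2)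
  refine TensorProduct.ext' fun g ψ => ?_
  have := e ψ (Δ W 1) (Δ W g)
  rw [rTensor_eR_one, map_antipode_one] at this
  refine this.trans ?_
  have e' : TensorProduct.comm ℂ W W (TensorProduct.comm ℂ W W (Δ W 1)) = Δ W 1 :=
    (TensorProduct.comm ℂ W W).symm_apply_apply _
  rw [e', comul_one_mul_comul]
  rfl

lemma mulR_mul_onSnd_lam_coact : (mulR W * onSnd (lam W)) 1 ∘ₗ coact W = coact W := by
  have e : ∀ (ψ : Dual ℂ W) (w z : W ⊗[ℂ] W),
      LinearMap.mul' ℂ _ (TensorProduct.map (mulR W).ofConv (onSnd (lam W)).ofConv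
        ((eL W).lTensor W w)) (onSnd (lam W) 1 (TensorProduct.assoc ℂ W W (Dual ℂ W) (z ⊗ₜ ψ))) =
      onSnd (lam W) 1 (TensorProduct.assoc ℂ W W (Dual ℂ W)
        ((z * (eL W).lTensor W w) ⊗ₜ ψ)) := by
    intro ψ w z
    induction w using TensorProduct.induction_on with
    | zero => simp
    | add x y hx hy => simp only [map_add, hx, hy, mul_add, add_tmul, LinearMap.add_apply]
    | tmul a b =>
      induction z using TensorProduct.induction_on with
      | zero => simp
      | add x y hx hy => simp only [map_add, hx, hy, add_mul, add_tmul]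
      | tmul c d =>
        have h1 := LinearMap.congr_fun (lam_mul_one (eL W b)) (d ⊗ₜ ψ)
        have h2 := LinearMap.congr_fun (lam_eL_mul b 1) (d ⊗ₜ ψ)
        rw [mul_one] at h2
        simp only [LinearMap.lTensor_tmul, TensorProduct.map_tmul,
          LinearMap.mul'_apply, Algebra.TensorProduct.tmul_mul_tmul,
          TensorProduct.assoc_tmul]
        exact congrArg ((c * a) ⊗ₜ[ℂ] ·) (h1.trans h2)
  refine TensorProduct.ext' fun g ψ => ?_
  have := e ψ (Δ W 1) (Δ W g)
  rw [lTensor_eL_one, comul_mul_comul_one] at this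
  exact this

/-- The twisted action of `1` on `W ⊗ (W ⊗ Ŵ)` splits into two factors, one for each side, because
the second leg of `Δ(1)` lies in `W_L` and comes out of the right-hand factor. Each of the two fixes
the image of the coaction. -/
lemma coact_lam_one : coact W ∘ₗ lam W 1 = coact W := by
  have e1 : ∀ c : W, (onSnd (lam W) * mulLS W) (eL W c) =
      onSnd (lam W) (eL W c) * (onSnd (lam W) * mulLS W) 1 := by
    intro c
    rw [convMul_eq, comul_eL_left, map_mul_tmul_one onSnd_lam_mul, ← convMul_eq]
  have e2 : ∀ w : W ⊗[ℂ] W, LinearMap.mul' ℂ _ (TensorProduct.map (mulR W).ofConv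
      (onSnd (lam W) * mulLS W).ofConv ((eL W).lTensor W w)) =
      LinearMap.mul' ℂ _ (TensorProduct.map (mulR W).ofConv
      (onSnd (lam W)).ofConv ((eL W).lTensor W w)) * (onSnd (lam W) * mulLS W) 1 := by
    intro w
    induction w using TensorProduct.induction_on with
    | zero => simp
    | add x y hx hy => simp only [map_add, hx, hy, add_mul]
    | tmul a b =>
      have : (onSnd (lam W) * mulLS W).ofConv (eL W b) = (onSnd (lam W)).ofConv (eL W b) *
        (onSnd (lam W) * mulLS W) 1 := e1 b
      simp [this, mul_assoc]
  have h := e2 (Δ W 1)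
  rw [lTensor_eL_one, ← convMul_eq, ← convMul_eq, ← mul_assoc] at h
  rw [coact_lam]
  change (mulR W * onSnd (lam W) * mulLS W) 1 ∘ₗ _ = _
  rw [h, Module.End.mul_eq_comp, LinearMap.comp_assoc, onSnd_lam_mul_mulLS_coact,
    mulR_mul_onSnd_lam_coact]

/-- The coaction is coassociative. -/
lemma coact_coassoc : (coact W).lTensor W ∘ₗ coact W =
    (TensorProduct.assoc ℂ W W (RibbonSpace W)).toLinearMap ∘ₗ (Δ W).rTensor (RibbonSpace W) ∘ₗ
      coact W := by
  -- The inner projection `lam 1` is swallowed by the second coaction; after that, coassociativity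
  -- of `Δ` is enough.
  have h1 : (coact W).lTensor W ∘ₗ coact W = (coact W).lTensor W ∘ₗ comulFst W := by
    conv_lhs => rw [coact, ← LinearMap.comp_assoc, ← LinearMap.lTensor_comp]
    rw [← coact, coact_lam_one]
  have h2 : (comulFst W).lTensor W ∘ₗ comulFst W =
      (TensorProduct.assoc ℂ W W (RibbonSpace W)).toLinearMap ∘ₗ (Δ W).rTensor (RibbonSpace W) ∘ₗ
      comulFst W := by
    refine TensorProduct.ext' fun g ψ => ?_
    have e1 : ∀ z : W ⊗[ℂ] W, (comulFst W).lTensor W (TensorProduct.assoc ℂ W W (Dual ℂ W)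
        (z ⊗ₜ ψ)) = (((TensorProduct.mk ℂ W (Dual ℂ W)).flip ψ).lTensor W).lTensor W
          ((Δ W).lTensor W z) := by
      intro z
      induction z using TensorProduct.induction_on with
      | zero => simp
      | add x y hx hy => simp only [map_add, hx, hy, add_tmul]
      | tmul a b =>
        simp only [TensorProduct.assoc_tmul, LinearMap.lTensor_tmul, comulFst, LinearMap.comp_apply,
          LinearMap.rTensor_tmul]
        generalize (comul (R := ℂ) b) = w
        induction w using TensorProduct.induction_on with
        | zero => simp
        | add x y hx hy => simp only [map_add, hx, hy, add_tmul, tmul_add]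
        | tmul c d => simp
    have e2 : ∀ z : W ⊗[ℂ] W, TensorProduct.assoc ℂ W W (RibbonSpace W)
        ((Δ W).rTensor (RibbonSpace W) (TensorProduct.assoc ℂ W W (Dual ℂ W) (z ⊗ₜ ψ))) =
          (((TensorProduct.mk ℂ W (Dual ℂ W)).flip ψ).lTensor W).lTensor W
          (TensorProduct.assoc ℂ W W W ((Δ W).rTensor W z)) := by
      intro z
      induction z using TensorProduct.induction_on with
      | zero => simp
      | add x y hx hy => simp only [map_add, hx, hy, add_tmul]
      | tmul a b =>
        simp only [TensorProduct.assoc_tmul, LinearMap.rTensor_tmul]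
        generalize (comul (R := ℂ) a) = w
        induction w using TensorProduct.induction_on with
        | zero => simp
        | add x y hx hy => simp only [map_add, hx, hy, add_tmul]
        | tmul c d => simp
    refine (e1 (Δ W g)).trans (Eq.trans ?_ (e2 (Δ W g)).symm)
    rw [assoc_rTensor_comul]
  rw [h1]
  have h3 : (coact W).lTensor W = ((lam W 1).lTensor W).lTensor W ∘ₗ (comulFst W).lTensor W := by
    rw [← LinearMap.lTensor_comp, coact]
  rw [h3, LinearMap.comp_assoc, h2, coact]
  simp only [← LinearMap.comp_assoc]
  congr 1
  refine TensorProduct.ext' fun g v => ?_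
  simp only [LinearMap.comp_apply, LinearMap.lTensor_tmul, LinearMap.rTensor_tmul]
  generalize (comul (R := ℂ) g) = w
  induction w using TensorProduct.induction_on with
  | zero => simp
  | add x y hx hy => simp only [map_add, hx, hy, add_tmul]
  | tmul c d => simp

/-- Apply `S` to `Σ x⁽¹⁾S(x⁽²⁾) = ε_L(x)`; as `S² = 1`, this only exchanges the roles of the two
legs. -/
lemma mul_antipode_rev (hS : ∀ x : W, S W (S W x) = x) (x : W) :
    LinearMap.mul' ℂ W (TensorProduct.map LinearMap.id (S W)
      (TensorProduct.comm ℂ W W (Δ W x))) = S W (eL W x) := by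
  rw [← epsL_eq, ← mul_antipode]
  generalize (comul (R := ℂ) x) = z
  induction z using TensorProduct.induction_on with
  | zero => simp
  | add x y hx hy => simp only [map_add, hx, hy]
  | tmul a b => simp [antipode_mul_rev, hS]

lemma mulRS_mul_mulR (hS : ∀ x : W, S W (S W x) = x) :
     mulRS W * mulR W = convComp W (mulR W) (S W ∘ₗ eL W) := by
  ext x : 2
  rw [convMul_eq]
  have e : ∀ z : W ⊗[ℂ] W, LinearMap.mul' ℂ _ (TensorProduct.map (mulRS W).ofConv
      (mulR W).ofConv z) = mulR W (LinearMap.mul' ℂ W (TensorProduct.map LinearMap.id (S W)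
        (TensorProduct.comm ℂ W W z))) := by
    intro z
    induction z using TensorProduct.induction_on with
    | zero => exact ((mulR W).ofConv.map_zero).symm
    | add x y hx hy =>
      simp only [map_add, hx, hy]
    | tmul a b =>
      refine TensorProduct.ext' fun g v => ?_
      simp only [TensorProduct.map_tmul, LinearMap.mul'_apply, TensorProduct.comm_tmul,
        LinearMap.id_apply, mulR_tmul, ← mul_assoc]
      rfl
  rw [e, mul_antipode_rev hS]
  rfl

/-- `Σ ε_L(y⁽¹⁾) ⊗ y⁽²⁾ = Σ S(1⁽¹⁾) ⊗ 1⁽²⁾y`, and a second `S` on the first leg undoes the one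
already there. -/
lemma convComp_mulR_mul_onSnd_lam (hS : ∀ x : W, S W (S W x) = x) (y : W) :
    (convComp W (mulR W) (S W ∘ₗ eL W) * onSnd (lam W)) y =
    onSnd (lam W) y * (mulR W * onSnd (lam W)) 1 := by
  have e1 : ∀ z : W ⊗[ℂ] W, TensorProduct.map (convComp W (mulR W) (S W ∘ₗ eL W)).ofConv
      (onSnd (lam W)).ofConv z = TensorProduct.map (mulRS W).ofConv (onSnd (lam W)).ofConv
        ((eL W).rTensor W z) := by
    intro z
    rw [← LinearMap.comp_apply, LinearMap.rTensor, ← TensorProduct.map_comp]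
    rfl
  have e2 : ∀ z : W ⊗[ℂ] W, TensorProduct.map (mulRS W).ofConv (onSnd (lam W)).ofConv
        ((S W).rTensor W z) = TensorProduct.map (mulR W).ofConv (onSnd (lam W)).ofConv z := by
    intro z
    have : (mulRS W).ofConv ∘ₗ S W = (mulR W).ofConv := by
      ext x : 1
      exact congrArg (mulR W) (hS x)
    rw [← LinearMap.comp_apply, LinearMap.rTensor, ← TensorProduct.map_comp, this]
    rfl
  rw [convMul_eq, e1, rTensor_eL',
    map_mul_one_tmul onSnd_lam_mul (fun x y => mulR_onSnd _ _ _), e2, convMul_eq]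

/-- In Sweedler notation this is `Σ S(x⁽²⁾)t⁽⁻¹⁾ ⊗ x⁽¹⁾·t⁽⁰⁾ = Σ (x⁽²⁾·t)⁽⁻¹⁾S(x⁽¹⁾) ⊗ (x⁽²⁾·t)⁽⁰⁾`.
Expanding the right side by `coact_lam` lets `S(x⁽¹⁾)` cancel against the leg beside it, by `S² =
1`; what is left over is a unit term, which the coaction absorbs. -/
lemma coact_exchange (hS : ∀ x : W, S W (S W x) = x) {x : W} {ι : Type*} (𝓡 : Repr ℂ x ι) :
    ∑ i ∈ 𝓡.index, (onSnd (lam W) (𝓡.left i) * mulL W (S W (𝓡.right i))) ∘ₗ coact W =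
    ∑ i ∈ 𝓡.index, mulR W (S W (𝓡.left i)) ∘ₗ coact W ∘ₗ lam W (𝓡.right i) := by
  have h1 : ∑ i ∈ 𝓡.index, (onSnd (lam W) (𝓡.left i) * mulL W (S W (𝓡.right i))) ∘ₗ coact W =
      (onSnd (lam W) * mulLS W) x ∘ₗ coact W := by
    rw [𝓡.convMul_apply, linearMap_sum_comp]; rfl
  have h2 : ∑ i ∈ 𝓡.index, mulR W (S W (𝓡.left i)) ∘ₗ coact W ∘ₗ lam W (𝓡.right i) =
      (mulRS W * (mulR W * onSnd (lam W) * mulLS W)) x ∘ₗ coact W := by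
    rw [𝓡.convMul_apply, linearMap_sum_comp]
    refine Finset.sum_congr rfl fun i _ => ?_
    rw [coact_lam]; rfl
  rw [h1, h2, mul_assoc (mulR W), ← mul_assoc (mulRS W), mulRS_mul_mulR hS, ← mul_assoc,
    𝓡.convMul_apply, 𝓡.convMul_apply, linearMap_sum_comp, linearMap_sum_comp]
  refine Finset.sum_congr rfl fun i _ => ?_
  have h5 : Commute ((mulR W * onSnd (lam W)) 1) (mulLS W (𝓡.right i)) :=
    commute_convMul (fun _ => mulR_mulL _ _) (fun _ => (mulL_onSnd _ _ _).symm) 1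
  rw [convComp_mulR_mul_onSnd_lam hS, mul_assoc, h5.eq, ← mul_assoc, Module.End.mul_eq_comp (onSnd (lam W) _ * _),
    LinearMap.comp_assoc, mulR_mul_onSnd_lam_coact]

/-- The companion law `Σ t⁽⁻¹⁾x⁽¹⁾ ⊗ x⁽²⁾·t⁽⁰⁾ = Σ x⁽²⁾(x⁽¹⁾·t)⁽⁻¹⁾ ⊗ (x⁽¹⁾·t)⁽⁰⁾`. Here the
cancellation takes place to the left of `t⁽⁻¹⁾`. Each of the two laws serves both a vertex and a
face braid relation. -/
lemma coact_exchange' (hS : ∀ x : W, S W (S W x) = x) {x : W} {ι : Type*} (𝓡 : Repr ℂ x ι) :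
    ∑ i ∈ 𝓡.index, (mulR W (𝓡.left i) * onSnd (lam W) (𝓡.right i)) ∘ₗ coact W =
    ∑ i ∈ 𝓡.index, mulL W (𝓡.right i) ∘ₗ coact W ∘ₗ lam W (𝓡.left i) := by
  let X := mulR W * onSnd (lam W)
  have h1 : ∑ i ∈ 𝓡.index, (mulR W (𝓡.left i) * onSnd (lam W) (𝓡.right i)) ∘ₗ coact W =
      X x ∘ₗ coact W := by
    rw [𝓡.convMul_apply, linearMap_sum_comp]
  have hX : ∀ y z, Commute (X y) (mulL W z) := fun y z =>
    commute_convMul (fun _ => mulR_mulL _ _) (fun _ => (mulL_onSnd _ _ _).symm) y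
  have h2 : ∑ i ∈ 𝓡.index, mulL W (𝓡.right i) * (X * mulLS W) (𝓡.left i) =
      (X * convComp W (mulL W) (S W ∘ₗ eL W)) x := by
    -- Coassociativity, written for the legs of legs: it brings the third leg (inside `S`) and the
    -- fourth one together so that they cancel through `mul_antipode_rev`.
    have key := congrArg (LinearMap.mul' ℂ _ ∘ₗ TensorProduct.map X.ofConv (LinearMap.mul' ℂ _ ∘ₗ
      TensorProduct.map (mulL W).ofConv (mulLS W).ofConv ∘ₗ
        (TensorProduct.comm ℂ W W).toLinearMap))
      (sum_tmul_tmul_eq 𝓡 (fun i => ℛ ℂ (𝓡.left i)) (fun i => ℛ ℂ (𝓡.right i)))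
    simp only [map_sum, LinearMap.comp_apply, TensorProduct.map_tmul, LinearEquiv.coe_coe,
      TensorProduct.comm_tmul, LinearMap.mul'_apply] at key
    refine Eq.trans (Finset.sum_congr rfl fun i _ => ?_) (key.trans ?_)
    · rw [(ℛ ℂ (𝓡.left i)).convMul_apply, Finset.mul_sum]
      refine Finset.sum_congr rfl fun j _ => ?_
      have := (hX ((ℛ ℂ (𝓡.left i)).left j) (𝓡.right i)).eq
      rw [← mul_assoc, ← this, mul_assoc]
    · rw [𝓡.convMul_apply]
      refine Finset.sum_congr rfl fun i _ => ?_
      have h := mul_antipode_rev hS (𝓡.right i)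
      rw [← (ℛ ℂ (𝓡.right i)).eq] at h
      simp only [map_sum, TensorProduct.comm_tmul, TensorProduct.map_tmul, LinearMap.mul'_apply,
        LinearMap.id_apply] at h
      rw [← Finset.mul_sum]
      have h' : convComp W (mulL W) (S W ∘ₗ eL W) (𝓡.right i) = (mulL W).ofConv (S W (eL W (𝓡.right i))) :=
        rfl
      rw [h', ← h, map_sum]
      congr 1
      refine Finset.sum_congr rfl fun j _ => ?_
      refine TensorProduct.ext' fun g v => ?_
      change _ = mulL W _ _
      rw [mulL_tmul, mul_assoc]
      rfl
  have h3 : ∀ y, (onSnd (lam W) * convComp W (mulL W) (S W ∘ₗ eL W)) y =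
      onSnd (lam W) y * (onSnd (lam W) * mulLS W) 1 := by
    intro y
    have e1 : ∀ z : W ⊗[ℂ] W, TensorProduct.map (onSnd (lam W)).ofConv
        (convComp W (mulL W) (S W ∘ₗ eL W)).ofConv z =
          TensorProduct.map (onSnd (lam W)).ofConv (mulLS W).ofConv ((eL W).lTensor W z) := by
      intro z
      rw [← LinearMap.comp_apply, LinearMap.lTensor, ← TensorProduct.map_comp]
      rfl
    rw [convMul_eq, e1, lTensor_eL, map_mul_tmul_one onSnd_lam_mul, convMul_eq]
  have h4 : ∑ i ∈ 𝓡.index, mulL W (𝓡.right i) ∘ₗ coact W ∘ₗ lam W (𝓡.left i) =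
      (X * convComp W (mulL W) (S W ∘ₗ eL W)) x ∘ₗ coact W := by
    rw [← h2, linearMap_sum_comp]
    refine Finset.sum_congr rfl fun i _ => ?_
    rw [coact_lam]; rfl
  rw [h1, h4]
  simp only [X]
  rw [mul_assoc, 𝓡.convMul_apply, 𝓡.convMul_apply, linearMap_sum_comp, linearMap_sum_comp]
  refine Finset.sum_congr rfl fun i _ => ?_
  rw [h3, ← mul_assoc, Module.End.mul_eq_comp (_ * _), LinearMap.comp_assoc,
    onSnd_lam_mul_mulLS_coact]

end YetterDrinfeld

/-! ### The idempotent `lam 1`, the counit and `D(W)^∨`. -/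

section DoubleDual

variable {W : Type*} [Ring W] [Algebra ℂ W] [WeakHopfAlgebra W]

lemma linearMap_comp_sum {ι M N P : Type*} [AddCommGroup M] [Module ℂ M] [AddCommGroup N]
    [Module ℂ N] [AddCommGroup P] [Module ℂ P] (s : Finset ι) (f : ι → M →ₗ[ℂ] N) (g : N →ₗ[ℂ] P) :
    g ∘ₗ (∑ i ∈ s, f i) = ∑ i ∈ s, g ∘ₗ f i := by
  ext
  simp

lemma eR_antipode (hS : ∀ x : W, S W (S W x) = x) (x : W) : eR W (S W x) = S W (eL W x) := by
  rw [← epsR_eq, ← antipode_mul, ← mul_antipode_rev hS, comul_antipode]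
  generalize (comul (R := ℂ) x) = z
  induction z using TensorProduct.induction_on with
  | zero => simp
  | add x y hx hy => simp only [map_add, hx, hy]
  | tmul a b => simp [hS]

/-- Elements of `W_R` are contractions of the first leg of `Δ(1)`, on which `ε_L` and `S` agree. -/
lemma eL_eR (y : W) : eL W (eR W y) = S W (eR W y) := by
  have e : ∀ z : W ⊗[ℂ] W, ∀ f : W →ₗ[ℂ] W,
      f (TensorProduct.rid ℂ W ((ε W).lTensor W ((1 ⊗ₜ y) * z))) =
        TensorProduct.rid ℂ W ((ε W).lTensor W ((1 ⊗ₜ y) * f.rTensor W z)) := by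
    intro z f
    induction z using TensorProduct.induction_on with
    | zero => simp
    | add x y hx hy => simp only [map_add, hx, hy, mul_add]
    | tmul a b => simp
  rw [eR_def, e, e, rTensor_antipode_one]

lemma eL_antipode_eL (hS : ∀ x : W, S W (S W x) = x) (x : W) :
    eL W (S W (eL W x)) = eL W x := by
  rw [← eR_antipode hS, eL_eR, eR_antipode hS, hS]

variable (W) in
/-- `g ⊗ ψ ↦ ε(g) ψ(1)` -/
def ribbonCounit : RibbonSpace W →ₗ[ℂ] ℂ :=
  LinearMap.mul' ℂ ℂ ∘ₗ TensorProduct.map (ε W) (Dual.eval ℂ W 1)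

@[simp] lemma ribbonCounit_tmul (g : W) (ψ : Dual ℂ W) :
    ribbonCounit W (g ⊗ₜ ψ) = ε W g * ψ 1 := rfl

/-- The factorization `Δ₂(1) = (Δ(1) ⊗ 1)(1 ⊗ Δ(1))` splits the idempotent into a part coupling
right multiplication to `Ŵ` and a part coupling left multiplication to `Ŵ`. -/
lemma lam_one : lam W 1 = (actDual W * actLeft W) 1 * (actRight W * actDual W) 1 := by
  have e1 : (lam W) 1 = LinearMap.mul' ℂ _ (TensorProduct.map
      (actRight W).ofConv (LinearMap.mul' ℂ _ ∘ₗ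
        TensorProduct.map (actDual W).ofConv (actLeft W).ofConv) (comul₂ W 1)) := by
    rw [lam, mul_assoc, LinearMap.convMul_apply, comul₂, LinearMap.comp_apply]
    generalize (comul (R := ℂ) (1 : W)) = z
    induction z using TensorProduct.induction_on with
    | zero => simp
    | add x y hx hy => simp only [map_add, hx, hy]
    | tmul a b => rfl
  have e2 : ∀ z w : W ⊗[ℂ] W, LinearMap.mul' ℂ _ (TensorProduct.map
      (actRight W).ofConv (LinearMap.mul' ℂ _ ∘ₗ
        TensorProduct.map (actDual W).ofConv (actLeft W).ofConv)
          (TensorProduct.assoc ℂ W W W (z ⊗ₜ[ℂ] (1 : W)) * ((1 : W) ⊗ₜ[ℂ] w))) =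
      LinearMap.mul' ℂ _ (TensorProduct.map (actDual W).ofConv (actLeft W).ofConv w) *
        LinearMap.mul' ℂ _ (TensorProduct.map (actRight W).ofConv (actDual W).ofConv z) := by
    intro z w
    induction z using TensorProduct.induction_on with
    | zero => simp
    | add x y hx hy => simp only [map_add, hx, hy, add_mul, mul_add, add_tmul]
    | tmul a b =>
      induction w using TensorProduct.induction_on with
      | zero => simp
      | add x y hx hy => simp only [map_add, hx, hy, add_mul, mul_add, tmul_add]
      | tmul c d =>
        have h1 : (actDual W).ofConv (b * c) = (actDual W).ofConv c * (actDual W).ofConv b :=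
          actDual_mul _ _
        have h2 : ∀ x, Commute ((actRight W).ofConv a) ((actDual W).ofConv x) := fun x =>
          actRight_actDual _ _
        have h3 : Commute ((actRight W).ofConv a) ((actLeft W).ofConv d) := actRight_actLeft _ _
        have h4 : Commute ((actLeft W).ofConv d) ((actDual W).ofConv b) := actLeft_actDual _ _
        simp only [TensorProduct.assoc_tmul, Algebra.TensorProduct.tmul_mul_tmul, mul_one, one_mul,
          TensorProduct.map_tmul, LinearMap.mul'_apply, LinearMap.comp_apply, h1]
        generalize (actRight W).ofConv a = A at *
        generalize (actDual W).ofConv b = B at *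
        generalize (actLeft W).ofConv d = D at *
        have h5 := h2 c
        generalize (actDual W).ofConv c = C at *
        calc A * (C * B * D) = (A * C) * (B * D) := by simp only [mul_assoc]
          _ = C * A * (D * B) := by rw [h5.eq, h4.eq]
          _ = C * (A * D) * B := by simp only [mul_assoc]
          _ = _ := by rw [h3.eq]; simp only [mul_assoc]
  rw [e1, comul_one_left, e2]
  rfl

lemma actRight_actDual_eL (x : W) : (convComp W (actRight W) (eL W) * actDual W) x =
    actDual W x * (convComp W (actRight W) (eL W) * actDual W) 1 := by
  have e1 : ∀ z : W ⊗[ℂ] W, TensorProduct.map (convComp W (actRight W) (eL W)).ofConv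
      (actDual W).ofConv z =
        TensorProduct.map (actRight W).ofConv (actDual W).ofConv ((eL W).rTensor W z) := by
    intro z
    rw [← LinearMap.comp_apply, LinearMap.rTensor, ← TensorProduct.map_comp]
    rfl
  rw [convMul_eq, e1, rTensor_eL, map_mul_one_tmul actDual_mul (fun x y => actRight_actDual _ _),
    ← e1, ← convMul_eq]

lemma actDual_actLeft_eL (x : W) : (actDual W * convComp W (actLeft W) (eL W)) x =
    actDual W x * (actDual W * actLeft W) 1 := by
  have e1 : ∀ z : W ⊗[ℂ] W, TensorProduct.map (actDual W).ofConv
      (convComp W (actLeft W) (eL W)).ofConv z =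
        TensorProduct.map (actDual W).ofConv (actLeft W).ofConv ((eL W).lTensor W z) := by
    intro z
    rw [← LinearMap.comp_apply, LinearMap.lTensor, ← TensorProduct.map_comp]
    rfl
  rw [convMul_eq, e1, lTensor_eL, map_mul_tmul_one actDual_mul, ← convMul_eq]

lemma ribbonCounit_actRight (x : W) :
    ribbonCounit W ∘ₗ actRight W (eL W x) = ribbonCounit W ∘ₗ actRight W x := by
  refine TensorProduct.ext' fun g ψ => ?_
  simp [counit_mul_eL]

lemma ribbonCounit_actLeft (hS : ∀ x : W, S W (S W x) = x) (x : W) :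
    ribbonCounit W ∘ₗ actLeft W (eL W x) = ribbonCounit W ∘ₗ actLeft W x := by
  refine TensorProduct.ext' fun g ψ => ?_
  simp [← eR_antipode hS, counit_eR_mul]

lemma commute_convComp {M : Type*} [AddCommGroup M] [Module ℂ M]
    {f : WithConv (W →ₗ[ℂ] Module.End ℂ M)} {u : W →ₗ[ℂ] W} {a : Module.End ℂ M}
    (hf : ∀ x, Commute (f x) a) (x : W) : Commute (convComp W f u x) a := hf (u x)

-- Under `ε`, the outer legs of `k` may be projected to `W_L`. Then `Σ ε_L(k⁽¹⁾) ⊗ k⁽²⁾` and `Σ k⁽¹⁾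
-- ⊗ ε_L(k⁽²⁾)` have their `k` in the middle leg alone, next to copies of `Δ(1)`, and these copies
-- reassemble into `lam 1`.
set_option maxHeartbeats 1000000 in
lemma ribbonCounit_lam (hS : ∀ x : W, S W (S W x) = x) (k : W) :
    ribbonCounit W ∘ₗ lam W k = ribbonCounit W ∘ₗ (actDual W k * lam W 1) := by
  have h1 : ∀ x, ribbonCounit W ∘ₗ (convComp W (actRight W) (eL W) * actDual W) x =
      ribbonCounit W ∘ₗ (actRight W * actDual W) x := by
    intro x
    rw [(ℛ ℂ x).convMul_apply, (ℛ ℂ x).convMul_apply, linearMap_comp_sum, linearMap_comp_sum]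
    refine Finset.sum_congr rfl fun i _ => ?_
    rw [Module.End.mul_eq_comp, Module.End.mul_eq_comp, ← LinearMap.comp_assoc,
      ← LinearMap.comp_assoc, convComp_apply, ribbonCounit_actRight]
  have hd : ∀ x y, Commute ((actRight W * actDual W) x) (actLeft W y) := fun x y =>
    commute_convMul (fun _ => actRight_actLeft _ _) (fun _ => (actLeft_actDual _ _).symm) x
  have hd' : ∀ x y, Commute ((convComp W (actRight W) (eL W) * actDual W) x) (actLeft W y) :=
    fun x y => commute_convMul (commute_convComp fun _ => actRight_actLeft _ _)
      (fun _ => (actLeft_actDual _ _).symm) x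
  have h2 : ribbonCounit W ∘ₗ lam W k = ribbonCounit W ∘ₗ
      (convComp W (actRight W) (eL W) * actDual W * convComp W (actLeft W) (eL W)) k := by
    rw [lam, (ℛ ℂ k).convMul_apply, (ℛ ℂ k).convMul_apply, linearMap_comp_sum, linearMap_comp_sum]
    refine Finset.sum_congr rfl fun i _ => ?_
    rw [(hd _ _).eq, Module.End.mul_eq_comp, ← LinearMap.comp_assoc, ← ribbonCounit_actLeft hS,
      LinearMap.comp_assoc, ← Module.End.mul_eq_comp, ← (hd _ _).eq, Module.End.mul_eq_comp,
      ← LinearMap.comp_assoc, ← h1, LinearMap.comp_assoc]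
    rfl
  have h3 : (convComp W (actRight W) (eL W) * actDual W * convComp W (actLeft W) (eL W)) k =
      actDual W k * (actDual W * actLeft W) 1 *
        (convComp W (actRight W) (eL W) * actDual W) 1 := by
    rw [← actDual_actLeft_eL, (ℛ ℂ k).convMul_apply, (ℛ ℂ k).convMul_apply, Finset.sum_mul]
    refine Finset.sum_congr rfl fun i _ => ?_
    rw [actRight_actDual_eL, convComp_apply, mul_assoc, (hd' _ _).eq, ← mul_assoc]
  have h4 : ∀ x, Commute ((actDual W * actLeft W) 1) (actRight W x) := fun x =>
    commute_convMul (fun _ => (actRight_actDual _ _).symm) (fun _ => (actRight_actLeft _ _).symm) 1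
  rw [h2, h3, lam_one, ← mul_assoc, (ℛ ℂ (1 : W)).convMul_apply (actRight W),
    (ℛ ℂ (1 : W)).convMul_apply (convComp W (actRight W) (eL W)), Finset.mul_sum, Finset.mul_sum,
    linearMap_comp_sum, linearMap_comp_sum]
  refine Finset.sum_congr rfl fun i _ => ?_
  have h5 : ∀ x, Commute (actDual W k * (actDual W * actLeft W) 1) (actRight W x) := fun x =>
    Commute.mul_left (actRight_actDual x k).symm (h4 x)
  rw [convComp_apply, ← mul_assoc, ← mul_assoc, (h5 _).eq, (h5 _).eq]
  simp only [Module.End.mul_eq_comp, ← LinearMap.comp_assoc, ribbonCounit_actRight]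

/-! ### The counit for the coproduct on `W ⊗ Ŵ` -/

variable (W) in
/-- `h ⊗ (g ⊗ ψ) ↦ ε(g) h ⊗ ψ` -/
def counitSnd : W ⊗[ℂ] RibbonSpace W →ₗ[ℂ] RibbonSpace W :=
  ((TensorProduct.lid ℂ (Dual ℂ W)).toLinearMap ∘ₗ (ε W).rTensor (Dual ℂ W)).lTensor W

lemma counitSnd_comulFst : counitSnd W ∘ₗ comulFst W = LinearMap.id := by
  refine TensorProduct.ext' fun g ψ => ?_
  have e : ∀ z : W ⊗[ℂ] W, counitSnd W (TensorProduct.assoc ℂ W W (Dual ℂ W) (z ⊗ₜ ψ)) =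
      TensorProduct.rid ℂ W ((ε W).lTensor W z) ⊗ₜ ψ := by
    intro z
    induction z using TensorProduct.induction_on with
    | zero => simp
    | add x y hx hy => simp only [map_add, hx, hy, add_tmul]
    | tmul a b => simp [counitSnd, smul_tmul]
  refine (e (Δ W g)).trans ?_
  rw [lTensor_counit_comul]
  simp

lemma comulFst_actRight_eR (x : W) :
    (actRight W (eR W x)).lTensor W ∘ₗ comulFst W = comulFst W ∘ₗ actRight W (eR W x) := by
  refine TensorProduct.ext' fun g ψ => ?_
  simp only [LinearMap.comp_apply, actRight_tmul, comulFst, LinearMap.rTensor_tmul, comul_mul_eR]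
  generalize (comul (R := ℂ) g) = z
  induction z using TensorProduct.induction_on with
  | zero => simp
  | add x y hx hy => simp only [map_add, hx, hy, add_mul, add_tmul]
  | tmul a b => simp

lemma comulFst_actLeft_eL (hS : ∀ x : W, S W (S W x) = x) (x : W) :
    (actLeft W (eL W x)).lTensor W ∘ₗ comulFst W = comulFst W ∘ₗ actLeft W (eL W x) := by
  refine TensorProduct.ext' fun g ψ => ?_
  simp only [LinearMap.comp_apply, actLeft_tmul, comulFst, LinearMap.rTensor_tmul,
    ← eR_antipode hS, comul_eR_mul]
  generalize (comul (R := ℂ) g) = z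
  induction z using TensorProduct.induction_on with
  | zero => simp
  | add x y hx hy => simp only [map_add, hx, hy, mul_add, add_tmul]
  | tmul a b => simp [← eR_antipode hS]

lemma map_actRight_actDual_one :
    (actRight W * actDual W) 1 = (convComp W (actRight W) (eR W) * actDual W) 1 := by
  have e : ∀ z : W ⊗[ℂ] W, TensorProduct.map (convComp W (actRight W) (eR W)).ofConv
      (actDual W).ofConv z =
        TensorProduct.map (actRight W).ofConv (actDual W).ofConv ((eR W).rTensor W z) := by
    intro z
    rw [← LinearMap.comp_apply, LinearMap.rTensor, ← TensorProduct.map_comp]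
    rfl
  rw [convMul_eq, convMul_eq, e, rTensor_eR_one]

lemma map_actDual_actLeft_one :
    (actDual W * actLeft W) 1 = (actDual W * convComp W (actLeft W) (eL W)) 1 := by
  rw [actDual_actLeft_eL]
  have : actDual W 1 = 1 := by
    refine TensorProduct.ext' fun g ψ => ?_
    simp
  rw [this, one_mul]

/-- The elements through which `lam 1` multiplies the first factor can be taken in `W_R` (`S` maps
`W_L` there). By the leg rule for `W_R`, such multiplications affect only the second leg of `Δ(g)`.
-/
lemma comulFst_lam_one (hS : ∀ x : W, S W (S W x) = x) : comulFst W ∘ₗ lam W 1 = coact W := by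
  have hA := comp_convMul (D := comulFst W) (f := convComp W (actRight W) (eR W))
    (F := onSnd (convComp W (actRight W) (eR W))) (fun x => (comulFst_actRight_eR x).symm)
    comulFst_actDual 1
  have hB := comp_convMul (D := comulFst W) comulFst_actDual (g := convComp W (actLeft W) (eL W))
    (G := onSnd (convComp W (actLeft W) (eL W))) (fun x => (comulFst_actLeft_eL hS x).symm) 1
  rw [← onSnd_mul, ← map_actRight_actDual_one] at hA
  rw [← onSnd_mul, ← map_actDual_actLeft_one] at hB
  rw [coact, lam_one, Module.End.mul_eq_comp, ← LinearMap.comp_assoc, hB, LinearMap.comp_assoc, hA,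
    LinearMap.lTensor_comp, LinearMap.comp_assoc, map_actRight_actDual_one,
    map_actDual_actLeft_one]
  rfl

lemma counitSnd_coact (hS : ∀ x : W, S W (S W x) = x) : counitSnd W ∘ₗ coact W = lam W 1 := by
  rw [← comulFst_lam_one hS, ← LinearMap.comp_assoc, counitSnd_comulFst, LinearMap.id_comp]

section FiniteDimensional

variable [FiniteDimensional ℂ W]

lemma ribbonComul_apply (hS : ∀ x : W, S W (S W x) = x) (v : RibbonSpace W) : ribbonComul W v =
    ∑ i, TensorProduct.map ((TensorProduct.mk ℂ W (Dual ℂ W)).flip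
      ((Module.finBasis ℂ W).coord i)) (lam W (Module.finBasis ℂ W i)) (comulFst W v) := by
  simp only [ribbonComul, twist_comul₂ hS, LinearMap.sum_apply]
  rfl

/-- The right counit law for the coproduct on `W ⊗ Ŵ`, up to the projection `lam 1`. -/
lemma rid_lTensor_ribbonCounit (hS : ∀ x : W, S W (S W x) = x) (v : RibbonSpace W) :
    TensorProduct.rid ℂ _ ((ribbonCounit W).lTensor _ (ribbonComul W v)) = lam W 1 v := by
  have e : ∀ z : W ⊗[ℂ] RibbonSpace W, TensorProduct.rid ℂ _ ((ribbonCounit W).lTensor _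
      (∑ i, TensorProduct.map ((TensorProduct.mk ℂ W (Dual ℂ W)).flip
      ((Module.finBasis ℂ W).coord i)) (lam W (Module.finBasis ℂ W i)) z)) =
      counitSnd W ((lam W 1).lTensor W z) := by
    intro z
    induction z using TensorProduct.induction_on with
    | zero => simp
    | add x y hx hy => simp only [map_add, Finset.sum_add_distrib, hx, hy]
    | tmul h v =>
      have h1 : ∀ k, ribbonCounit W (lam W k v) = ribbonCounit W (actDual W k (lam W 1 v)) :=
        fun k => LinearMap.congr_fun (ribbonCounit_lam hS k) v
      simp only [TensorProduct.map_tmul, map_sum, LinearMap.lTensor_tmul, h1,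
        TensorProduct.rid_tmul, LinearMap.flip_apply, TensorProduct.mk_apply]
      generalize lam W 1 v = u
      induction u using TensorProduct.induction_on with
      | zero => simp
      | add x y hx hy => simp only [map_add, add_smul, Finset.sum_add_distrib, hx, hy, tmul_add]
      | tmul g ψ =>
        have h2 : ∑ i, ψ (Module.finBasis ℂ W i) • (Module.finBasis ℂ W).coord i = ψ := by
          refine (Module.finBasis ℂ W).ext fun j => ?_
          simp
        simp only [actDual_tmul, ribbonCounit_tmul, LinearMap.comp_apply, LinearMap.mulLeft_apply,
          mul_one, counitSnd, LinearMap.lTensor_tmul, LinearMap.rTensor_tmul, LinearEquiv.coe_coe,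
          TensorProduct.lid_tmul, mul_smul, ← Finset.smul_sum, ← tmul_smul, ← tmul_sum, h2]
  rw [ribbonComul_apply hS, e, ← LinearMap.congr_fun (counitSnd_coact hS) v]
  rfl

end FiniteDimensional

lemma counit_mul_antipode_eL (hS : ∀ x : W, S W (S W x) = x) (z x : W) :
    ε W (z * S W (eL W x)) = ε W (z * eL W x) := by
  rw [← counit_mul_eL, eL_antipode_eL hS]

/-- `S(x)` lies in `W_R`, so `g S(x) = Σ g⁽¹⁾ ε(g⁽²⁾S(x))`; and `ε` does not distinguish `S(x)` from
`x` when `x ∈ W_L`. -/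
lemma dualMul_harpoonLeft (hS : ∀ x : W, S W (S W x) = x) (φ : Dual ℂ W) (x : W) :
    dualMul φ (harpoonLeft (eL W x) (ε W)) = φ ∘ₗ LinearMap.mulRight ℂ (S W (eL W x)) := by
  ext g
  have h : g * S W (eL W x) = TensorProduct.rid ℂ W ((ε W ∘ₗ LinearMap.mulRight ℂ (eL W x)).lTensor W
      (Δ W g)) := by
    have h1 := lTensor_counit_comul (R := ℂ) (g * S W (eL W x))
    have h2 := congrArg (TensorProduct.rid ℂ W) h1
    rw [TensorProduct.rid_tmul, one_smul, ← eR_antipode hS, comul_mul_eR] at h2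
    rw [← eR_antipode hS, ← h2]
    generalize (comul (R := ℂ) g) = z
    induction z using TensorProduct.induction_on with
    | zero => simp
    | add x y hx hy => simp only [map_add, hx, hy, add_mul]
    | tmul a b => simp [eR_antipode hS, counit_mul_antipode_eL hS]
  rw [LinearMap.comp_apply, LinearMap.mulRight_apply, h]
  simp only [dualMul, harpoonLeft, LinearMap.comp_apply]
  generalize (comul (R := ℂ) g) = z
  induction z using TensorProduct.induction_on with
  | zero => simp
  | add x y hx hy => simp only [map_add, hx, hy]
  | tmul a b => simp [mul_comm]

lemma dualMul_harpoonRight (φ : Dual ℂ W) (y : W) :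
    dualMul φ (harpoonRight (ε W) (eR W y)) = φ ∘ₗ LinearMap.mulLeft ℂ (eR W y) := by
  ext g
  have h : eR W y * g = TensorProduct.rid ℂ W ((ε W ∘ₗ LinearMap.mulLeft ℂ (eR W y)).lTensor W
      (Δ W g)) := by
    have h1 := lTensor_counit_comul (R := ℂ) (eR W y * g)
    have h2 := congrArg (TensorProduct.rid ℂ W) h1
    rw [TensorProduct.rid_tmul, one_smul, comul_eR_mul] at h2
    rw [← h2]
    generalize (comul (R := ℂ) g) = z
    induction z using TensorProduct.induction_on with
    | zero => simp
    | add x y hx hy => simp only [map_add, hx, hy, mul_add]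
    | tmul a b => simp
  rw [LinearMap.comp_apply, LinearMap.mulLeft_apply, h]
  simp only [dualMul, harpoonRight, LinearMap.comp_apply]
  generalize (comul (R := ℂ) g) = z
  induction z using TensorProduct.induction_on with
  | zero => simp
  | add x y hx hy => simp only [map_add, hx, hy]
  | tmul a b => simp [mul_comm]

lemma doublePairing_tmul (g : W) (ψ φ : Dual ℂ W) (h : W) :
    doublePairing W (g ⊗ₜ ψ) (φ ⊗ₜ h) = φ g * ψ h := by
  simp [doublePairing]

lemma doublePairing_injective [FiniteDimensional ℂ W] : Function.Injective (doublePairing W) := by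
  have h1 : Function.Injective (TensorProduct.dualDistrib ℂ (Dual ℂ W) W) :=
    (TensorProduct.dualDistribEquiv ℂ (Dual ℂ W) W).injective
  have h2 : Function.Injective ((Dual.eval ℂ W).rTensor (Dual ℂ W)) :=
    (LinearEquiv.rTensor (Dual ℂ W) (Module.evalEquiv ℂ W)).injective
  exact h1.comp h2

/-- Pairing with the generators of the ideal converts the two defining relations of `D(W)^∨` into
statements about `W ⊗ Ŵ`: multiplication in the argument of `ψ` by an element of `W_L` or `W_R` can
be moved to the factor `W`. -/
lemma actDual_eL_of_mem [FiniteDimensional ℂ W] (hS : ∀ x : W, S W (S W x) = x)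
    {t : RibbonSpace W} (ht : t ∈ doubleDual W) (x : W) :
    actDual W (eL W x) t = actRight W (S W (eL W x)) t := by
  apply doublePairing_injective
  refine TensorProduct.ext' fun φ h => ?_
  have hz : φ ⊗ₜ[ℂ] (eL W x * h) - dualMul φ (harpoonLeft (eL W x) (ε W)) ⊗ₜ[ℂ] h ∈
      doubleIdeal W := Submodule.subset_span (Or.inl ⟨φ, h, eL W x, ⟨x, rfl⟩, rfl⟩)
  have h0 := (Submodule.mem_dualAnnihilator _).1 ht _ hz
  rw [map_sub, sub_eq_zero, dualMul_harpoonLeft hS] at h0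
  have e1 : ∀ v : RibbonSpace W, doublePairing W (actDual W (eL W x) v) (φ ⊗ₜ h) =
      doublePairing W v (φ ⊗ₜ (eL W x * h)) := by
    intro v
    induction v using TensorProduct.induction_on with
    | zero => simp
    | add x y hx hy => simp only [map_add, LinearMap.add_apply, hx, hy]
    | tmul a b => simp [doublePairing_tmul]
  have e2 : ∀ v : RibbonSpace W, doublePairing W (actRight W (S W (eL W x)) v) (φ ⊗ₜ h) =
      doublePairing W v ((φ ∘ₗ LinearMap.mulRight ℂ (S W (eL W x))) ⊗ₜ h) := by
    intro v
    induction v using TensorProduct.induction_on with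
    | zero => simp
    | add x y hx hy => simp only [map_add, LinearMap.add_apply, hx, hy]
    | tmul a b => simp [doublePairing_tmul]
  rw [e1, e2, h0]

lemma actDual_eR_of_mem [FiniteDimensional ℂ W] (hS : ∀ x : W, S W (S W x) = x)
    {t : RibbonSpace W} (ht : t ∈ doubleDual W) (y : W) :
    actDual W (eR W y) t = actLeft W (S W (eR W y)) t := by
  apply doublePairing_injective
  refine TensorProduct.ext' fun φ h => ?_
  have hz : φ ⊗ₜ[ℂ] (eR W y * h) - dualMul φ (harpoonRight (ε W) (eR W y)) ⊗ₜ[ℂ] h ∈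
      doubleIdeal W := Submodule.subset_span (Or.inr ⟨φ, h, eR W y, ⟨y, rfl⟩, rfl⟩)
  have h0 := (Submodule.mem_dualAnnihilator _).1 ht _ hz
  rw [map_sub, sub_eq_zero, dualMul_harpoonRight] at h0
  have e1 : ∀ v : RibbonSpace W, doublePairing W (actDual W (eR W y) v) (φ ⊗ₜ h) =
      doublePairing W v (φ ⊗ₜ (eR W y * h)) := by
    intro v
    induction v using TensorProduct.induction_on with
    | zero => simp
    | add x y hx hy => simp only [map_add, LinearMap.add_apply, hx, hy]
    | tmul a b => simp [doublePairing_tmul]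
  have e2 : ∀ v : RibbonSpace W, doublePairing W (actLeft W (S W (eR W y)) v) (φ ⊗ₜ h) =
      doublePairing W v ((φ ∘ₗ LinearMap.mulLeft ℂ (eR W y)) ⊗ₜ h) := by
    intro v
    induction v using TensorProduct.induction_on with
    | zero => simp
    | add x y hx hy => simp only [map_add, LinearMap.add_apply, hx, hy]
    | tmul a b => simp [doublePairing_tmul, hS]
  rw [e1, e2, h0]

/-- The projection `lam 1` fixes the dual of the quantum double. -/
theorem lam_one_of_mem [FiniteDimensional ℂ W] (hS : ∀ x : W, S W (S W x) = x)
    {t : RibbonSpace W} (ht : t ∈ doubleDual W) : lam W 1 t = t := by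
  have h2 : LinearMap.mul' ℂ W ((S W).rTensor W (Δ W 1)) = 1 :=
    (antipode_mul (1 : W)).trans (by rw [epsR_eq, eR_one])
  -- Moving the second leg of `Δ(1)` over to `W` leaves right multiplication by `Σ S(1⁽²⁾)1⁽¹⁾`,
  -- which is `S` of `Σ S(1⁽¹⁾)1⁽²⁾ = 1`. The second factor of `lam 1` is treated in the same way
  -- with `W_R`.
  have hA : (actRight W * actDual W) 1 t = t := by
    have e : ∀ z : W ⊗[ℂ] W, LinearMap.mul' ℂ _ (TensorProduct.map (actRight W).ofConv
        (actDual W).ofConv ((eL W).lTensor W z)) t = actRight W (S W (LinearMap.mul' ℂ W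
          ((S W).rTensor W ((eL W).lTensor W z)))) t := by
      intro z
      induction z using TensorProduct.induction_on with
      | zero => simp only [map_zero]
      | add x y hx hy =>
        simp only [map_add, LinearMap.add_apply, hx, hy]
      | tmul a b =>
        have h := actDual_eL_of_mem hS ht b
        simp only [LinearMap.lTensor_tmul, LinearMap.rTensor_tmul, TensorProduct.map_tmul,
          LinearMap.mul'_apply, Module.End.mul_apply, antipode_mul_rev, hS]
        rw [h, actRight_mul]
        rfl
    have h1 := e (Δ W 1)
    rw [lTensor_eL_one, h2, antipode_one, ← convMul_eq] at h1
    rw [h1]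
    have : actRight W 1 = 1 := by
      refine TensorProduct.ext' fun g ψ => ?_
      simp
    rw [this]; rfl
  have hB : (actDual W * actLeft W) 1 t = t := by
    have e : ∀ z : W ⊗[ℂ] W, LinearMap.mul' ℂ _ (TensorProduct.map (actDual W).ofConv
        (actLeft W).ofConv ((eR W).rTensor W z)) t = actLeft W (LinearMap.mul' ℂ W
          ((S W).rTensor W ((eR W).rTensor W z))) t := by
      intro z
      induction z using TensorProduct.induction_on with
      | zero => simp only [map_zero]
      | add x y hx hy => simp only [map_add, LinearMap.add_apply, hx, hy]
      | tmul a b =>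
        have h := actDual_eR_of_mem hS ht a
        have hc : Commute ((actLeft W).ofConv b) ((actDual W).ofConv (eR W a)) :=
          actLeft_actDual _ _
        simp only [LinearMap.rTensor_tmul, TensorProduct.map_tmul, LinearMap.mul'_apply]
        rw [← hc.eq, Module.End.mul_apply, h, actLeft_mul]
        rfl
    have h1 := e (Δ W 1)
    rw [rTensor_eR_one, h2, ← convMul_eq] at h1
    rw [h1]
    have : actLeft W 1 = 1 := by
      refine TensorProduct.ext' fun g ψ => ?_
      simp [antipode_one]
    rw [this]; rfl
  rw [lam_one, Module.End.mul_apply, hA, hB]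

end DoubleDual

/-! ### Operators on a single edge. -/

section EdgeOperators

variable {W : Type*} [Ring W] [Algebra ℂ W] [WeakHopfAlgebra W]

variable (W) in
/-- The vertex action at an end of an edge (`true` for the terminal end). -/
def vOp (b : Bool) : W →ₗ[ℂ] Module.End ℂ W := bif b then Lplus W else Lminus W

variable (W) in
/-- The face action on a side of an edge. -/
def fOp (b : Bool) : Dual ℂ W →ₗ[ℂ] Module.End ℂ W := bif b then Tplus W else Tminus W

variable (W) in
/-- The action of a dual triangle with the dual edge on the left. -/
def vOp' (b : Bool) : W →ₗ[ℂ] Module.End ℂ W := bif b then tLplus W else tLminus W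

variable (W) in
/-- The action of a direct triangle with the edge on the left. -/
def fOp' (b : Bool) : Dual ℂ W →ₗ[ℂ] Module.End ℂ W := bif b then tTplus W else tTminus W

variable (W) in
/-- Conjugation by the antipode. -/
def conjS : Module.End ℂ W →ₗ[ℂ] Module.End ℂ W :=
  LinearMap.mulLeft ℂ (S W : Module.End ℂ W) ∘ₗ LinearMap.mulRight ℂ (S W : Module.End ℂ W)

lemma conjS_apply (f : Module.End ℂ W) (x : W) : conjS W f x = S W (f (S W x)) := rfl

lemma conjS_mul (hS : ∀ x : W, S W (S W x) = x) (f g : Module.End ℂ W) :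
    conjS W (f * g) = conjS W f * conjS W g := by
  ext x
  simp [conjS_apply, hS]

lemma conjS_conjS (hS : ∀ x : W, S W (S W x) = x) (f : Module.End ℂ W) :
    conjS W (conjS W f) = f := by
  ext x
  simp [conjS_apply, hS]

lemma Lplus_apply (h x : W) : Lplus W h x = h * x := rfl
lemma tLminus_apply (h x : W) : tLminus W h x = x * h := rfl
lemma Lminus_apply (hS : ∀ x : W, S W (S W x) = x) (h x : W) : Lminus W h x = x * S W h := by
  rw [← antipodeInv_eq hS]; rfl
lemma tLplus_apply (hS : ∀ x : W, S W (S W x) = x) (h x : W) : tLplus W h x = S W h * x := by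
  rw [← antipodeInv_eq hS]; rfl
lemma Tplus_apply (φ : Dual ℂ W) (x : W) :
    Tplus W φ x = TensorProduct.rid ℂ W (φ.lTensor W (Δ W x)) := rfl
lemma tTminus_apply (φ : Dual ℂ W) (x : W) :
    tTminus W φ x = TensorProduct.lid ℂ W (φ.rTensor W (Δ W x)) := rfl
lemma Tminus_apply (φ : Dual ℂ W) (x : W) :
    Tminus W φ x = TensorProduct.lid ℂ W ((φ ∘ₗ S W).rTensor W (Δ W x)) := rfl
lemma tTplus_apply (φ : Dual ℂ W) (x : W) :
    tTplus W φ x = TensorProduct.rid ℂ W ((φ ∘ₗ S W).lTensor W (Δ W x)) := rfl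

lemma conjS_Lplus (hS : ∀ x : W, S W (S W x) = x) (h : W) :
    conjS W (Lplus W h) = Lminus W h := by
  ext x
  simp [conjS_apply, Lplus_apply, Lminus_apply hS, antipode_mul_rev, hS]

lemma conjS_tLplus (hS : ∀ x : W, S W (S W x) = x) (h : W) :
    conjS W (tLplus W h) = tLminus W h := by
  ext x
  simp [conjS_apply, tLplus_apply hS, tLminus_apply, antipode_mul_rev, hS]

lemma conjS_Tplus (hS : ∀ x : W, S W (S W x) = x) (φ : Dual ℂ W) :
    conjS W (Tplus W φ) = Tminus W φ := by
  ext x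
  rw [conjS_apply, Tplus_apply, Tminus_apply, comul_antipode]
  generalize (comul (R := ℂ) x) = z
  induction z using TensorProduct.induction_on with
  | zero => simp
  | add x y hx hy => simp only [map_add, hx, hy]
  | tmul a b => simp [hS]

lemma conjS_tTplus (hS : ∀ x : W, S W (S W x) = x) (φ : Dual ℂ W) :
    conjS W (tTplus W φ) = tTminus W φ := by
  ext x
  rw [conjS_apply, tTplus_apply, tTminus_apply, comul_antipode]
  generalize (comul (R := ℂ) x) = z
  induction z using TensorProduct.induction_on with
  | zero => simp
  | add x y hx hy => simp only [map_add, hx, hy]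
  | tmul a b => simp [hS]

/-- Reversing an edge amounts to applying the involutive anti-automorphism `S` to its copy of `W`.
Every edge identity therefore needs to be checked for one direction only. -/
lemma conjS_vOp (hS : ∀ x : W, S W (S W x) = x) (b : Bool) (h : W) :
    conjS W (vOp W b h) = vOp W (!b) h := by
  cases b
  · rw [← conjS_conjS hS (vOp W (!false) h)]
    exact congrArg _ (conjS_Lplus hS h).symm
  · exact conjS_Lplus hS h

lemma conjS_vOp' (hS : ∀ x : W, S W (S W x) = x) (b : Bool) (h : W) :
    conjS W (vOp' W b h) = vOp' W (!b) h := by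
  cases b
  · rw [← conjS_conjS hS (vOp' W (!false) h)]
    exact congrArg _ (conjS_tLplus hS h).symm
  · exact conjS_tLplus hS h

lemma conjS_fOp (hS : ∀ x : W, S W (S W x) = x) (b : Bool) (φ : Dual ℂ W) :
    conjS W (fOp W b φ) = fOp W (!b) φ := by
  cases b
  · rw [← conjS_conjS hS (fOp W (!false) φ)]
    exact congrArg _ (conjS_Tplus hS φ).symm
  · exact conjS_Tplus hS φ

lemma conjS_fOp' (hS : ∀ x : W, S W (S W x) = x) (b : Bool) (φ : Dual ℂ W) :
    conjS W (fOp' W b φ) = fOp' W (!b) φ := by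
  cases b
  · rw [← conjS_conjS hS (fOp' W (!false) φ)]
    exact congrArg _ (conjS_tTplus hS φ).symm
  · exact conjS_tTplus hS φ

lemma vOp_mul (hS : ∀ x : W, S W (S W x) = x) (b : Bool) (g h : W) :
    vOp W b (g * h) = vOp W b g * vOp W b h := by
  have h1 : vOp W true (g * h) = vOp W true g * vOp W true h := by
    ext x
    exact mul_assoc _ _ _
  cases b
  · simpa [conjS_mul hS, conjS_vOp hS] using congrArg (conjS W) h1
  · exact h1

lemma fOp_mul (hS : ∀ x : W, S W (S W x) = x) (b : Bool) (φ χ : Dual ℂ W) :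
    fOp W b (dualMul φ χ) = fOp W b φ * fOp W b χ := by
  have h1 : fOp W true (dualMul φ χ) = fOp W true φ * fOp W true χ := by
    ext x
    have e1 : ∀ z : W ⊗[ℂ] W, TensorProduct.rid ℂ W ((dualMul φ χ).lTensor W z) =
        TensorProduct.rid ℂ W ((TensorProduct.dualDistrib ℂ W W (φ ⊗ₜ[ℂ] χ)).lTensor W
          ((Δ W).lTensor W z)) := by
      intro z
      rw [← LinearMap.comp_apply, ← LinearMap.lTensor_comp]; rfl
    have e2 : ∀ z : W ⊗[ℂ] W, TensorProduct.rid ℂ W ((TensorProduct.dualDistrib ℂ W W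
          (φ ⊗ₜ[ℂ] χ)).lTensor W (TensorProduct.assoc ℂ W W W ((Δ W).rTensor W z))) =
        Tplus W φ (TensorProduct.rid ℂ W (χ.lTensor W z)) := by
      intro z
      induction z using TensorProduct.induction_on with
      | zero => simp
      | add x y hx hy => simp only [map_add, hx, hy]
      | tmul a b =>
        simp only [LinearMap.rTensor_tmul, LinearMap.lTensor_tmul, TensorProduct.rid_tmul,
          map_smul, Tplus_apply]
        generalize (comul (R := ℂ) a) = w
        induction w using TensorProduct.induction_on with
        | zero => simp
        | add x y hx hy => simp only [map_add, hx, hy, add_tmul, smul_add]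
        | tmul c d => simp [smul_smul, mul_comm]
    refine (e1 (Δ W x)).trans ?_
    rw [← assoc_rTensor_comul]
    exact e2 (Δ W x)
  cases b
  · simpa [conjS_mul hS, conjS_fOp hS] using congrArg (conjS W) h1
  · exact h1

/-- For `S² = 1` the left-handed operators are the right-handed ones at `S(g)`, so they commute with
whatever the latter commute with. -/
lemma vOp'_eq (hS : ∀ x : W, S W (S W x) = x) (b : Bool) (g : W) :
    vOp' W b g = vOp W b (S W g) := by
  have h1 : vOp' W true g = vOp W true (S W g) := by
    ext x
    exact tLplus_apply hS g x
  cases b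
  · simpa [conjS_vOp hS, conjS_vOp' hS] using congrArg (conjS W) h1
  · exact h1

lemma fOp'_eq (hS : ∀ x : W, S W (S W x) = x) (b : Bool) (φ : Dual ℂ W) :
    fOp' W b φ = fOp W b (φ ∘ₗ S W) := by
  cases b
  · have h1 : fOp' W true φ = fOp W true (φ ∘ₗ S W) := rfl
    simpa [conjS_fOp hS, conjS_fOp' hS] using congrArg (conjS W) h1
  · rfl

lemma vOp_commute (hS : ∀ x : W, S W (S W x) = x) (b : Bool) (g h : W) :
    Commute (vOp W b g) (vOp W (!b) h) := by
  have h1 : ∀ g h, Commute (vOp W true g) (vOp W false h) := fun g h => by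
    ext x
    change Lplus W g (Lminus W h x) = Lminus W h (Lplus W g x)
    simp [Lplus_apply, Lminus_apply hS, mul_assoc]
  cases b
  · exact (h1 h g).symm
  · exact h1 g h

lemma fOp_commute (b : Bool) (φ χ : Dual ℂ W) :
    Commute (fOp W b φ) (fOp W (!b) χ) := by
  have h1 : ∀ φ χ, Commute (fOp W true φ) (fOp W false χ) := fun φ χ => by
    ext x
    have e1 : ∀ z : W ⊗[ℂ] W, Tplus W φ (TensorProduct.lid ℂ W ((χ ∘ₗ S W).rTensor W z)) =
        TensorProduct.lid ℂ W ((χ ∘ₗ S W).rTensor W (((TensorProduct.rid ℂ W).toLinearMap ∘ₗ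
          φ.lTensor W).lTensor W ((Δ W).lTensor W z))) := by
      intro z
      induction z using TensorProduct.induction_on with
      | zero => simp
      | add x y hx hy => simp only [map_add, hx, hy]
      | tmul a b => simp [Tplus_apply]
    have e2 : ∀ z : W ⊗[ℂ] W, Tminus W χ (TensorProduct.rid ℂ W (φ.lTensor W z)) =
        TensorProduct.lid ℂ W ((χ ∘ₗ S W).rTensor W (((TensorProduct.rid ℂ W).toLinearMap ∘ₗ
          φ.lTensor W).lTensor W (TensorProduct.assoc ℂ W W W ((Δ W).rTensor W z)))) := by
      intro z
      induction z using TensorProduct.induction_on with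
      | zero => simp
      | add x y hx hy => simp only [map_add, hx, hy]
      | tmul a b =>
        simp only [LinearMap.rTensor_tmul, LinearMap.lTensor_tmul, TensorProduct.rid_tmul,
          map_smul, Tminus_apply]
        generalize (comul (R := ℂ) a) = w
        induction w using TensorProduct.induction_on with
        | zero => simp
        | add x y hx hy => simp only [map_add, hx, hy, add_tmul, smul_add]
        | tmul c d => simp [smul_smul]
    refine (e1 (Δ W x)).trans ?_
    rw [← assoc_rTensor_comul]
    exact (e2 (Δ W x)).symm
  cases b
  · exact (h1 χ φ).symm
  · exact h1 φ χ

section Exchange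

variable {ι : Type*} {h : W} (𝓡 : Repr ℂ h ι)

/-- Only `Δ(hx) = Δ(h)Δ(x)` is used: the leg of `h` that lands in the contracted position is moved
into `φ`. The same holds for `fOp_mul_vOp` and `fOp_mul_vOp'`. -/
lemma fOp'_mul_vOp (hS : ∀ x : W, S W (S W x) = x) (b : Bool) (φ : Dual ℂ W) :
    fOp' W b φ * vOp W (!b) h =
      ∑ i ∈ 𝓡.index, vOp W (!b) (𝓡.right i) * fOp' W b (φ ∘ₗ LinearMap.mulLeft ℂ (𝓡.left i)) := by
  have h1 : fOp' W false φ * vOp W true h =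
      ∑ i ∈ 𝓡.index, vOp W true (𝓡.right i) *
        fOp' W false (φ ∘ₗ LinearMap.mulLeft ℂ (𝓡.left i)) := by
    ext x
    change tTminus W φ (Lplus W h x) = _
    rw [Lplus_apply, tTminus_apply, comul_mul, ← 𝓡.eq, Finset.sum_mul, map_sum, map_sum,
      LinearMap.sum_apply]
    refine Finset.sum_congr rfl fun i _ => ?_
    change _ = Lplus W _ (tTminus W _ x)
    rw [Lplus_apply, tTminus_apply]
    generalize (comul (R := ℂ) x) = z
    induction z using TensorProduct.induction_on with
    | zero => simp
    | add x y hx hy => simp only [map_add, hx, hy, mul_add]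
    | tmul a b => simp
  cases b
  · exact h1
  · simpa [conjS_mul hS, conjS_vOp hS, conjS_fOp' hS] using congrArg (conjS W) h1

lemma fOp_mul_vOp (hS : ∀ x : W, S W (S W x) = x) (b : Bool) (φ : Dual ℂ W) :
    fOp W b φ * vOp W b h =
      ∑ i ∈ 𝓡.index, vOp W b (𝓡.left i) * fOp W b (φ ∘ₗ LinearMap.mulLeft ℂ (𝓡.right i)) := by
  have h1 : fOp W true φ * vOp W true h =
      ∑ i ∈ 𝓡.index, vOp W true (𝓡.left i) *
        fOp W true (φ ∘ₗ LinearMap.mulLeft ℂ (𝓡.right i)) := by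
    ext x
    change Tplus W φ (Lplus W h x) = _
    rw [Lplus_apply, Tplus_apply, comul_mul, ← 𝓡.eq, Finset.sum_mul, map_sum, map_sum,
      LinearMap.sum_apply]
    refine Finset.sum_congr rfl fun i _ => ?_
    change _ = Lplus W _ (Tplus W _ x)
    rw [Lplus_apply, Tplus_apply]
    generalize (comul (R := ℂ) x) = z
    induction z using TensorProduct.induction_on with
    | zero => simp
    | add x y hx hy => simp only [map_add, hx, hy, mul_add]
    | tmul a b => simp
  cases b
  · simpa [conjS_mul hS, conjS_vOp hS, conjS_fOp hS] using congrArg (conjS W) h1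
  · exact h1

lemma fOp_mul_vOp' (hS : ∀ x : W, S W (S W x) = x) (b : Bool) (φ : Dual ℂ W) :
    fOp W (!b) φ * vOp' W b h =
      ∑ i ∈ 𝓡.index, vOp' W b (𝓡.left i) *
        fOp W (!b) (φ ∘ₗ LinearMap.mulRight ℂ (𝓡.right i)) := by
  have h1 : fOp W true φ * vOp' W false h =
      ∑ i ∈ 𝓡.index, vOp' W false (𝓡.left i) *
        fOp W true (φ ∘ₗ LinearMap.mulRight ℂ (𝓡.right i)) := by
    ext x
    change Tplus W φ (tLminus W h x) = _
    rw [tLminus_apply, Tplus_apply, comul_mul, ← 𝓡.eq, Finset.mul_sum, map_sum, map_sum,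
      LinearMap.sum_apply]
    refine Finset.sum_congr rfl fun i _ => ?_
    change _ = tLminus W _ (Tplus W _ x)
    rw [tLminus_apply, Tplus_apply]
    generalize (comul (R := ℂ) x) = z
    induction z using TensorProduct.induction_on with
    | zero => simp
    | add x y hx hy => simp only [map_add, hx, hy, add_mul]
    | tmul a b => simp
  cases b
  · exact h1
  · simpa [conjS_mul hS, conjS_vOp' hS, conjS_fOp hS] using congrArg (conjS W) h1

end Exchange

end EdgeOperators

/-! ### Edge identities in which legs of `h` cancel. -/

section Absorption

variable {W : Type*} [Ring W] [Algebra ℂ W] [WeakHopfAlgebra W]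

lemma antipode_mul_rev' (hS : ∀ x : W, S W (S W x) = x) (x : W) :
    LinearMap.mul' ℂ W (TensorProduct.map (S W) LinearMap.id
      (TensorProduct.comm ℂ W W (Δ W x))) = S W (eR W x) := by
  rw [← epsR_eq, ← antipode_mul]
  generalize (comul (R := ℂ) x) = z
  induction z using TensorProduct.induction_on with
  | zero => simp
  | add x y hx hy => simp only [map_add, hx, hy]
  | tmul a b => simp [antipode_mul_rev, hS]

variable {ι : Type*} {h : W} (𝓡 : Repr ℂ h ι)

/-- The left side evaluates to `Σ φ(S(x⁽²⁾)S(h⁽²⁾)h⁽³⁾) h⁽¹⁾x⁽¹⁾`. Here `S(h⁽²⁾)h⁽³⁾` collapses to a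
copy of `Δ(1)`, which `Δ(x)` absorbs. -/
lemma sum_fOp'_mul_vOp (hS : ∀ x : W, S W (S W x) = x) (b : Bool) (φ : Dual ℂ W) :
    ∑ i ∈ 𝓡.index, fOp' W b (φ ∘ₗ LinearMap.mulRight ℂ (𝓡.right i)) * vOp W b (𝓡.left i) =
      vOp W b h * fOp' W b φ := by
  have h1 : ∑ i ∈ 𝓡.index, fOp' W true (φ ∘ₗ LinearMap.mulRight ℂ (𝓡.right i)) *
      vOp W true (𝓡.left i) = vOp W true h * fOp' W true φ := by
    ext x
    let 𝓧 := ℛ ℂ x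
    -- `G` sends `a ⊗ c` to `Σ φ(S(x⁽²⁾)c) a x⁽¹⁾`: it holds the dependence on `x`, so that the
    -- Sweedler legs of `h` can be rearranged inside its argument.
    let G : W ⊗[ℂ] W →ₗ[ℂ] W := ∑ j ∈ 𝓧.index, (TensorProduct.rid ℂ W).toLinearMap ∘ₗ
      TensorProduct.map (LinearMap.mulRight ℂ (𝓧.left j))
        (φ ∘ₗ LinearMap.mulLeft ℂ (S W (𝓧.right j)))
    have eA : ∀ (z : W ⊗[ℂ] W) (b : W), TensorProduct.rid ℂ W
        (((φ ∘ₗ LinearMap.mulRight ℂ b) ∘ₗ S W).lTensor W (z * Δ W x)) =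
          G ((LinearMap.mul' ℂ W ∘ₗ (S W).rTensor W).lTensor W
            (TensorProduct.assoc ℂ W W W (z ⊗ₜ b))) := by
      intro z b
      induction z using TensorProduct.induction_on with
      | zero => simp
      | add x y hx hy => simp only [map_add, hx, hy, add_mul, add_tmul]
      | tmul a c =>
        rw [← 𝓧.eq]
        simp [G, Finset.mul_sum, antipode_mul_rev, mul_assoc]
    have eC : ∀ w : W ⊗[ℂ] W, G ((h ⊗ₜ 1) * (S W).lTensor W w) =
        h * TensorProduct.rid ℂ W ((φ ∘ₗ S W).lTensor W (w * Δ W x)) := by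
      intro w
      induction w using TensorProduct.induction_on with
      | zero => simp
      | add x y hx hy => simp only [map_add, hx, hy, add_mul, mul_add]
      | tmul a c =>
        rw [← 𝓧.eq]
        simp [G, Finset.mul_sum, antipode_mul_rev, mul_assoc]
    have eB : (LinearMap.mul' ℂ W ∘ₗ (S W).rTensor W).lTensor W ((Δ W).lTensor W (Δ W h)) =
        (eR W).lTensor W (Δ W h) := by
      rw [← LinearMap.comp_apply, ← LinearMap.lTensor_comp]
      congr 2
      exact LinearMap.ext fun y => antipode_mul y
    have hL : (∑ i ∈ 𝓡.index, fOp' W true (φ ∘ₗ LinearMap.mulRight ℂ (𝓡.right i)) *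
        vOp W true (𝓡.left i)) x = ∑ i ∈ 𝓡.index, TensorProduct.rid ℂ W
        (((φ ∘ₗ LinearMap.mulRight ℂ (𝓡.right i)) ∘ₗ S W).lTensor W (Δ W (𝓡.left i * x))) := by
      rw [LinearMap.sum_apply]; rfl
    rw [hL]
    simp only [comul_mul, eA, ← map_sum, ← LinearMap.rTensor_tmul, 𝓡.eq]
    rw [assoc_rTensor_comul, eB, lTensor_eR', eC, comul_one_mul_comul]
    rfl
  cases b
  · simpa [conjS_mul hS, conjS_vOp hS, conjS_fOp' hS] using congrArg (conjS W) h1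
  · exact h1

/-- This time the legs meet in the order `S(h⁽²⁾)h⁽¹⁾`, which collapses only because `S² = 1`
(`antipode_mul_rev'`). -/
lemma sum_fOp_mul_vOp (hS : ∀ x : W, S W (S W x) = x) (b : Bool) (φ : Dual ℂ W) :
    ∑ i ∈ 𝓡.index, fOp W b (φ ∘ₗ LinearMap.mulRight ℂ (𝓡.left i)) * vOp W (!b) (𝓡.right i) =
      vOp W (!b) h * fOp W b φ := by
  have h1 : ∑ i ∈ 𝓡.index, fOp W false (φ ∘ₗ LinearMap.mulRight ℂ (𝓡.left i)) *
      vOp W true (𝓡.right i) = vOp W true h * fOp W false φ := by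
    ext x
    let 𝓧 := ℛ ℂ x
    let G : W ⊗[ℂ] W →ₗ[ℂ] W := ∑ j ∈ 𝓧.index, (TensorProduct.lid ℂ W).toLinearMap ∘ₗ
      TensorProduct.map (φ ∘ₗ LinearMap.mulLeft ℂ (S W (𝓧.left j)))
        (LinearMap.mulRight ℂ (𝓧.right j))
    have eA : ∀ (z : W ⊗[ℂ] W) (b : W), TensorProduct.lid ℂ W
        (((φ ∘ₗ LinearMap.mulRight ℂ b) ∘ₗ S W).rTensor W (z * Δ W x)) =
          G ((LinearMap.mul' ℂ W ∘ₗ TensorProduct.map (S W) LinearMap.id ∘ₗ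
            (TensorProduct.comm ℂ W W).toLinearMap).rTensor W
            ((TensorProduct.assoc ℂ W W W).symm (b ⊗ₜ z))) := by
      intro z b
      induction z using TensorProduct.induction_on with
      | zero => simp
      | add x y hx hy => simp only [map_add, hx, hy, add_mul, tmul_add]
      | tmul a c =>
        rw [← 𝓧.eq]
        simp [G, Finset.mul_sum, antipode_mul_rev, mul_assoc]
    have eC : ∀ w : W ⊗[ℂ] W, G ((S W).rTensor W ((1 ⊗ₜ h) * w)) =
        h * TensorProduct.lid ℂ W ((φ ∘ₗ S W).rTensor W (w * Δ W x)) := by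
      intro w
      induction w using TensorProduct.induction_on with
      | zero => simp
      | add x y hx hy => simp only [map_add, hx, hy, add_mul, mul_add]
      | tmul a c =>
        rw [← 𝓧.eq]
        simp [G, Finset.mul_sum, antipode_mul_rev, mul_assoc]
    have eB : (LinearMap.mul' ℂ W ∘ₗ TensorProduct.map (S W) LinearMap.id ∘ₗ
            (TensorProduct.comm ℂ W W).toLinearMap).rTensor W ((Δ W).rTensor W (Δ W h)) =
        (S W).rTensor W ((eR W).rTensor W (Δ W h)) := by
      have e : (LinearMap.mul' ℂ W ∘ₗ TensorProduct.map (S W) LinearMap.id ∘ₗ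
          (TensorProduct.comm ℂ W W).toLinearMap) ∘ₗ Δ W = S W ∘ₗ eR W :=
        LinearMap.ext fun y => antipode_mul_rev' hS y
      rw [← LinearMap.comp_apply, ← LinearMap.rTensor_comp, e, LinearMap.rTensor_comp]
      rfl
    have hL : (∑ i ∈ 𝓡.index, fOp W false (φ ∘ₗ LinearMap.mulRight ℂ (𝓡.left i)) *
        vOp W true (𝓡.right i)) x = ∑ i ∈ 𝓡.index, TensorProduct.lid ℂ W
        (((φ ∘ₗ LinearMap.mulRight ℂ (𝓡.left i)) ∘ₗ S W).rTensor W (Δ W (𝓡.right i * x))) := by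
      rw [LinearMap.sum_apply]; rfl
    rw [hL]
    simp only [comul_mul, eA, ← map_sum, ← LinearMap.lTensor_tmul, 𝓡.eq]
    rw [coassoc_symm_apply, eB, rTensor_eR, eC, comul_one_mul_comul]
    rfl
  cases b
  · exact h1
  · simpa [conjS_mul hS, conjS_vOp hS, conjS_fOp hS] using congrArg (conjS W) h1

/-- Reading from the right: `S` reverses the legs of `h⁽²⁾`, so `φ` sees `h⁽¹⁾S(h⁽²⁾)x⁽²⁾` while
`S(h⁽³⁾)` multiplies `x⁽¹⁾`. The product `h⁽¹⁾S(h⁽²⁾)` collapses through `ε_L`. -/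
lemma vOp'_mul_fOp (hS : ∀ x : W, S W (S W x) = x) (b : Bool) (φ : Dual ℂ W) :
    vOp' W b h * fOp W b φ =
      ∑ i ∈ 𝓡.index, fOp W b (φ ∘ₗ LinearMap.mulLeft ℂ (𝓡.left i)) * vOp' W b (𝓡.right i) := by
  have h1 : vOp' W true h * fOp W true φ =
      ∑ i ∈ 𝓡.index, fOp W true (φ ∘ₗ LinearMap.mulLeft ℂ (𝓡.left i)) *
        vOp' W true (𝓡.right i) := by
    ext x
    let 𝓧 := ℛ ℂ x
    let G : W ⊗[ℂ] W →ₗ[ℂ] W := ∑ j ∈ 𝓧.index, (TensorProduct.lid ℂ W).toLinearMap ∘ₗ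
      TensorProduct.map (φ ∘ₗ LinearMap.mulRight ℂ (𝓧.right j))
        (LinearMap.mulRight ℂ (𝓧.left j) ∘ₗ S W)
    have eA : ∀ (z : W ⊗[ℂ] W) (b : W), TensorProduct.rid ℂ W
        ((φ ∘ₗ LinearMap.mulLeft ℂ b).lTensor W (TensorProduct.map (S W) (S W)
          (TensorProduct.comm ℂ W W z) * Δ W x)) =
          G ((LinearMap.mul' ℂ W ∘ₗ (S W).lTensor W).rTensor W
            ((TensorProduct.assoc ℂ W W W).symm (b ⊗ₜ z))) := by
      intro z b
      induction z using TensorProduct.induction_on with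
      | zero => simp
      | add x y hx hy => simp only [map_add, hx, hy, add_mul, tmul_add]
      | tmul a c =>
        rw [← 𝓧.eq]
        simp [G, Finset.mul_sum, mul_assoc]
    have eC : ∀ w : W ⊗[ℂ] W, G ((S W).rTensor W w * (1 ⊗ₜ h)) =
        S W h * TensorProduct.rid ℂ W (φ.lTensor W
          (TensorProduct.comm ℂ W W (TensorProduct.map (S W) (S W) w) * Δ W x)) := by
      intro w
      induction w using TensorProduct.induction_on with
      | zero => simp
      | add x y hx hy => simp only [map_add, hx, hy, add_mul, mul_add]
      | tmul a c =>
        rw [← 𝓧.eq]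
        simp [G, Finset.mul_sum, antipode_mul_rev, mul_assoc]
    have eB : (LinearMap.mul' ℂ W ∘ₗ (S W).lTensor W).rTensor W ((Δ W).rTensor W (Δ W h)) =
        (eL W).rTensor W (Δ W h) := by
      rw [← LinearMap.comp_apply, ← LinearMap.rTensor_comp]
      congr 2
      exact LinearMap.ext fun y => mul_antipode y
    have hR : (∑ i ∈ 𝓡.index, fOp W true (φ ∘ₗ LinearMap.mulLeft ℂ (𝓡.left i)) *
        vOp' W true (𝓡.right i)) x = ∑ i ∈ 𝓡.index, TensorProduct.rid ℂ W
        ((φ ∘ₗ LinearMap.mulLeft ℂ (𝓡.left i)).lTensor W (Δ W (S W (𝓡.right i) * x))) := by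
      rw [LinearMap.sum_apply]
      refine Finset.sum_congr rfl fun i _ => ?_
      rw [vOp'_eq hS]
      rfl
    have hcc : TensorProduct.comm ℂ W W (TensorProduct.comm ℂ W W (Δ W 1)) = Δ W 1 :=
      (TensorProduct.comm ℂ W W).symm_apply_apply _
    rw [hR]
    simp only [comul_mul, comul_antipode, eA, ← map_sum, ← LinearMap.lTensor_tmul, 𝓡.eq]
    rw [coassoc_symm_apply, eB, rTensor_eL', eC, map_antipode_one, hcc, comul_one_mul_comul,
      vOp'_eq hS]
    rfl
  cases b
  · simpa [conjS_mul hS, conjS_vOp' hS, conjS_fOp hS] using congrArg (conjS W) h1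
  · exact h1

end Absorption

/-! ### Star operators and their relations with left multiplications. -/

section StarOperators

section General

variable {V A : Type*} [AddCommGroup V] [Module ℂ V] [Ring A] [Algebra ℂ A]

variable (V A) in
/-- Left multiplication of `A`-valued linear maps. -/
def postMul : A →ₗ[ℂ] Module.End ℂ (V →ₗ[ℂ] A) := LinearMap.llcomp ℂ V A A ∘ₗ LinearMap.mul ℂ A

variable (V A) in
/-- Precomposition of `A`-valued linear maps. -/
def preComp : Module.End ℂ V →ₗ[ℂ] Module.End ℂ (V →ₗ[ℂ] A) := (LinearMap.llcomp ℂ V V A).flip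

@[simp] lemma postMul_apply (x : A) (Q : V →ₗ[ℂ] A) (t : V) : postMul V A x Q t = x * Q t := rfl

@[simp] lemma preComp_apply (n : Module.End ℂ V) (Q : V →ₗ[ℂ] A) (t : V) :
    preComp V A n Q t = Q (n t) := rfl

lemma postMul_mul (x y : A) : postMul V A (x * y) = postMul V A x * postMul V A y := by
  ext Q t
  simp [mul_assoc]

lemma postMul_commute_preComp (x : A) (n : Module.End ℂ V) :
    Commute (postMul V A x) (preComp V A n) := by
  ext Q t
  simp

lemma postMul_commute {x y : A} (h : Commute x y) : Commute (postMul V A x) (postMul V A y) := by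
  rw [commute_iff_eq, ← postMul_mul, h.eq, postMul_mul]

end General

variable {W : Type*} [Ring W] [Algebra ℂ W] [WeakHopfAlgebra W]
variable {A : Type*} [Ring A] [Algebra ℂ A]

/-- `Q ↦ (t ↦ Σ K(t⁽⁻¹⁾) Q(t⁽⁰⁾))` -/
def starVertex (K : W →ₗ[ℂ] A) : Module.End ℂ (RibbonSpace W →ₗ[ℂ] A) where
  toFun Q := LinearMap.mul' ℂ A ∘ₗ TensorProduct.map K Q ∘ₗ coact W
  map_add' Q Q' := by
    rw [TensorProduct.map_add_right, LinearMap.add_comp, LinearMap.comp_add]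
  map_smul' c Q := by
    rw [TensorProduct.map_smul_right, LinearMap.smul_comp, LinearMap.comp_smul]; rfl

lemma starVertex_apply (K : W →ₗ[ℂ] A) (Q : RibbonSpace W →ₗ[ℂ] A) (t : RibbonSpace W) :
    starVertex K Q t = LinearMap.mul' ℂ A (TensorProduct.map K Q (coact W t)) := rfl

variable (W) in
/-- `t ↦ Σ χ(t⁽⁻¹⁾) t⁽⁰⁾` -/
def coactDual : Dual ℂ W →ₗ[ℂ] Module.End ℂ (RibbonSpace W) where
  toFun χ := (TensorProduct.lid ℂ (RibbonSpace W)).toLinearMap ∘ₗ χ.rTensor (RibbonSpace W) ∘ₗ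
    coact W
  map_add' χ χ' := by
    rw [LinearMap.rTensor_add, LinearMap.add_comp, LinearMap.comp_add]
  map_smul' c χ := by
    rw [LinearMap.rTensor_smul, LinearMap.smul_comp, LinearMap.comp_smul]; rfl

lemma coactDual_apply (χ : Dual ℂ W) (t : RibbonSpace W) : coactDual W χ t =
    TensorProduct.lid ℂ (RibbonSpace W) (χ.rTensor (RibbonSpace W) (coact W t)) := rfl

lemma starVertex_commute {K : W →ₗ[ℂ] A} {x : A} (h : ∀ g, Commute (K g) x) :
    Commute (starVertex K) (postMul (RibbonSpace W) A x) := by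
  refine LinearMap.ext fun Q => LinearMap.ext fun t => ?_
  simp only [Module.End.mul_apply, postMul_apply, starVertex_apply]
  generalize coact W t = z
  induction z using TensorProduct.induction_on with
  | zero => simp
  | add x y hx hy => simp only [map_add, hx, hy, mul_add]
  | tmul a b =>
    simp only [TensorProduct.map_tmul, LinearMap.mul'_apply, postMul_apply]
    rw [← mul_assoc, (h a).eq, mul_assoc]

section Vertex

variable {ι : Type*} {h : W} (𝓡 : Repr ℂ h ι) {a : W →ₗ[ℂ] A}

/-- The relation for a dual triangle with the dual edge on the right. -/
lemma starVertex_braid (hS : ∀ x : W, S W (S W x) = x) (ha : ∀ g h, a (g * h) = a g * a h) :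
    ∑ i ∈ 𝓡.index, starVertex a * (postMul (RibbonSpace W) A (a (𝓡.left i)) *
        preComp _ A (lam W (𝓡.right i))) =
      ∑ i ∈ 𝓡.index, preComp _ A (lam W (𝓡.left i)) * postMul _ A (a (𝓡.right i)) *
        starVertex a := by
  refine LinearMap.ext fun Q => LinearMap.ext fun t => ?_
  have key := congrArg (fun z => LinearMap.mul' ℂ A (TensorProduct.map a Q z))
    (LinearMap.congr_fun (coact_exchange' hS 𝓡) t)
  simp only [LinearMap.sum_apply, map_sum] at key ⊢
  refine Eq.trans (Finset.sum_congr rfl fun i _ => ?_)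
    (key.trans (Finset.sum_congr rfl fun i _ => ?_))
  · simp only [Module.End.mul_apply, starVertex_apply, LinearMap.comp_apply]
    generalize coact W t = z
    induction z using TensorProduct.induction_on with
    | zero => simp
    | add x y hx hy => simp only [map_add, hx, hy]
    | tmul g v => simp [ha, mul_assoc]
  · simp only [Module.End.mul_apply, preComp_apply, postMul_apply, starVertex_apply,
      LinearMap.comp_apply]
    generalize coact W _ = z
    induction z using TensorProduct.induction_on with
    | zero => simp
    | add x y hx hy => simp only [map_add, hx, hy, mul_add]
    | tmul g v => simp [ha, mul_assoc]

/-- The relation for a dual triangle with the dual edge on the left. -/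
lemma starVertex_antipode_braid (hS : ∀ x : W, S W (S W x) = x)
    (ha : ∀ g h, a (g * h) = a g * a h) :
    ∑ i ∈ 𝓡.index, starVertex (a ∘ₗ S W) * (postMul (RibbonSpace W) A (a (𝓡.right i)) *
        preComp _ A (lam W (𝓡.left i))) =
      ∑ i ∈ 𝓡.index, preComp _ A (lam W (𝓡.right i)) * postMul _ A (a (𝓡.left i)) *
        starVertex (a ∘ₗ S W) := by
  refine LinearMap.ext fun Q => LinearMap.ext fun t => ?_
  have key := congrArg (fun z => LinearMap.mul' ℂ A (TensorProduct.map (a ∘ₗ S W) Q z))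
    (LinearMap.congr_fun (coact_exchange hS 𝓡) t)
  simp only [LinearMap.sum_apply, map_sum] at key ⊢
  refine Eq.trans (Finset.sum_congr rfl fun i _ => ?_)
    (key.trans (Finset.sum_congr rfl fun i _ => ?_))
  · simp only [Module.End.mul_apply, starVertex_apply, LinearMap.comp_apply]
    generalize coact W t = z
    induction z using TensorProduct.induction_on with
    | zero => simp
    | add x y hx hy => simp only [map_add, hx, hy]
    | tmul g v => simp [ha, mul_assoc, antipode_mul_rev, hS]
  · simp only [Module.End.mul_apply, preComp_apply, postMul_apply, starVertex_apply,
      LinearMap.comp_apply]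
    generalize coact W _ = z
    induction z using TensorProduct.induction_on with
    | zero => simp
    | add x y hx hy => simp only [map_add, hx, hy, mul_add]
    | tmul g v => simp [ha, mul_assoc, antipode_mul_rev, hS]

end Vertex

section VertexMove

variable {ι : Type*} {s : Finset ι} {K B : W →ₗ[ℂ] A} {x : A} {y : ι → A} {n : ι → Dual ℂ W}

lemma sum_coactDual (hB : ∀ g, ∑ i ∈ s, n i g • y i = B g) (Q : RibbonSpace W →ₗ[ℂ] A)
    (t : RibbonSpace W) : ∑ i ∈ s, y i * Q (coactDual W (n i) t) =
      LinearMap.mul' ℂ A (TensorProduct.map B Q (coact W t)) := by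
  simp only [coactDual_apply]
  generalize coact W t = z
  induction z using TensorProduct.induction_on with
  | zero => simp
  | add x y hx hy => simp only [map_add, ← hx, ← hy, mul_add, Finset.sum_add_distrib]
  | tmul g v =>
    simp [← hB, Finset.sum_mul]

/-- An identity for the single-edge operator `K` lifts to the star operator by coassociativity of
the coaction. The additional leg of `g` needed in `hK` is a second application of `coact`, which is
then read as the action of `coactDual` on the label. -/
lemma starVertex_move_out (hB : ∀ g, ∑ i ∈ s, n i g • y i = B g)
    (hK : ∀ g, K g * x = LinearMap.mul' ℂ A (TensorProduct.map B K (Δ W g))) :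
    starVertex K * postMul (RibbonSpace W) A x =
      ∑ i ∈ s, preComp _ A (coactDual W (n i)) * postMul _ A (y i) * starVertex K := by
  refine LinearMap.ext fun Q => LinearMap.ext fun t => ?_
  have h1 : (∑ i ∈ s, preComp _ A (coactDual W (n i)) * postMul (RibbonSpace W) A (y i) *
      starVertex K) Q t =
      LinearMap.mul' ℂ A (TensorProduct.map B (starVertex K Q) (coact W t)) := by
    rw [← sum_coactDual hB]
    simp
  have h2 : ∀ z : W ⊗[ℂ] RibbonSpace W, LinearMap.mul' ℂ A (TensorProduct.map B (starVertex K Q) z) =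
      LinearMap.mul' ℂ A (TensorProduct.map B (LinearMap.mul' ℂ A ∘ₗ TensorProduct.map K Q)
        ((coact W).lTensor W z)) := by
    intro z
    induction z using TensorProduct.induction_on with
    | zero => simp
    | add x y hx hy => simp only [map_add, hx, hy]
    | tmul g v => rfl
  have h3 : ∀ z : W ⊗[ℂ] RibbonSpace W,
      LinearMap.mul' ℂ A (TensorProduct.map B (LinearMap.mul' ℂ A ∘ₗ TensorProduct.map K Q)
        (TensorProduct.assoc ℂ W W (RibbonSpace W) ((Δ W).rTensor (RibbonSpace W) z))) =
      LinearMap.mul' ℂ A (TensorProduct.map K (postMul _ A x Q) z) := by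
    intro z
    induction z using TensorProduct.induction_on with
    | zero => simp
    | add x y hx hy => simp only [map_add, hx, hy]
    | tmul g v =>
      simp only [TensorProduct.map_tmul, LinearMap.mul'_apply, postMul_apply, ← mul_assoc, hK,
        LinearMap.rTensor_tmul]
      generalize (comul (R := ℂ) g) = w
      induction w using TensorProduct.induction_on with
      | zero => simp
      | add x y hx hy => simp only [map_add, hx, hy, add_tmul, add_mul]
      | tmul c d => simp [mul_assoc]
  have hco := LinearMap.congr_fun (coact_coassoc (W := W)) t
  simp only [LinearMap.comp_apply, LinearEquiv.coe_coe] at hco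
  rw [h1, h2, hco, h3]
  rfl

lemma starVertex_move_in (hB : ∀ g, ∑ i ∈ s, n i g • y i = B g)
    (hK : ∀ g, LinearMap.mul' ℂ A (TensorProduct.map K B (Δ W g)) = x * K g) :
    ∑ i ∈ s, starVertex K * (postMul (RibbonSpace W) A (y i) * preComp _ A (coactDual W (n i))) =
      postMul _ A x * starVertex K := by
  refine LinearMap.ext fun Q => LinearMap.ext fun t => ?_
  have h1 : ∀ v, (∑ i ∈ s, postMul (RibbonSpace W) A (y i) * preComp _ A (coactDual W (n i))) Q v =
      LinearMap.mul' ℂ A (TensorProduct.map B Q (coact W v)) := by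
    intro v
    rw [← sum_coactDual hB]
    simp
  rw [← Finset.mul_sum, Module.End.mul_apply, starVertex_apply]
  have h2 : ∀ z : W ⊗[ℂ] RibbonSpace W, LinearMap.mul' ℂ A (TensorProduct.map K
      ((∑ i ∈ s, postMul (RibbonSpace W) A (y i) * preComp _ A (coactDual W (n i))) Q) z) =
      LinearMap.mul' ℂ A (TensorProduct.map K (LinearMap.mul' ℂ A ∘ₗ TensorProduct.map B Q)
        ((coact W).lTensor W z)) := by
    intro z
    induction z using TensorProduct.induction_on with
    | zero => simp only [map_zero]
    | add x y hx hy => simp only [map_add, hx, hy]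
    | tmul g v =>
      simp only [TensorProduct.map_tmul, LinearMap.mul'_apply, h1, LinearMap.lTensor_tmul,
        LinearMap.comp_apply]
  have h3 : ∀ z : W ⊗[ℂ] RibbonSpace W,
      LinearMap.mul' ℂ A (TensorProduct.map K (LinearMap.mul' ℂ A ∘ₗ TensorProduct.map B Q)
        (TensorProduct.assoc ℂ W W (RibbonSpace W) ((Δ W).rTensor (RibbonSpace W) z))) =
      x * LinearMap.mul' ℂ A (TensorProduct.map K Q z) := by
    intro z
    induction z using TensorProduct.induction_on with
    | zero => simp
    | add x y hx hy => simp only [map_add, hx, hy, mul_add]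
    | tmul g v =>
      simp only [TensorProduct.map_tmul, LinearMap.mul'_apply, ← mul_assoc, ← hK,
        LinearMap.rTensor_tmul]
      generalize (comul (R := ℂ) g) = w
      induction w using TensorProduct.induction_on with
      | zero => simp
      | add x y hx hy => simp only [map_add, hx, hy, add_tmul, add_mul]
      | tmul c d => simp [mul_assoc]
  have hco := LinearMap.congr_fun (coact_coassoc (W := W)) t
  simp only [LinearMap.comp_apply, LinearEquiv.coe_coe] at hco
  rw [h2, hco, h3]
  rfl

end VertexMove

section Face

variable [FiniteDimensional ℂ W]

/-- `Q ↦ (t ↦ Σ_k T(k̂) Q(λ_k t))` for dual bases `k`, `k̂`. -/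
def starFace (T : Dual ℂ W →ₗ[ℂ] A) : Module.End ℂ (RibbonSpace W →ₗ[ℂ] A) :=
  ∑ i, postMul _ A (T ((Module.finBasis ℂ W).coord i)) *
    preComp _ A (lam W (Module.finBasis ℂ W i))

lemma starFace_apply (T : Dual ℂ W →ₗ[ℂ] A) (Q : RibbonSpace W →ₗ[ℂ] A) (t : RibbonSpace W) :
    starFace T Q t = ∑ i, T ((Module.finBasis ℂ W).coord i) *
      Q (lam W (Module.finBasis ℂ W i) t) := by
  simp [starFace]

/-- Both sums run over the same element of `Ŵ ⊗ W`, the one that represents the endomorphism `u`. -/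
lemma sum_coord_comp {M : Type*} [AddCommGroup M] [Module ℂ M] (F : Dual ℂ W →ₗ[ℂ] W →ₗ[ℂ] M)
    (u : W →ₗ[ℂ] W) :
    ∑ i, F ((Module.finBasis ℂ W).coord i ∘ₗ u) (Module.finBasis ℂ W i) =
      ∑ i, F ((Module.finBasis ℂ W).coord i) (u (Module.finBasis ℂ W i)) := by
  have h1 : ∀ φ : Dual ℂ W, φ = ∑ j, φ (Module.finBasis ℂ W j) • (Module.finBasis ℂ W).coord j := by
    intro φ
    refine (Module.finBasis ℂ W).ext fun j => ?_
    simp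
  have h2 : ∀ i, (Module.finBasis ℂ W).coord i ∘ₗ u =
      ∑ j, (Module.finBasis ℂ W).coord i (u (Module.finBasis ℂ W j)) •
        (Module.finBasis ℂ W).coord j := fun i => h1 _
  have h3 : ∀ x, x = ∑ i, (Module.finBasis ℂ W).coord i x • Module.finBasis ℂ W i := fun x =>
    ((Module.finBasis ℂ W).sum_repr x).symm
  have h4 : ∀ j, F ((Module.finBasis ℂ W).coord j) (u (Module.finBasis ℂ W j)) =
      ∑ i, (Module.finBasis ℂ W).coord i (u (Module.finBasis ℂ W j)) •
        F ((Module.finBasis ℂ W).coord j) (Module.finBasis ℂ W i) := by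
    intro j
    conv_lhs => rw [h3 (u (Module.finBasis ℂ W j))]
    simp only [map_sum, map_smul]
  simp only [h2, h4, map_sum, LinearMap.sum_apply, map_smul, LinearMap.smul_apply]
  exact Finset.sum_comm

lemma sum_coord_comp_mul (T : Dual ℂ W →ₗ[ℂ] A) (Q : RibbonSpace W →ₗ[ℂ] A) (t : RibbonSpace W)
    (u : W →ₗ[ℂ] W) :
    ∑ i, T ((Module.finBasis ℂ W).coord i ∘ₗ u) * Q (lam W (Module.finBasis ℂ W i) t) =
      ∑ i, T ((Module.finBasis ℂ W).coord i) * Q (lam W (u (Module.finBasis ℂ W i)) t) :=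
  sum_coord_comp ((LinearMap.mul ℂ A).compl₁₂ T (Q ∘ₗ (lam W).ofConv.flip t)) u

lemma starFace_commute {T : Dual ℂ W →ₗ[ℂ] A} {x : A} (h : ∀ φ, Commute (T φ) x) :
    Commute (starFace T) (postMul (RibbonSpace W) A x) :=
  Commute.sum_left _ _ _ fun _ _ =>
    (postMul_commute (h _)).mul_left (postMul_commute_preComp _ _).symm

section FaceMove

variable {ι : Type*} {s : Finset ι} {T : Dual ℂ W →ₗ[ℂ] A} {x : A} {y : ι → A} {k : ι → W}

/-- Replacing `k̂` by `k̂(k_i •)` is the same as replacing `k` by `k_i k`. As `lam` reverses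
products, `lam k_i` then acts on the label first, in front of the star operator. -/
lemma starFace_move_out (hT : ∀ φ, T φ * x = ∑ i ∈ s, y i * T (φ ∘ₗ LinearMap.mulLeft ℂ (k i))) :
    starFace T * postMul (RibbonSpace W) A x =
      ∑ i ∈ s, preComp _ A (lam W (k i)) * postMul _ A (y i) * starFace T := by
  refine LinearMap.ext fun Q => LinearMap.ext fun t => ?_
  simp only [LinearMap.sum_apply, Module.End.mul_apply, preComp_apply, postMul_apply,
    starFace_apply, ← mul_assoc, hT]
  simp only [Finset.sum_mul]
  rw [Finset.sum_comm]
  refine Finset.sum_congr rfl fun i _ => ?_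
  have := sum_coord_comp_mul T Q t (LinearMap.mulLeft ℂ (k i))
  simp only [LinearMap.mulLeft_apply, lam_mul, Module.End.mul_apply] at this
  rw [← this, Finset.mul_sum]
  simp only [mul_assoc]

/-- Here `k̂(• k_i)` corresponds to `k k_i`, whose factor `lam k_i` acts last, hence sits on `Q`. -/
lemma starFace_move_in (hT : ∀ φ, ∑ i ∈ s, T (φ ∘ₗ LinearMap.mulRight ℂ (k i)) * y i = x * T φ) :
    ∑ i ∈ s, starFace T * (postMul (RibbonSpace W) A (y i) * preComp _ A (lam W (k i))) =
      postMul _ A x * starFace T := by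
  refine LinearMap.ext fun Q => LinearMap.ext fun t => ?_
  have h1 : ∀ i, ∑ j, T ((Module.finBasis ℂ W).coord j) * (y i *
      Q (lam W (Module.finBasis ℂ W j * k i) t)) =
      ∑ j, T ((Module.finBasis ℂ W).coord j ∘ₗ LinearMap.mulRight ℂ (k i)) * (y i *
      Q (lam W (Module.finBasis ℂ W j) t)) := fun i =>
    (sum_coord_comp_mul T (postMul _ A (y i) Q) t (LinearMap.mulRight ℂ (k i))).symm
  simp only [LinearMap.sum_apply, Module.End.mul_apply, preComp_apply, postMul_apply,
    starFace_apply, ← Module.End.mul_apply (lam W _), ← lam_mul, h1]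
  rw [Finset.sum_comm, Finset.mul_sum]
  refine Finset.sum_congr rfl fun j _ => ?_
  rw [← mul_assoc, ← hT, Finset.sum_mul]
  simp only [mul_assoc]

end FaceMove

end Face

end StarOperators

/-! ### Braid relations for direct triangles. -/

section FaceBraid

variable {W : Type*} [Ring W] [Algebra ℂ W] [WeakHopfAlgebra W] [FiniteDimensional ℂ W]
variable {A : Type*} [Ring A] [Algebra ℂ A]

lemma dualDistrib_dualComul (χ : Dual ℂ W) :
    TensorProduct.dualDistrib ℂ W W (dualComul W χ) = χ ∘ₗ LinearMap.mul' ℂ W :=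
  (TensorProduct.dualDistribEquiv ℂ W W).apply_symm_apply (χ ∘ₗ LinearMap.mul' ℂ W)

lemma dualMul_apply (φ ψ : Dual ℂ W) {x : W} {ι : Type*} (𝓧 : Repr ℂ x ι) :
    dualMul φ ψ x = ∑ p ∈ 𝓧.index, φ (𝓧.left p) * ψ (𝓧.right p) := by
  rw [dualMul, LinearMap.comp_apply, ← 𝓧.eq]
  simp

variable {ι : Type*} {s : Finset ι} {χ : Dual ℂ W} {l r : ι → Dual ℂ W}

lemma sum_left_coactDual (hχ : ∀ x y, ∑ i ∈ s, l i x * r i y = χ (x * y)) (y : W)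
    (f : Module.End ℂ (RibbonSpace W)) (v : RibbonSpace W) :
    ∑ i ∈ s, l i y • f (coactDual W (r i) v) =
      TensorProduct.lid ℂ _ (χ.rTensor _ (f.lTensor W (mulL W y (coact W v)))) := by
  simp only [coactDual_apply]
  generalize coact W v = z
  induction z using TensorProduct.induction_on with
  | zero => simp
  | add x y hx hy => simp only [map_add, smul_add, Finset.sum_add_distrib, hx, hy]
  | tmul g v => simp [smul_smul, ← Finset.sum_smul, hχ]

lemma sum_right_coactDual (hχ : ∀ x y, ∑ i ∈ s, l i x * r i y = χ (x * y)) (y : W)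
    (f : Module.End ℂ (RibbonSpace W)) (v : RibbonSpace W) :
    ∑ i ∈ s, r i y • f (coactDual W (l i) v) =
      TensorProduct.lid ℂ _ (χ.rTensor _ (f.lTensor W (mulR W y (coact W v)))) := by
  simp only [coactDual_apply]
  generalize coact W v = z
  induction z using TensorProduct.induction_on with
  | zero => simp
  | add x y hx hy => simp only [map_add, smul_add, Finset.sum_add_distrib, hx, hy]
  | tmul g v =>
    have h : ∑ i ∈ s, r i y * l i g = χ (g * y) := by
      rw [← hχ]
      exact Finset.sum_congr rfl fun _ _ => mul_comm _ _
    simp [smul_smul, ← Finset.sum_smul, h]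

lemma dualTensorHom_injective {V : Type*} [AddCommGroup V] [Module ℂ V] :
    Function.Injective (dualTensorHom ℂ W V) :=
  (dualTensorHomEquivOfBasis (N := V) (Module.finBasis ℂ W)).injective

lemma sum_coord_smul_lam (x : W) (t : RibbonSpace W) (f : RibbonSpace W →ₗ[ℂ] RibbonSpace W) :
    ∑ j, (Module.finBasis ℂ W).coord j x • f (lam W (Module.finBasis ℂ W j) t) =
      f (lam W x t) := by
  have h := congrArg (f ∘ₗ (lam W).ofConv.flip t) ((Module.finBasis ℂ W).sum_repr x)
  rw [map_sum] at h
  simp only [map_smul] at h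
  exact h

/-- The relation for a direct triangle with the edge on the right. -/
lemma starFace_braid (hS : ∀ x : W, S W (S W x) = x) {a : Dual ℂ W →ₗ[ℂ] A}
    (ha : ∀ φ ψ, a (dualMul φ ψ) = a φ * a ψ) (hχ : ∀ x y, ∑ i ∈ s, l i x * r i y = χ (x * y)) :
    ∑ i ∈ s, starFace a * (postMul (RibbonSpace W) A (a (l i)) *
        preComp _ A (coactDual W (r i))) =
      ∑ i ∈ s, preComp _ A (coactDual W (l i)) * postMul (RibbonSpace W) A (a (r i)) *
        starFace a := by
  refine LinearMap.ext fun Q => LinearMap.ext fun t => ?_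
  have key : ∑ i ∈ s, ∑ j, dualMul ((Module.finBasis ℂ W).coord j) (l i) ⊗ₜ[ℂ]
      coactDual W (r i) (lam W (Module.finBasis ℂ W j) t) =
      ∑ i ∈ s, ∑ j, dualMul (r i) ((Module.finBasis ℂ W).coord j) ⊗ₜ[ℂ]
      lam W (Module.finBasis ℂ W j) (coactDual W (l i) t) := by
    -- Evaluating the factor `Ŵ` at `x` collapses the dual-basis sums. What is left is
    -- `coact_exchange'` for the legs of `x`, with `χ` applied to the factor `W`.
    refine dualTensorHom_injective (LinearMap.ext fun x => ?_)
    let 𝓧 := ℛ ℂ x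
    have h1 : ∀ i, ∑ j, dualMul ((Module.finBasis ℂ W).coord j) (l i) x •
        coactDual W (r i) (lam W (Module.finBasis ℂ W j) t) =
        ∑ p ∈ 𝓧.index, l i (𝓧.right p) • coactDual W (r i) (lam W (𝓧.left p) t) := by
      intro i
      simp only [dualMul_apply _ _ 𝓧, Finset.sum_smul]
      rw [Finset.sum_comm]
      refine Finset.sum_congr rfl fun p _ => ?_
      simp only [mul_comm _ (l i _), mul_smul, ← Finset.smul_sum, sum_coord_smul_lam]
    have h2 : ∀ i, ∑ j, dualMul (r i) ((Module.finBasis ℂ W).coord j) x •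
        lam W (Module.finBasis ℂ W j) (coactDual W (l i) t) =
        ∑ p ∈ 𝓧.index, r i (𝓧.left p) • lam W (𝓧.right p) (coactDual W (l i) t) := by
      intro i
      simp only [dualMul_apply _ _ 𝓧, Finset.sum_smul]
      rw [Finset.sum_comm]
      refine Finset.sum_congr rfl fun p _ => ?_
      have := sum_coord_smul_lam (𝓧.right p) (coactDual W (l i) t) LinearMap.id
      simp only [LinearMap.id_apply] at this
      simp only [mul_smul, ← Finset.smul_sum, this]
    simp only [map_sum, LinearMap.sum_apply, dualTensorHom_apply, h1, h2]
    rw [Finset.sum_comm, Finset.sum_comm (s := s)]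
    have h3 := congrArg (fun z => TensorProduct.lid ℂ _ (χ.rTensor _ z))
      (LinearMap.congr_fun (coact_exchange' hS 𝓧) t)
    simp only [LinearMap.sum_apply, map_sum] at h3
    refine Eq.trans (Finset.sum_congr rfl fun p _ => ?_)
      (h3.symm.trans (Finset.sum_congr rfl fun p _ => ?_))
    · have := sum_left_coactDual hχ (𝓧.right p) LinearMap.id (lam W (𝓧.left p) t)
      simp only [LinearMap.id_apply, LinearMap.lTensor_id] at this
      exact this
    · rw [sum_right_coactDual hχ, (mulR_onSnd _ _ _).eq]
      rfl
  have key' := congrArg (fun z => LinearMap.mul' ℂ A (TensorProduct.map a Q z)) key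
  simp only [map_sum, TensorProduct.map_tmul, LinearMap.mul'_apply, ha, mul_assoc] at key'
  simpa only [LinearMap.sum_apply, Module.End.mul_apply, preComp_apply, postMul_apply,
    starFace_apply, Finset.mul_sum] using key'

/-- The relation for a direct triangle with the edge on the left. -/
lemma starFace_antipode_braid (hS : ∀ x : W, S W (S W x) = x) {a b : Dual ℂ W →ₗ[ℂ] A}
    (ha : ∀ φ ψ, a (dualMul φ ψ) = a φ * a ψ) (hb : ∀ φ, b φ = a (φ ∘ₗ S W))
    (hχ : ∀ x y, ∑ i ∈ s, l i x * r i y = χ (x * y)) :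
    ∑ i ∈ s, starFace b * (postMul (RibbonSpace W) A (a (r i)) *
        preComp _ A (coactDual W (l i))) =
      ∑ i ∈ s, preComp _ A (coactDual W (r i)) * postMul (RibbonSpace W) A (a (l i)) *
        starFace b := by
  refine LinearMap.ext fun Q => LinearMap.ext fun t => ?_
  have key : ∑ i ∈ s, ∑ j, dualMul ((Module.finBasis ℂ W).coord j ∘ₗ S W) (r i) ⊗ₜ[ℂ]
      coactDual W (l i) (lam W (Module.finBasis ℂ W j) t) =
      ∑ i ∈ s, ∑ j, dualMul (l i) ((Module.finBasis ℂ W).coord j ∘ₗ S W) ⊗ₜ[ℂ]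
      lam W (Module.finBasis ℂ W j) (coactDual W (r i) t) := by
    refine dualTensorHom_injective (LinearMap.ext fun x => ?_)
    -- As `S` is onto, the test element may be taken to be `S(y)`. Its coproduct then has the
    -- flipped legs `S(y⁽²⁾)`, `S(y⁽¹⁾)`, and the statement becomes `coact_exchange` at `y`.
    obtain ⟨y, rfl⟩ : ∃ y, x = S W y := ⟨S W x, (hS x).symm⟩
    let 𝓧 := ℛ ℂ y
    have h0 : ∀ φ ψ : Dual ℂ W, dualMul φ ψ (S W y) =
        ∑ p ∈ 𝓧.index, φ (S W (𝓧.right p)) * ψ (S W (𝓧.left p)) := by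
      intro φ ψ
      rw [dualMul, LinearMap.comp_apply, comul_antipode, ← 𝓧.eq]
      simp
    have h1 : ∀ i, ∑ j, dualMul ((Module.finBasis ℂ W).coord j ∘ₗ S W) (r i) (S W y) •
        coactDual W (l i) (lam W (Module.finBasis ℂ W j) t) =
        ∑ p ∈ 𝓧.index, r i (S W (𝓧.left p)) • coactDual W (l i) (lam W (𝓧.right p) t) := by
      intro i
      simp only [h0, Finset.sum_smul, LinearMap.comp_apply, hS]
      rw [Finset.sum_comm]
      refine Finset.sum_congr rfl fun p _ => ?_
      simp only [mul_comm _ (r i _), mul_smul, ← Finset.smul_sum, sum_coord_smul_lam]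
    have h2 : ∀ i, ∑ j, dualMul (l i) ((Module.finBasis ℂ W).coord j ∘ₗ S W) (S W y) •
        lam W (Module.finBasis ℂ W j) (coactDual W (r i) t) =
        ∑ p ∈ 𝓧.index, l i (S W (𝓧.right p)) • lam W (𝓧.left p) (coactDual W (r i) t) := by
      intro i
      simp only [h0, Finset.sum_smul, LinearMap.comp_apply, hS]
      rw [Finset.sum_comm]
      refine Finset.sum_congr rfl fun p _ => ?_
      have := sum_coord_smul_lam (𝓧.left p) (coactDual W (r i) t) LinearMap.id
      simp only [LinearMap.id_apply] at this
      simp only [mul_smul, ← Finset.smul_sum, this]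
    simp only [map_sum, LinearMap.sum_apply, dualTensorHom_apply, h1, h2]
    rw [Finset.sum_comm, Finset.sum_comm (s := s)]
    have h3 := congrArg (fun z => TensorProduct.lid ℂ _ (χ.rTensor _ z))
      (LinearMap.congr_fun (coact_exchange hS 𝓧) t)
    simp only [LinearMap.sum_apply, map_sum] at h3
    refine Eq.trans (Finset.sum_congr rfl fun p _ => ?_)
      (h3.symm.trans (Finset.sum_congr rfl fun p _ => ?_))
    · have := sum_right_coactDual hχ (S W (𝓧.left p)) LinearMap.id (lam W (𝓧.right p) t)
      simp only [LinearMap.id_apply, LinearMap.lTensor_id] at this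
      exact this
    · rw [sum_left_coactDual hχ]
      rfl
  have key' := congrArg (fun z => LinearMap.mul' ℂ A (TensorProduct.map a Q z)) key
  simp only [map_sum, TensorProduct.map_tmul, LinearMap.mul'_apply, ha, mul_assoc] at key'
  simpa only [LinearMap.sum_apply, Module.End.mul_apply, preComp_apply, postMul_apply,
    starFace_apply, Finset.mul_sum, hb] using key'

/-! ### Products with respect to the coproduct on `W ⊗ Ŵ` -/

lemma lid_rTensor_counit_comulFst (v : RibbonSpace W) :
    TensorProduct.lid ℂ _ ((ε W).rTensor _ (comulFst W v)) = v := by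
  induction v using TensorProduct.induction_on with
  | zero => simp
  | add x y hx hy => simp only [map_add, hx, hy]
  | tmul g ψ =>
    have e : ∀ z : W ⊗[ℂ] W, TensorProduct.lid ℂ _ ((ε W).rTensor _
        (TensorProduct.assoc ℂ W W (Dual ℂ W) (z ⊗ₜ ψ))) =
        TensorProduct.lid ℂ W ((ε W).rTensor W z) ⊗ₜ ψ := by
      intro z
      induction z using TensorProduct.induction_on with
      | zero => simp
      | add x y hx hy => simp only [map_add, hx, hy, add_tmul]
      | tmul a b => simp [smul_tmul']
    refine (e (Δ W g)).trans ?_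
    rw [rTensor_counit_comul]
    simp

/-- The functional `φ ↦ φ(1)` turns `Σ_k k̂(1) λ_k` into `λ_1`, which is the projection built into
the coaction. -/
lemma mul'_map_ribbonComul_of_vertex (hS : ∀ x : W, S W (S W x) = x) (K : W →ₗ[ℂ] A)
    (Q : RibbonSpace W →ₗ[ℂ] A) (t : RibbonSpace W) :
    LinearMap.mul' ℂ A (TensorProduct.map (K ∘ₗ (TensorProduct.rid ℂ W).toLinearMap ∘ₗ
      (Dual.eval ℂ W 1).lTensor W) Q (ribbonComul W t)) = starVertex K Q t := by
  have e : ∀ z : W ⊗[ℂ] RibbonSpace W, LinearMap.mul' ℂ A (TensorProduct.map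
      (K ∘ₗ (TensorProduct.rid ℂ W).toLinearMap ∘ₗ (Dual.eval ℂ W 1).lTensor W) Q
      (∑ i, TensorProduct.map ((TensorProduct.mk ℂ W (Dual ℂ W)).flip
      ((Module.finBasis ℂ W).coord i)) (lam W (Module.finBasis ℂ W i)) z)) =
      LinearMap.mul' ℂ A (TensorProduct.map K Q ((lam W 1).lTensor W z)) := by
    intro z
    induction z using TensorProduct.induction_on with
    | zero => simp
    | add x y hx hy => simp only [map_add, Finset.sum_add_distrib, hx, hy]
    | tmul h v =>
      have h1 := sum_coord_smul_lam 1 v LinearMap.id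
      simp only [LinearMap.id_apply] at h1
      simp only [LinearMap.lTensor_tmul, ← h1]
      simp [Finset.mul_sum]
  rw [ribbonComul_apply hS, e]
  rfl

/-- The counit on the factor `W` removes the first leg of `g`, so only the sum over dual bases is
left. -/
lemma mul'_map_ribbonComul_of_face (hS : ∀ x : W, S W (S W x) = x) (T : Dual ℂ W →ₗ[ℂ] A)
    (Q : RibbonSpace W →ₗ[ℂ] A) (t : RibbonSpace W) :
    LinearMap.mul' ℂ A (TensorProduct.map (T ∘ₗ (TensorProduct.lid ℂ (Dual ℂ W)).toLinearMap ∘ₗ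
      (ε W).rTensor (Dual ℂ W)) Q (ribbonComul W t)) = starFace T Q t := by
  have e : ∀ z : W ⊗[ℂ] RibbonSpace W, LinearMap.mul' ℂ A (TensorProduct.map
      (T ∘ₗ (TensorProduct.lid ℂ (Dual ℂ W)).toLinearMap ∘ₗ (ε W).rTensor (Dual ℂ W)) Q
      (∑ i, TensorProduct.map ((TensorProduct.mk ℂ W (Dual ℂ W)).flip
      ((Module.finBasis ℂ W).coord i)) (lam W (Module.finBasis ℂ W i)) z)) =
      starFace T Q (TensorProduct.lid ℂ _ ((ε W).rTensor _ z)) := by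
    intro z
    induction z using TensorProduct.induction_on with
    | zero => simp
    | add x y hx hy => simp only [map_add, Finset.sum_add_distrib, hx, hy]
    | tmul h v => simp [starFace_apply, Finset.smul_sum]
  rw [ribbonComul_apply hS, e, lid_rTensor_counit_comulFst]

lemma starVertex_lam_one (K : W →ₗ[ℂ] A) (Q : RibbonSpace W →ₗ[ℂ] A) (t : RibbonSpace W) :
    starVertex K Q (lam W 1 t) = starVertex K Q t := by
  rw [starVertex_apply, starVertex_apply]
  exact congrArg _ (congrArg _ (LinearMap.congr_fun coact_lam_one t))

lemma starFace_lam_one (T : Dual ℂ W →ₗ[ℂ] A) (Q : RibbonSpace W →ₗ[ℂ] A) (t : RibbonSpace W) :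
    starFace T Q (lam W 1 t) = starFace T Q t := by
  rw [starFace_apply, starFace_apply]
  refine Finset.sum_congr rfl fun i _ => ?_
  rw [← Module.End.mul_apply, lam_mul_one]

lemma starVertex_comp_lam_one (K : W →ₗ[ℂ] A) (Q : RibbonSpace W →ₗ[ℂ] A) :
    starVertex K (Q ∘ₗ lam W 1) = starVertex K Q := by
  refine LinearMap.ext fun t => ?_
  have e : (lam W 1).lTensor W (coact W t) = coact W t := by
    change (lam W 1).lTensor W ((lam W 1).lTensor W (comulFst W t)) =
      (lam W 1).lTensor W (comulFst W t)
    rw [← LinearMap.lTensor_comp_apply]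
    exact congrArg (fun f => LinearMap.lTensor W f (comulFst W t)) (lam_mul_one 1)
  rw [starVertex_apply, starVertex_apply]
  conv_rhs => rw [← e]
  rw [← LinearMap.comp_apply (TensorProduct.map K Q), LinearMap.map_comp_lTensor]

lemma starFace_comp_lam_one (T : Dual ℂ W →ₗ[ℂ] A) (Q : RibbonSpace W →ₗ[ℂ] A) :
    starFace T (Q ∘ₗ lam W 1) = starFace T Q := by
  refine LinearMap.ext fun t => ?_
  rw [starFace_apply, starFace_apply]
  refine Finset.sum_congr rfl fun i _ => ?_
  rw [LinearMap.comp_apply, ← Module.End.mul_apply, lam_one_mul]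

end FaceBraid

/-! ### Transport in convolution rings -/

section ConvTransport

variable {C B : Type*} [AddCommGroup C] [Module ℂ C] [Coalgebra ℂ C] [Ring B] [Algebra ℂ B]

/-- The only place where cocommutativity acts: at a cocommutative element, convolution factors with
commuting values can be interchanged. -/
lemma convMul_apply_comm {c : C} (hc : TensorProduct.comm ℂ C C (comul c) = comul c)
    (F G : WithConv (C →ₗ[ℂ] B)) (h : ∀ x y, Commute (F x) (G y)) : (F * G) c = (G * F) c := by
  have e : ∀ z : C ⊗[ℂ] C, LinearMap.mul' ℂ B (TensorProduct.map F.ofConv G.ofConv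
      (TensorProduct.comm ℂ C C z)) = LinearMap.mul' ℂ B (TensorProduct.map G.ofConv F.ofConv z) := by
    intro z
    induction z using TensorProduct.induction_on with
    | zero => simp
    | add x y hx hy => simp only [map_add, hx, hy]
    | tmul x y => simpa using (h y x).eq
  rw [LinearMap.convMul_apply, ← hc, e]
  rfl

lemma commute_convProd_apply {X : Type*} {α : X → C →ₗ[ℂ] B} {b : B} {c : List X}
    (h : ∀ y ∈ c, ∀ g, Commute b (α y g)) (g : C) :
    Commute b ((c.map fun y => toConv (α y)).prod g) := by
  induction c generalizing g with
  | nil =>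
    rw [List.map_nil, List.prod_nil, LinearMap.convOne_apply]
    exact (Algebra.commutes _ b).symm
  | cons x c ih =>
    rw [List.map_cons, List.prod_cons, (ℛ ℂ g).convMul_apply]
    exact Commute.sum_right _ _ _ fun i _ => (h x (by simp) _).mul_right
      (ih (fun y hy => h y (List.mem_cons_of_mem _ hy)) _)

/-- The list `c` runs once through the cycle of `s` under `σ`. -/
structure IsCycleList {X : Type*} (σ : Equiv.Perm X) (s : X) (c : List X) : Prop where
  chain : c.IsChain fun a b => σ a = b
  last : ∀ x ∈ c.getLast?, ∀ y ∈ c.head?, σ x = y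
  nodup : c.Nodup
  mem : ∀ y, y ∈ c ↔ σ.SameCycle s y

/-- `transport_circle` in the convolution ring: step operators are constants, and `α x` and `n`
become elements of the ring. Products of these elements distribute Sweedler legs automatically, so
the summed relations turn into the axioms of `StepRelations`. -/
theorem commute_stepProd {X : Type*} {σ : Equiv.Perm X} {rev : X → X}
    (hrev : Function.Injective rev) (hne : ∀ x, rev x ≠ x)
    {α : X → C →ₗ[ℂ] B} {n : C →ₗ[ℂ] B} {τ : Step X → B}
    (hαα : ∀ x y, x ≠ y → ∀ g h, Commute (α x g) (α y h))
    (hnα : ∀ x g h, Commute (n g) (α x h))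
    (turn_comm : ∀ x y, y ≠ x → ∀ h, Commute (τ (.turn x)) (α y h))
    (turn_braid : ∀ x h (s : Finset (C × C)) (l r : C × C → C), ∑ i ∈ s, l i ⊗ₜ[ℂ] r i = comul h →
      ∑ i ∈ s, τ (.turn x) * (α x (l i) * n (r i)) = ∑ i ∈ s, n (l i) * α x (r i) * τ (.turn x))
    (move_comm : ∀ x y, y ≠ x → y ≠ rev x → ∀ h, Commute (τ (.move x)) (α y h))
    (move_out : ∀ x h (s : Finset (C × C)) (l r : C × C → C), ∑ i ∈ s, l i ⊗ₜ[ℂ] r i = comul h →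
      τ (.move x) * α x h = ∑ i ∈ s, n (l i) * α x (r i) * τ (.move x))
    (move_in : ∀ x h (s : Finset (C × C)) (l r : C × C → C), ∑ i ∈ s, l i ⊗ₜ[ℂ] r i = comul h →
      ∑ i ∈ s, τ (.move x) * (α (rev x) (l i) * n (r i)) = α (rev x) h * τ (.move x))
    {c₀ : C} (hc₀ : TensorProduct.comm ℂ C C (comul c₀) = comul c₀)
    {s : X} {c : List X} (hc : IsCycleList σ s c)
    {p q : X} (hp : ¬ σ.SameCycle s p) (hq : ¬ σ.SameCycle s q) {l : List (Step X)}
    (hl : Step.Path σ rev p l q) (hd : l.Pairwise (Step.Apart rev)) :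
    Commute (l.map τ).prod ((c.map fun y => toConv (α y)).prod c₀) := by
  have R : StepRelations rev (fun x => toConv (α x)) (toConv n) (fun s => convConst C (τ s)) := by
    refine ⟨fun x y h => convConst_mul_comm _ _ (turn_comm x y h), fun x => ?_,
      fun x y h h' => convConst_mul_comm _ _ (move_comm x y h h'), fun x => ?_, fun x => ?_⟩
    · ext h
      rw [convConst_mul_apply, mul_convConst_apply, (ℛ ℂ h).convMul_apply, (ℛ ℂ h).convMul_apply,
        Finset.mul_sum, Finset.sum_mul]
      exact turn_braid x h _ _ _ (ℛ ℂ h).eq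
    · ext h
      rw [convConst_mul_apply, mul_convConst_apply, (ℛ ℂ h).convMul_apply, Finset.sum_mul]
      exact move_out x h _ _ _ (ℛ ℂ h).eq
    · ext h
      rw [convConst_mul_apply, mul_convConst_apply, (ℛ ℂ h).convMul_apply, Finset.mul_sum]
      exact move_in x h _ _ _ (ℛ ℂ h).eq
  -- Equality of values at `c₀` is preserved by multiplication with constants on both sides, though
  -- not by general ring elements; this is why `M` consists of constants.
  let M : Submonoid (WithConv (C →ₗ[ℂ] B)) :=
    { carrier := Set.range (convConst C)
      one_mem' := ⟨1, convConst_one⟩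
      mul_mem' := by
        rintro _ _ ⟨a, rfl⟩ ⟨b, rfl⟩
        exact ⟨a * b, (convConst_mul_convConst a b).symm⟩ }
  have key := R.transport_circle hrev hne (σ := σ)
    (r := fun Y Z : WithConv (C →ₗ[ℂ] B) => Y c₀ = Z c₀)
    ⟨fun _ => rfl, fun h => h.symm, fun h h' => h.trans h'⟩ (M := M) (fun s => ⟨τ s, rfl⟩)
    (by
      rintro _ ⟨a, rfl⟩ _ ⟨b, rfl⟩ Y Z h
      simp only [mul_convConst_apply, convConst_mul_apply, h])
    (fun c => convMul_apply_comm hc₀ _ _ fun x y =>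
      commute_convProd_apply (fun z _ g => hnα z x g) y)
    (fun c₁ c₂ h => by
      rw [List.map_append, List.map_append, List.prod_append, List.prod_append]
      refine convMul_apply_comm hc₀ _ _ fun x y => commute_convProd_apply (fun z hz g => ?_) y
      refine (commute_convProd_apply (fun w hw k => ?_) x).symm
      refine (hαα w z ?_ k g).symm
      rintro rfl
      exact (List.nodup_append.1 h).2.2 w hw w hz rfl)
    hc.chain hc.last hc.nodup
    (fun y => by rw [hc.mem, hc.mem, Equiv.Perm.sameCycle_apply_right])
    (fun h => hq ((hc.mem _).1 h)) l p hl hd (fun h => hp ((hc.mem _).1 h))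
  have e : (l.map fun s => convConst C (τ s)).prod = convConst C (l.map τ).prod := by
    clear key hl hd
    induction l with
    | nil => exact convConst_one.symm
    | cons s l ih => rw [List.map_cons, List.prod_cons, ih, convConst_mul_convConst]; rfl
  simp only [e, mul_convConst_apply, convConst_mul_apply] at key
  exact key

/-- The list has to be nonempty: the empty product of the convolution ring is its unit, while
`sweedlerProd` is `0` there. -/
lemma sweedlerProd_comul (l : List (C →ₗ[ℂ] B)) (hl : l ≠ []) (h : C) :
    sweedlerProd comul l h = (l.map toConv).prod h := by
  induction l generalizing h with
  | nil => exact absurd rfl hl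
  | cons f l ih =>
    cases l with
    | nil => simp [sweedlerProd]
    | cons g l =>
      have e : sweedlerProd comul (g :: l) = ((g :: l).map toConv).prod.ofConv :=
        LinearMap.ext (ih (by simp))
      rw [List.map_cons, List.prod_cons, sweedlerProd, e]
      rfl

lemma map_sweedlerProd {B' : Type*} [Ring B'] [Algebra ℂ B'] (δ : C →ₗ[ℂ] C ⊗[ℂ] C)
    (P : B →ₗ[ℂ] B') (hP : ∀ x y, P (x * y) = P x * P y) (l : List (C →ₗ[ℂ] B)) (h : C) :
    P (sweedlerProd δ l h) = sweedlerProd δ (l.map fun f => P ∘ₗ f) h := by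
  induction l generalizing h with
  | nil => simp [sweedlerProd]
  | cons f l ih =>
    cases l with
    | nil => simp [sweedlerProd]
    | cons g l =>
      have e : sweedlerProd δ ((P ∘ₗ g) :: l.map fun f => P ∘ₗ f) = P ∘ₗ sweedlerProd δ (g :: l) :=
        LinearMap.ext fun h => (ih h).symm
      simp only [List.map_cons, sweedlerProd, LinearMap.comp_apply, e]
      generalize δ h = z
      induction z using TensorProduct.induction_on with
      | zero => simp
      | add x y hx hy => simp only [map_add, hx, hy]
      | tmul x y => simp [hP]

end ConvTransport

/-! ### The co-opposite coalgebra -/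

section Cop

/-- The co-opposite of a coalgebra. -/
def Cop (C : Type*) := C

variable {C B : Type*} [AddCommGroup C] [Module ℂ C] [Ring B] [Algebra ℂ B]

instance : AddCommGroup (Cop C) := inferInstanceAs (AddCommGroup C)
instance : Module ℂ (Cop C) := inferInstanceAs (Module ℂ C)

variable (C) in
/-- The identity map from the co-opposite coalgebra. -/
def ofCop : Cop C ≃ₗ[ℂ] C := LinearEquiv.refl ℂ C

variable [Coalgebra ℂ C]

instance : CoalgebraStruct ℂ (Cop C) where
  comul := (TensorProduct.comm ℂ C C).toLinearMap ∘ₗ comul (R := ℂ) (A := C)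
  counit := counit (R := ℂ) (A := C)

lemma comul_cop (h : Cop C) :
    comul (R := ℂ) h = TensorProduct.comm ℂ C C (comul (R := ℂ) (ofCop C h)) := rfl

/-- The opposite of a coassociative coproduct is coassociative. -/
lemma assoc_comm_comm {M : Type*} [AddCommGroup M] [Module ℂ M] (δ : M →ₗ[ℂ] M ⊗[ℂ] M)
    (hδ : TensorProduct.assoc ℂ M M M ∘ₗ δ.rTensor M ∘ₗ δ = δ.lTensor M ∘ₗ δ) :
    TensorProduct.assoc ℂ M M M ∘ₗ ((TensorProduct.comm ℂ M M).toLinearMap ∘ₗ δ).rTensor M ∘ₗ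
      ((TensorProduct.comm ℂ M M).toLinearMap ∘ₗ δ) =
    ((TensorProduct.comm ℂ M M).toLinearMap ∘ₗ δ).lTensor M ∘ₗ
      ((TensorProduct.comm ℂ M M).toLinearMap ∘ₗ δ) := by
  -- `σ` reverses the order of three tensor factors; it takes each side of coassociativity for `δ`
  -- to the other side for the opposite coproduct.
  let σ : M ⊗[ℂ] (M ⊗[ℂ] M) →ₗ[ℂ] M ⊗[ℂ] (M ⊗[ℂ] M) :=
    TensorProduct.assoc ℂ M M M ∘ₗ (TensorProduct.comm ℂ M M).toLinearMap.rTensor M ∘ₗ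
      (TensorProduct.comm ℂ M (M ⊗[ℂ] M)).toLinearMap
  have h1 : ∀ z : M ⊗[ℂ] M, TensorProduct.assoc ℂ M M M
      (((TensorProduct.comm ℂ M M).toLinearMap ∘ₗ δ).rTensor M (TensorProduct.comm ℂ M M z)) =
      σ (δ.lTensor M z) := by
    intro z
    induction z using TensorProduct.induction_on with
    | zero => simp
    | add x y hx hy => simp only [map_add, hx, hy]
    | tmul a b => simp [σ]
  have h2 : ∀ z : M ⊗[ℂ] M, ((TensorProduct.comm ℂ M M).toLinearMap ∘ₗ δ).lTensor M
      (TensorProduct.comm ℂ M M z) = σ (TensorProduct.assoc ℂ M M M (δ.rTensor M z)) := by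
    intro z
    induction z using TensorProduct.induction_on with
    | zero => simp
    | add x y hx hy => simp only [map_add, hx, hy]
    | tmul a b =>
      simp only [TensorProduct.comm_tmul, LinearMap.lTensor_tmul, LinearMap.rTensor_tmul,
        LinearMap.comp_apply, LinearEquiv.coe_coe]
      generalize δ a = w
      induction w using TensorProduct.induction_on with
      | zero => simp
      | add x y hx hy => simp only [map_add, hx, hy, add_tmul, tmul_add]
      | tmul c d => simp [σ]
  refine LinearMap.ext fun x => (h1 (δ x)).trans (Eq.trans ?_ (h2 (δ x)).symm)
  exact congrArg σ (LinearMap.congr_fun hδ x).symm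

instance : Coalgebra ℂ (Cop C) where
  coassoc := assoc_comm_comm (M := C) comul Coalgebra.coassoc
  rTensor_counit_comp_comul := by
    have e : ∀ z : C ⊗[ℂ] C, (counit (R := ℂ) (A := C)).rTensor C (TensorProduct.comm ℂ C C z) =
        TensorProduct.comm ℂ C ℂ ((counit (R := ℂ) (A := C)).lTensor C z) := fun z =>
      LinearMap.congr_fun (LinearMap.rTensor_comp_comm ..) z
    refine LinearMap.ext fun x => (e (comul (R := ℂ) (ofCop C x))).trans ?_
    rw [lTensor_counit_comul]
    rfl
  lTensor_counit_comp_comul := by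
    have e : ∀ z : C ⊗[ℂ] C, (counit (R := ℂ) (A := C)).lTensor C (TensorProduct.comm ℂ C C z) =
        TensorProduct.comm ℂ ℂ C ((counit (R := ℂ) (A := C)).rTensor C z) := fun z =>
      LinearMap.congr_fun (LinearMap.lTensor_comp_comm ..) z
    refine LinearMap.ext fun x => (e (comul (R := ℂ) (ofCop C x))).trans ?_
    rw [rTensor_counit_comul]
    rfl

lemma comm_comul_cop {h : C} (hc : TensorProduct.comm ℂ C C (comul h) = comul h) :
    TensorProduct.comm ℂ (Cop C) (Cop C) (comul ((ofCop C).symm h)) =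
      comul ((ofCop C).symm h) :=
  congrArg (TensorProduct.comm ℂ C C) hc

/-- Reversing both the factors and the legs leaves every factor with its own leg; only the order of
multiplication changes, and operators at distinct elements commute. -/
lemma convProd_reverse_cop {X : Type*} {α : X → C →ₗ[ℂ] B} {c : List X} (hc : c.Nodup)
    (hα : ∀ x y, x ≠ y → ∀ g h, Commute (α x g) (α y h)) (h : C) :
    (c.reverse.map fun y => toConv (α y ∘ₗ (ofCop C).toLinearMap)).prod ((ofCop C).symm h) =
      (c.map fun y => toConv (α y)).prod h := by
  induction c generalizing h with
  | nil => rfl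
  | cons x c ih =>
    obtain ⟨hx, hc⟩ := List.nodup_cons.1 hc
    rw [List.reverse_cons, List.map_append, List.prod_append, List.map_singleton,
      List.prod_singleton, List.map_cons, List.prod_cons]
    have hcomm : ∀ g k, Commute (α x g) ((c.map fun y => toConv (α y)).prod k) := fun g k =>
      commute_convProd_apply (fun y hy m => hα x y (fun e => hx (e ▸ hy)) g m) k
    generalize (c.reverse.map fun y => toConv (α y ∘ₗ (ofCop C).toLinearMap)).prod = P at ih ⊢
    generalize (c.map fun y => toConv (α y)).prod = Q at ih hcomm ⊢
    have e : ∀ z : C ⊗[ℂ] C, LinearMap.mul' ℂ B (TensorProduct.map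
        (P.ofConv ∘ₗ (ofCop C).symm.toLinearMap) (α x) (TensorProduct.comm ℂ C C z)) =
        LinearMap.mul' ℂ B (TensorProduct.map (α x) Q.ofConv z) := by
      intro z
      induction z using TensorProduct.induction_on with
      | zero => simp
      | add x y hx hy => simp only [map_add, hx, hy]
      | tmul g k => simpa [ih hc] using (hcomm g k).eq.symm
    exact e (comul h)

end Cop

/-! ### The coalgebra `Ŵ` -/

section DualCoalgebra

variable {W : Type*} [Ring W] [Algebra ℂ W] [WeakHopfAlgebra W] [FiniteDimensional ℂ W]

lemma dualDistrib_injective {M N : Type*} [AddCommGroup M] [Module ℂ M] [FiniteDimensional ℂ M]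
    [AddCommGroup N] [Module ℂ N] [FiniteDimensional ℂ N] :
    Function.Injective (TensorProduct.dualDistrib ℂ M N) :=
  (TensorProduct.dualDistribEquiv ℂ M N).injective

lemma sum_dualComul {ι : Type*} {s : Finset ι} {χ : Dual ℂ W} {l r : ι → Dual ℂ W}
    (h : ∑ i ∈ s, l i ⊗ₜ[ℂ] r i = dualComul W χ) (x y : W) :
    ∑ i ∈ s, l i x * r i y = χ (x * y) := by
  have := LinearMap.congr_fun (dualDistrib_dualComul χ) (x ⊗ₜ y)
  rw [← h] at this
  simpa using this

lemma dualComul_coassoc :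
    TensorProduct.assoc ℂ (Dual ℂ W) (Dual ℂ W) (Dual ℂ W) ∘ₗ (dualComul W).rTensor (Dual ℂ W) ∘ₗ
      dualComul W = (dualComul W).lTensor (Dual ℂ W) ∘ₗ dualComul W := by
  -- `Φ` embeds the triple tensor product of `Ŵ` into the dual of that of `W`, where both sides of
  -- coassociativity become `χ(xyz)`.
  let Φ := TensorProduct.dualDistrib ℂ W (W ⊗[ℂ] W) ∘ₗ
    (TensorProduct.dualDistrib ℂ W W).lTensor (Dual ℂ W)
  have hΦ : Function.Injective Φ := dualDistrib_injective.comp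
    ((TensorProduct.dualDistribEquiv ℂ W W).lTensor (Dual ℂ W)).injective
  have h1 : ∀ (u : Dual ℂ W ⊗[ℂ] Dual ℂ W) (b : Dual ℂ W) (x y z : W),
      Φ (TensorProduct.assoc ℂ _ _ _ (u ⊗ₜ b)) (x ⊗ₜ (y ⊗ₜ z)) =
      TensorProduct.dualDistrib ℂ W W u (x ⊗ₜ y) * b z := by
    intro u b x y z
    induction u using TensorProduct.induction_on with
    | zero => simp
    | add u v hu hv => simp only [add_tmul, map_add, hu, hv, LinearMap.add_apply, add_mul]
    | tmul c d => simp [Φ, mul_assoc]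
  have h2 : ∀ (u : Dual ℂ W ⊗[ℂ] Dual ℂ W) (x y z : W),
      Φ (TensorProduct.assoc ℂ _ _ _ ((dualComul W).rTensor _ u)) (x ⊗ₜ (y ⊗ₜ z)) =
      TensorProduct.dualDistrib ℂ W W u ((x * y) ⊗ₜ z) := by
    intro u x y z
    induction u using TensorProduct.induction_on with
    | zero => simp
    | add u v hu hv => simp only [map_add, hu, hv, LinearMap.add_apply]
    | tmul c d =>
      rw [LinearMap.rTensor_tmul, h1, dualDistrib_dualComul]
      simp
  have h3 : ∀ (u : Dual ℂ W ⊗[ℂ] Dual ℂ W) (x y z : W),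
      Φ ((dualComul W).lTensor _ u) (x ⊗ₜ (y ⊗ₜ z)) =
      TensorProduct.dualDistrib ℂ W W u (x ⊗ₜ (y * z)) := by
    intro u x y z
    induction u using TensorProduct.induction_on with
    | zero => simp
    | add u v hu hv => simp only [map_add, hu, hv, LinearMap.add_apply]
    | tmul c d => simp [Φ, dualDistrib_dualComul]
  refine LinearMap.ext fun χ => hΦ (TensorProduct.ext_threefold' ?_)
  intro x y z
  refine (h2 _ x y z).trans (Eq.trans ?_ (h3 _ x y z).symm)
  simp [dualDistrib_dualComul, mul_assoc]

variable (W) in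
/-- The dual of `W` as a coalgebra. -/
@[reducible] def dualCoalgebra : Coalgebra ℂ (Dual ℂ W) where
  comul := dualComul W
  counit := Dual.eval ℂ W 1
  coassoc := dualComul_coassoc
  rTensor_counit_comp_comul := by
    have e : ∀ (u : Dual ℂ W ⊗[ℂ] Dual ℂ W) (x : W),
        TensorProduct.lid ℂ _ ((Dual.eval ℂ W 1).rTensor _ u) x =
        TensorProduct.dualDistrib ℂ W W u (1 ⊗ₜ x) := by
      intro u x
      induction u using TensorProduct.induction_on with
      | zero => simp
      | add u v hu hv => simp only [map_add, hu, hv, LinearMap.add_apply]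
      | tmul c d => simp
    refine LinearMap.ext fun χ => (TensorProduct.lid ℂ _).injective (LinearMap.ext fun x => ?_)
    refine (e _ x).trans ?_
    rw [dualDistrib_dualComul]
    simp
  lTensor_counit_comp_comul := by
    have e : ∀ (u : Dual ℂ W ⊗[ℂ] Dual ℂ W) (x : W),
        TensorProduct.rid ℂ _ ((Dual.eval ℂ W 1).lTensor _ u) x =
        TensorProduct.dualDistrib ℂ W W u (x ⊗ₜ 1) := by
      intro u x
      induction u using TensorProduct.induction_on with
      | zero => simp
      | add u v hu hv => simp only [map_add, hu, hv, LinearMap.add_apply]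
      | tmul c d => simp [mul_comm]
    refine LinearMap.ext fun χ => (TensorProduct.rid ℂ _).injective (LinearMap.ext fun x => ?_)
    refine (e _ x).trans ?_
    rw [dualDistrib_dualComul]
    simp

end DualCoalgebra

/-! ### Operators on edges -/

section Edges

variable {W : Type*} [Ring W] [Algebra ℂ W] [WeakHopfAlgebra W] {E : Type*} [DecidableEq E]

lemma onEdge_apply (e : E) (f : Module.End ℂ W) :
    onEdge W e f = PiTensorProduct.map (Function.update (fun _ => LinearMap.id) e f) := rfl

lemma onEdge_mul (e : E) (f g : Module.End ℂ W) :
    onEdge W e (f * g) = onEdge W e f * onEdge W e g := by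
  rw [onEdge_apply, onEdge_apply, onEdge_apply, ← PiTensorProduct.map_mul]
  congr 1
  funext i
  rcases eq_or_ne i e with rfl | h
  · simp
  · simp [h]; rfl

lemma onEdge_commute {e e' : E} (h : e ≠ e') (f g : Module.End ℂ W) :
    Commute (onEdge W e f) (onEdge W e' g) := by
  rw [commute_iff_eq, onEdge_apply, onEdge_apply, ← PiTensorProduct.map_mul,
    ← PiTensorProduct.map_mul]
  congr 1
  funext i
  rcases eq_or_ne i e with rfl | h1
  · simp [h]; rfl
  · simp [h1]; rfl

lemma onEdge_commute_of_commute (e : E) {f g : Module.End ℂ W} (h : Commute f g) :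
    Commute (onEdge W e f) (onEdge W e g) := by
  rw [commute_iff_eq, ← onEdge_mul, h.eq, onEdge_mul]

lemma vertexAct_apply (d : Dart E) (h : W) : vertexAct W d h = onEdge W d.1 (vOp W d.2 h) := rfl

lemma faceAct_apply (d : Dart E) (φ : Dual ℂ W) :
    faceAct W d φ = onEdge W d.1 (fOp W d.2 φ) := rfl

lemma vertexAct_mul (hS : ∀ x : W, S W (S W x) = x) (d : Dart E) (g h : W) :
    vertexAct W d (g * h) = vertexAct W d g * vertexAct W d h := by
  simp only [vertexAct_apply, vOp_mul hS, onEdge_mul]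

lemma faceAct_mul [FiniteDimensional ℂ W] (hS : ∀ x : W, S W (S W x) = x) (d : Dart E)
    (φ χ : Dual ℂ W) :
    faceAct W d (dualMul φ χ) = faceAct W d φ * faceAct W d χ := by
  simp only [faceAct_apply, fOp_mul hS, onEdge_mul]

lemma Dart.rev_mk (e : E) (b : Bool) : Dart.rev (e, b) = (e, !b) := rfl

lemma Dart.rev_rev (d : Dart E) : Dart.rev (Dart.rev d) = d := by
  rw [← Prod.mk.eta (p := d), Dart.rev_mk, Dart.rev_mk, Bool.not_not]

lemma Dart.rev_ne (d : Dart E) : Dart.rev d ≠ d := by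
  obtain ⟨e, b⟩ := d
  simp [Dart.rev_mk]

lemma Dart.fst_ne {d d' : Dart E} (h : d ≠ d') (h' : d ≠ Dart.rev d') : d.1 ≠ d'.1 := by
  obtain ⟨e, b⟩ := d
  obtain ⟨e', b'⟩ := d'
  rintro rfl
  cases b <;> cases b' <;> simp_all [Dart.rev_mk]

/-- Distinct ends may still be the two ends of one edge; there the actions are a left and a right
multiplication. -/
lemma vertexAct_commute (hS : ∀ x : W, S W (S W x) = x) {d d' : Dart E} (h : d ≠ d') (x y : W) :
    Commute (vertexAct W d x) (vertexAct W d' y) := by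
  by_cases h' : d = Dart.rev d'
  · subst h'
    exact onEdge_commute_of_commute _ (vOp_commute hS d'.2 y x).symm
  · exact onEdge_commute (Dart.fst_ne h h') _ _

lemma faceAct_commute {d d' : Dart E} (h : d ≠ d') (φ χ : Dual ℂ W) :
    Commute (faceAct W d φ) (faceAct W d' χ) := by
  by_cases h' : d = Dart.rev d'
  · subst h'
    exact onEdge_commute_of_commute _ (fOp_commute d'.2 χ φ).symm
  · exact onEdge_commute (Dart.fst_ne h h') _ _

end Edges

/-! ### Ribbon operators as products of star operators -/

section RibbonProducts

variable {W : Type*} [Ring W] [Algebra ℂ W] [WeakHopfAlgebra W] [FiniteDimensional ℂ W]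
variable {E : Type*} [DecidableEq E]

variable (W) in
/-- The operator `Q ↦ F(τ) ⋆ Q` of a triangle. -/
def starOp : Triangle E → Module.End ℂ (RibbonSpace W →ₗ[ℂ] Module.End ℂ (TotalSpace W E))
  | .directR d => starFace (faceAct W d)
  | .directL d => starFace (onEdge W d.1 ∘ₗ fOp' W d.2)
  | .dualR d => starVertex (vertexAct W d)
  | .dualL d => starVertex (onEdge W d.1 ∘ₗ vOp' W d.2)

lemma mul'_map_triangleOp (hS : ∀ x : W, S W (S W x) = x) (τ : Triangle E)
    (Q : RibbonSpace W →ₗ[ℂ] Module.End ℂ (TotalSpace W E)) (t : RibbonSpace W) :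
    LinearMap.mul' ℂ _ (TensorProduct.map (triangleOp W τ) Q (ribbonComul W t)) =
      starOp W τ Q t := by
  rcases τ with ⟨e, b⟩ | ⟨e, b⟩ | ⟨e, b⟩ | ⟨e, b⟩ <;> cases b
  · exact mul'_map_ribbonComul_of_face hS (onEdge W e ∘ₗ Tminus W) Q t
  · exact mul'_map_ribbonComul_of_face hS (onEdge W e ∘ₗ Tplus W) Q t
  · exact mul'_map_ribbonComul_of_face hS (onEdge W e ∘ₗ tTminus W) Q t
  · exact mul'_map_ribbonComul_of_face hS (onEdge W e ∘ₗ tTplus W) Q t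
  · exact mul'_map_ribbonComul_of_vertex hS (onEdge W e ∘ₗ Lminus W) Q t
  · exact mul'_map_ribbonComul_of_vertex hS (onEdge W e ∘ₗ Lplus W) Q t
  · exact mul'_map_ribbonComul_of_vertex hS (onEdge W e ∘ₗ tLminus W) Q t
  · exact mul'_map_ribbonComul_of_vertex hS (onEdge W e ∘ₗ tLplus W) Q t

lemma starOp_lam_one (τ : Triangle E)
    (Q : RibbonSpace W →ₗ[ℂ] Module.End ℂ (TotalSpace W E)) (t : RibbonSpace W) :
    starOp W τ Q (lam W 1 t) = starOp W τ Q t := by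
  cases τ
  · exact starFace_lam_one _ Q t
  · exact starFace_lam_one _ Q t
  · exact starVertex_lam_one _ Q t
  · exact starVertex_lam_one _ Q t

lemma starOp_comp_lam_one (τ : Triangle E)
    (Q : RibbonSpace W →ₗ[ℂ] Module.End ℂ (TotalSpace W E)) :
    starOp W τ (Q ∘ₗ lam W 1) = starOp W τ Q := by
  cases τ
  · exact starFace_comp_lam_one _ Q
  · exact starFace_comp_lam_one _ Q
  · exact starVertex_comp_lam_one _ Q
  · exact starVertex_comp_lam_one _ Q

/-- The unit of the `⋆` product. -/
def starUnit (W A : Type*) [Ring W] [Algebra ℂ W] [WeakHopfAlgebra W] [Ring A] [Algebra ℂ A] :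
    RibbonSpace W →ₗ[ℂ] A :=
  LinearMap.toSpanSingleton ℂ A 1 ∘ₗ ribbonCounit W

/-- `starUnit` is a right unit only up to `lam 1`, because the counit law for the ribbon coproduct
holds only up to this idempotent. -/
lemma starOp_starUnit (hS : ∀ x : W, S W (S W x) = x) (τ : Triangle E) :
    starOp W τ (starUnit W _) = triangleOp W τ ∘ₗ lam W 1 := by
  refine LinearMap.ext fun t => ?_
  have e : ∀ z : RibbonSpace W ⊗[ℂ] RibbonSpace W, LinearMap.mul' ℂ (Module.End ℂ (TotalSpace W E))
      (TensorProduct.map (triangleOp W τ) (starUnit W _) z) =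
      triangleOp W τ (TensorProduct.rid ℂ _ ((ribbonCounit W).lTensor _ z)) := by
    intro z
    induction z using TensorProduct.induction_on with
    | zero => simp
    | add x y hx hy => simp only [map_add, hx, hy]
    | tmul x y => simp [starUnit]
  rw [← mul'_map_triangleOp hS, e, rid_lTensor_ribbonCounit hS]
  rfl

/-- The projection left over by the induction hypothesis is swallowed by the next star operator, and
a new one may be inserted in front of the label for free. -/
lemma prod_starOp_starUnit (hS : ∀ x : W, S W (S W x) = x) (l : List (Triangle E)) (hl : l ≠ []) :
    (l.map (starOp W)).prod (starUnit W _) =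
      sweedlerProd (ribbonComul W) (l.map (triangleOp W)) ∘ₗ lam W 1 := by
  induction l with
  | nil => exact absurd rfl hl
  | cons τ l ih =>
    cases l with
    | nil => simpa [sweedlerProd] using starOp_starUnit hS τ
    | cons τ' l =>
      rw [List.map_cons, List.prod_cons, Module.End.mul_apply, ih (by simp), starOp_comp_lam_one]
      refine LinearMap.ext fun t => ?_
      rw [← starOp_lam_one, ← mul'_map_triangleOp hS]
      rfl

variable (W) in
/-- Right multiplication of operator-valued maps. -/
def mulRightMap {A : Type*} [Ring A] [Algebra ℂ A] (x : A) :
    Module.End ℂ (RibbonSpace W →ₗ[ℂ] A) :=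
  LinearMap.llcomp ℂ (RibbonSpace W) A A (LinearMap.mulRight ℂ x)

lemma mulRightMap_apply {A : Type*} [Ring A] [Algebra ℂ A] (x : A) (Q : RibbonSpace W →ₗ[ℂ] A)
    (t : RibbonSpace W) : mulRightMap W x Q t = Q t * x := rfl

lemma starOp_commute_mulRightMap (hS : ∀ x : W, S W (S W x) = x) (τ : Triangle E)
    (x : Module.End ℂ (TotalSpace W E)) : Commute (starOp W τ) (mulRightMap W x) := by
  refine LinearMap.ext fun Q => LinearMap.ext fun t => ?_
  rw [Module.End.mul_apply, Module.End.mul_apply, mulRightMap_apply, ← mul'_map_triangleOp hS,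
    ← mul'_map_triangleOp hS]
  generalize ribbonComul W t = z
  induction z using TensorProduct.induction_on with
  | zero => simp
  | add x y hx hy => simp only [map_add, hx, hy, add_mul]
  | tmul g v => simp [mulRightMap_apply, mul_assoc]

/-- With `T` the product of star operators and `u` the scalar-valued unit, `x · T(u) = T(xu) = T(ux)
= T(u) · x`. Membership of `t` in `D(W)^∨` makes `T(u)(t)` equal to the ribbon operator. -/
lemma commute_ribbonOp (hS : ∀ x : W, S W (S W x) = x) {L : Cellulation E} (ρ : Ribbon L)
    {t : RibbonSpace W} (ht : t ∈ doubleDual W) {x : Module.End ℂ (TotalSpace W E)}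
    (h : Commute (ρ.triangles.map (starOp W)).prod (postMul (RibbonSpace W) _ x)) :
    x * ribbonOp ρ t = ribbonOp ρ t * x := by
  have h1 : ribbonOp ρ t = (ρ.triangles.map (starOp W)).prod (starUnit W _) t := by
    rw [prod_starOp_starUnit hS _ ρ.ne_nil, LinearMap.comp_apply, lam_one_of_mem hS ht]
    rfl
  have h2 : Commute (ρ.triangles.map (starOp W)).prod (mulRightMap W x) := by
    refine Commute.list_prod_left _ _ fun g hg => ?_
    obtain ⟨τ, -, rfl⟩ := List.mem_map.1 hg
    exact starOp_commute_mulRightMap hS τ x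
  have h3 : postMul (RibbonSpace W) _ x (starUnit W _) = mulRightMap W x (starUnit W _) := by
    refine LinearMap.ext fun t => ?_
    simp [mulRightMap_apply, starUnit]
  rw [h1]
  generalize (ρ.triangles.map (starOp W)).prod = T at *
  have e1 := LinearMap.congr_fun (LinearMap.congr_fun h.eq (starUnit W _)) t
  have e2 := LinearMap.congr_fun (LinearMap.congr_fun h2.eq (starUnit W _)) t
  rw [Module.End.mul_apply, Module.End.mul_apply] at e1 e2
  rw [h3] at e1
  exact e1.symm.trans e2

end RibbonProducts

/-! ### Cycles of permutations and paths of ribbons -/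

section Cycles

lemma isCycleList_range {X : Type*} [Finite X] (σ : Equiv.Perm X) (s : X) (k : ℕ) :
    IsCycleList σ s ((List.range (Function.minimalPeriod σ s)).map fun i => (σ ^ (i + k)) s) := by
  have hpos : 0 < Function.minimalPeriod σ s := Function.minimalPeriod_pos_of_mem_periodicPts
    (Function.Injective.mem_periodicPts σ.injective s)
  have hper : (σ ^ Function.minimalPeriod σ s) s = s := by
    rw [← Equiv.Perm.iterate_eq_pow]
    exact Function.iterate_minimalPeriod
  generalize hn : Function.minimalPeriod σ s = n at hpos hper ⊢
  refine ⟨?_, ?_, ?_, ?_⟩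
  · rw [List.isChain_iff_getElem]
    intro i hi
    simp [add_right_comm i 1 k, pow_succ']
  · obtain ⟨m, rfl⟩ : ∃ m, n = m + 1 := ⟨n - 1, by omega⟩
    intro x hx y hy
    rw [List.range_succ, List.map_append] at hx
    rw [List.range_succ_eq_map] at hy
    simp only [List.map_cons, List.map_nil, List.getLast?_append, List.getLast?_singleton,
      Option.some_or, Option.mem_def, Option.some.injEq, List.head?_cons, zero_add] at hx hy
    rw [← hx, ← hy, ← Equiv.Perm.mul_apply, ← pow_succ', add_right_comm, add_comm _ k, pow_add,
      Equiv.Perm.mul_apply, hper]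
  · refine List.Nodup.map_on (fun i hi j hj h => ?_) List.nodup_range
    rw [add_comm i, add_comm j, pow_add, pow_add, Equiv.Perm.mul_apply, Equiv.Perm.mul_apply,
      (σ ^ k).injective.eq_iff, ← Equiv.Perm.iterate_eq_pow, ← Equiv.Perm.iterate_eq_pow] at h
    refine Function.iterate_injOn_Iio_minimalPeriod (f := σ) (x := s) ?_ ?_ h
    · simpa [hn] using hi
    · simpa [hn] using hj
  · intro y
    rw [List.mem_map]
    constructor
    · rintro ⟨i, -, rfl⟩
      exact ⟨((i + k : ℕ) : ℤ), by rw [zpow_natCast]⟩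
    · rintro ⟨z, rfl⟩
      have hn0 : (n : ℤ) ≠ 0 := by exact_mod_cast hpos.ne'
      -- An element `σ^z s` of the cycle appears at the position `(z - k) mod n`, since the list
      -- starts at `σ^k s` and `n` is the period.
      obtain ⟨i, hi⟩ := Int.eq_ofNat_of_zero_le (Int.emod_nonneg (z - k) hn0)
      refine ⟨i, ?_, ?_⟩
      · have := Int.emod_lt_of_pos (z - k) (b := (n : ℤ)) (by exact_mod_cast hpos)
        rw [List.mem_range]
        omega
      · have hz : z = ((i + k : ℕ) : ℤ) + n * ((z - k) / n) := by
          have := Int.emod_add_mul_ediv (z - k) n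
          push_cast
          omega
        rw [hz, zpow_add, Equiv.Perm.mul_apply, zpow_natCast, zpow_mul, zpow_natCast,
          Equiv.Perm.zpow_apply_eq_self_of_apply_eq_self hper]

lemma IsCycleList.reverse {X : Type*} {σ : Equiv.Perm X} {s : X} {c : List X}
    (h : IsCycleList σ s c) : IsCycleList σ⁻¹ s c.reverse := by
  refine ⟨?_, ?_, ?_, ?_⟩
  · rw [List.isChain_reverse]
    exact h.chain.imp fun a b e => by simp [← e]
  · intro x hx y hy
    rw [List.getLast?_reverse] at hx
    rw [List.head?_reverse] at hy
    rw [← h.last y hy x hx]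
    simp
  · exact List.nodup_reverse.2 h.nodup
  · intro y
    rw [List.mem_reverse, h.mem, Equiv.Perm.sameCycle_inv]

variable {E : Type*} {L : Cellulation E}

lemma isCycleList_star [Finite E] (s : Site E) : IsCycleList L.rot s (L.star s) :=
  isCycleList_range L.rot s 1

lemma isCycleList_boundary [Finite E] (s : Site E) : IsCycleList L.next s (L.boundary s) :=
  isCycleList_range L.next s 0

lemma IsCycleList.ne_nil {X : Type*} {σ : Equiv.Perm X} {s : X} {c : List X}
    (h : IsCycleList σ s c) : c ≠ [] := by
  rintro rfl
  simpa using (h.mem s).2 (Equiv.Perm.SameCycle.refl _ _)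

/-- A site is a gap of the circle; `label` names it by the element which follows it in the direction
`σ`. With a suitable dictionary `tri`, consecutive triangles become a path and disjoint regions
become steps that are apart. -/
lemma exists_path (ρ : Ribbon L) {σ label : Equiv.Perm (Dart E)} {tri : Step (Dart E) → Triangle E}
    (hsrc : ∀ s, label ((tri s).source L) = s.src)
    (htgt : ∀ s, label ((tri s).target L) = s.tgt σ Dart.rev)
    (hapart : ∀ s s', Disjoint (tri s).region (tri s').region → s.Apart Dart.rev s')
    (hsurj : ∀ τ : Triangle E, τ.HasType ρ.type → ∃ s, tri s = τ) :
    ∃ l : List (Step (Dart E)), l.map tri = ρ.triangles ∧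
      Step.Path σ Dart.rev (label ρ.initialSite) l (label ρ.finalSite) ∧
      l.Pairwise (Step.Apart Dart.rev) := by
  obtain ⟨type, T, ne_nil, hcons, htype, hover⟩ := ρ
  simp only [Ribbon.initialSite, Ribbon.finalSite] at *
  obtain ⟨l, rfl⟩ : ∃ l : List (Step (Dart E)), l.map tri = T := by
    clear ne_nil hcons hover
    induction T with
    | nil => exact ⟨[], rfl⟩
    | cons τ T ih =>
      obtain ⟨l, rfl⟩ := ih fun τ h => htype τ (List.mem_cons_of_mem _ h)
      obtain ⟨s, rfl⟩ := hsurj τ (htype τ (by simp))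
      exact ⟨s :: l, rfl⟩
  refine ⟨l, rfl, ?_, (List.pairwise_map.1 hover).imp (hapart _ _)⟩
  have path : ∀ (l : List (Step (Dart E))) (h : l.map tri ≠ []),
      (l.map tri).IsChain (fun τ τ' => τ.target L = τ'.source L) →
      Step.Path σ Dart.rev (label (((l.map tri).head h).source L)) l
        (label (((l.map tri).getLast h).target L)) := by
    intro l
    induction l with
    | nil => exact fun h => absurd rfl h
    | cons s l ih =>
      intro h hc
      refine ⟨(hsrc s).symm, ?_⟩
      cases l with
      | nil => exact (htgt s).symm
      | cons s' l =>
        have h := ih (by simp) (List.isChain_of_isChain_cons hc)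
        have e : (tri s).target L = (tri s').source L := (List.isChain_cons_cons.1 hc).1
        simp only [List.map_cons, List.head_cons] at h
        rw [← htgt, e]
        simpa using h
  exact path l ne_nil hcons

end Cycles

/-! ### Ribbons and the vertex and face operators away from their ends -/

section Commutation

lemma sum_comul_of_cop {C : Type*} [AddCommGroup C] [Module ℂ C] [Coalgebra ℂ C] {ι : Type*}
    {s : Finset ι} {l r : ι → Cop C} {h : Cop C} (e : ∑ i ∈ s, l i ⊗ₜ[ℂ] r i = comul h) :
    ∑ i ∈ s, ofCop C (r i) ⊗ₜ[ℂ] ofCop C (l i) = comul (ofCop C h) := by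
  have := congrArg (TensorProduct.comm ℂ (Cop C) (Cop C)) e
  rw [map_sum] at this
  refine this.trans ((TensorProduct.comm ℂ C C).injective ?_)
  exact (TensorProduct.comm_comm ℂ C C _).trans (comul_cop h)

section General

variable {C A B X : Type*} [AddCommGroup C] [Module ℂ C] [Coalgebra ℂ C]
  [Ring A] [Algebra ℂ A] [Ring B] [Algebra ℂ B]

lemma convProd_comp_eq {P : A →ₗ[ℂ] B} (hP : ∀ x y, P (x * y) = P x * P y) {a : X → C →ₗ[ℂ] A}
    {c : List X} (hc : c ≠ []) (h : C) :
    (c.map fun y => toConv (P ∘ₗ a y)).prod h = P (sweedlerProd comul (c.map a) h) := by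
  rw [map_sweedlerProd comul P hP, sweedlerProd_comul _ (by simpa using hc), List.map_map,
    List.map_map]
  rfl

theorem commute_map_sweedlerProd {σ : Equiv.Perm X} {rev : X → X}
    (hrev : Function.Injective rev) (hne : ∀ x, rev x ≠ x)
    {P : A →ₗ[ℂ] B} (hP : ∀ x y, P (x * y) = P x * P y)
    {a : X → C →ₗ[ℂ] A} {n : C →ₗ[ℂ] B} {τ : Step X → B}
    (ha : ∀ x y, x ≠ y → ∀ g h, Commute (a x g) (a y h))
    (hn : ∀ x g, Commute (n g) (P x))
    (turn_comm : ∀ x y, y ≠ x → ∀ h, Commute (τ (.turn x)) (P (a y h)))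
    (turn_braid : ∀ x h (s : Finset (C × C)) (l r : C × C → C), ∑ i ∈ s, l i ⊗ₜ[ℂ] r i = comul h →
      ∑ i ∈ s, τ (.turn x) * (P (a x (l i)) * n (r i)) =
        ∑ i ∈ s, n (l i) * P (a x (r i)) * τ (.turn x))
    (move_comm : ∀ x y, y ≠ x → y ≠ rev x → ∀ h, Commute (τ (.move x)) (P (a y h)))
    (move_out : ∀ x h (s : Finset (C × C)) (l r : C × C → C), ∑ i ∈ s, l i ⊗ₜ[ℂ] r i = comul h →
      τ (.move x) * P (a x h) =
        ∑ i ∈ s, n (l i) * P (a x (r i)) * τ (.move x))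
    (move_in : ∀ x h (s : Finset (C × C)) (l r : C × C → C), ∑ i ∈ s, l i ⊗ₜ[ℂ] r i = comul h →
      ∑ i ∈ s, τ (.move x) * (P (a (rev x) (l i)) * n (r i)) =
        P (a (rev x) h) * τ (.move x))
    {c₀ : C} (hc₀ : TensorProduct.comm ℂ C C (comul c₀) = comul c₀)
    {s : X} {c : List X} (hc : IsCycleList σ s c)
    {p q : X} (hp : ¬ σ.SameCycle s p) (hq : ¬ σ.SameCycle s q) {l : List (Step X)}
    (hl : Step.Path σ rev p l q) (hd : l.Pairwise (Step.Apart rev)) :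
    Commute (l.map τ).prod (P (sweedlerProd comul (c.map a) c₀)) := by
  rw [← convProd_comp_eq hP hc.ne_nil]
  refine commute_stepProd (α := fun x => P ∘ₗ a x) (n := n) hrev hne
    (fun x y hxy g h => ?_) (fun x g h => hn _ _)
    turn_comm turn_braid move_comm move_out move_in hc₀ hc hp hq hl hd
  exact (hP _ _).symm.trans ((congrArg P (ha x y hxy g h).eq).trans (hP _ _))

/-- For a path running against the order in which the legs are attached: the list is reversed, `C`
is replaced by its co-opposite, and the relations are required with their legs exchanged. -/
theorem commute_map_sweedlerProd_inv {σ : Equiv.Perm X} {rev : X → X}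
    (hrev : Function.Injective rev) (hne : ∀ x, rev x ≠ x)
    {P : A →ₗ[ℂ] B} (hP : ∀ x y, P (x * y) = P x * P y)
    {a : X → C →ₗ[ℂ] A} {n : C →ₗ[ℂ] B} {τ : Step X → B}
    (ha : ∀ x y, x ≠ y → ∀ g h, Commute (a x g) (a y h))
    (hn : ∀ x g, Commute (n g) (P x))
    (turn_comm : ∀ x y, y ≠ x → ∀ h, Commute (τ (.turn x)) (P (a y h)))
    (turn_braid : ∀ x h (s : Finset (C × C)) (l r : C × C → C), ∑ i ∈ s, l i ⊗ₜ[ℂ] r i = comul h →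
      ∑ i ∈ s, τ (.turn x) * (P (a x (r i)) * n (l i)) =
        ∑ i ∈ s, n (r i) * P (a x (l i)) * τ (.turn x))
    (move_comm : ∀ x y, y ≠ x → y ≠ rev x → ∀ h, Commute (τ (.move x)) (P (a y h)))
    (move_out : ∀ x h (s : Finset (C × C)) (l r : C × C → C), ∑ i ∈ s, l i ⊗ₜ[ℂ] r i = comul h →
      τ (.move x) * P (a x h) =
        ∑ i ∈ s, n (r i) * P (a x (l i)) * τ (.move x))
    (move_in : ∀ x h (s : Finset (C × C)) (l r : C × C → C), ∑ i ∈ s, l i ⊗ₜ[ℂ] r i = comul h →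
      ∑ i ∈ s, τ (.move x) * (P (a (rev x) (r i)) * n (l i)) =
        P (a (rev x) h) * τ (.move x))
    {c₀ : C} (hc₀ : TensorProduct.comm ℂ C C (comul c₀) = comul c₀)
    {s : X} {c : List X} (hc : IsCycleList σ s c)
    {p q : X} (hp : ¬ σ.SameCycle s p) (hq : ¬ σ.SameCycle s q) {l : List (Step X)}
    (hl : Step.Path σ⁻¹ rev p l q) (hd : l.Pairwise (Step.Apart rev)) :
    Commute (l.map τ).prod (P (sweedlerProd comul (c.map a) c₀)) := by
  have hα : ∀ x y, x ≠ y → ∀ g h, Commute ((P ∘ₗ a x) g) ((P ∘ₗ a y) h) := fun x y hxy g h =>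
    (hP _ _).symm.trans ((congrArg P (ha x y hxy g h).eq).trans (hP _ _))
  have e := convProd_reverse_cop (α := fun x => P ∘ₗ a x) hc.nodup hα c₀
  rw [← convProd_comp_eq hP hc.ne_nil, ← e]
  exact commute_stepProd (α := fun x => (P ∘ₗ a x) ∘ₗ (ofCop C).toLinearMap)
    (n := n ∘ₗ (ofCop C).toLinearMap) hrev hne hα (fun x g h => hn _ _) turn_comm
    (fun x h s l r e => turn_braid x h s _ _ (sum_comul_of_cop e)) move_comm
    (fun x h s l r e => move_out x h s _ _ (sum_comul_of_cop e))
    (fun x h s l r e => move_in x h s _ _ (sum_comul_of_cop e)) (comm_comul_cop hc₀) hc.reverse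
    (by rwa [Equiv.Perm.sameCycle_inv]) (by rwa [Equiv.Perm.sameCycle_inv]) hl hd

variable {V : Type*} [AddCommGroup V] [Module ℂ V]

-- Here `P` is left multiplication and `n` acts by precomposition on the label. These always
-- commute, so only the relations with the star operators have to be supplied.
set_option maxHeartbeats 1000000 in
theorem commute_starProd {σ : Equiv.Perm X} {rev : X → X}
    (hrev : Function.Injective rev) (hne : ∀ x, rev x ≠ x)
    {a : X → C →ₗ[ℂ] A} {n : C →ₗ[ℂ] Module.End ℂ V} {τ : Step X → Module.End ℂ (V →ₗ[ℂ] A)}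
    (ha : ∀ x y, x ≠ y → ∀ g h, Commute (a x g) (a y h))
    (turn_comm : ∀ x y, y ≠ x → ∀ h, Commute (τ (.turn x)) (postMul V A (a y h)))
    (turn_braid : ∀ x h (s : Finset (C × C)) (l r : C × C → C), ∑ i ∈ s, l i ⊗ₜ[ℂ] r i = comul h →
      ∑ i ∈ s, τ (.turn x) * (postMul V A (a x (l i)) * preComp V A (n (r i))) =
        ∑ i ∈ s, preComp V A (n (l i)) * postMul V A (a x (r i)) * τ (.turn x))
    (move_comm : ∀ x y, y ≠ x → y ≠ rev x → ∀ h, Commute (τ (.move x)) (postMul V A (a y h)))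
    (move_out : ∀ x h (s : Finset (C × C)) (l r : C × C → C), ∑ i ∈ s, l i ⊗ₜ[ℂ] r i = comul h →
      τ (.move x) * postMul V A (a x h) =
        ∑ i ∈ s, preComp V A (n (l i)) * postMul V A (a x (r i)) * τ (.move x))
    (move_in : ∀ x h (s : Finset (C × C)) (l r : C × C → C), ∑ i ∈ s, l i ⊗ₜ[ℂ] r i = comul h →
      ∑ i ∈ s, τ (.move x) * (postMul V A (a (rev x) (l i)) * preComp V A (n (r i))) =
        postMul V A (a (rev x) h) * τ (.move x))
    {c₀ : C} (hc₀ : TensorProduct.comm ℂ C C (comul c₀) = comul c₀)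
    {s : X} {c : List X} (hc : IsCycleList σ s c)
    {p q : X} (hp : ¬ σ.SameCycle s p) (hq : ¬ σ.SameCycle s q) {l : List (Step X)}
    (hl : Step.Path σ rev p l q) (hd : l.Pairwise (Step.Apart rev)) :
    Commute (l.map τ).prod (postMul V A (sweedlerProd comul (c.map a) c₀)) :=
  commute_map_sweedlerProd (B := Module.End ℂ (V →ₗ[ℂ] A)) (P := postMul V A)
    (n := preComp V A ∘ₗ n) hrev hne postMul_mul ha
    (fun x g => (postMul_commute_preComp x (n g)).symm)
    turn_comm turn_braid move_comm move_out move_in hc₀ hc hp hq hl hd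

set_option maxHeartbeats 1000000 in
theorem commute_starProd_inv {σ : Equiv.Perm X} {rev : X → X}
    (hrev : Function.Injective rev) (hne : ∀ x, rev x ≠ x)
    {a : X → C →ₗ[ℂ] A} {n : C →ₗ[ℂ] Module.End ℂ V} {τ : Step X → Module.End ℂ (V →ₗ[ℂ] A)}
    (ha : ∀ x y, x ≠ y → ∀ g h, Commute (a x g) (a y h))
    (turn_comm : ∀ x y, y ≠ x → ∀ h, Commute (τ (.turn x)) (postMul V A (a y h)))
    (turn_braid : ∀ x h (s : Finset (C × C)) (l r : C × C → C), ∑ i ∈ s, l i ⊗ₜ[ℂ] r i = comul h →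
      ∑ i ∈ s, τ (.turn x) * (postMul V A (a x (r i)) * preComp V A (n (l i))) =
        ∑ i ∈ s, preComp V A (n (r i)) * postMul V A (a x (l i)) * τ (.turn x))
    (move_comm : ∀ x y, y ≠ x → y ≠ rev x → ∀ h, Commute (τ (.move x)) (postMul V A (a y h)))
    (move_out : ∀ x h (s : Finset (C × C)) (l r : C × C → C), ∑ i ∈ s, l i ⊗ₜ[ℂ] r i = comul h →
      τ (.move x) * postMul V A (a x h) =
        ∑ i ∈ s, preComp V A (n (r i)) * postMul V A (a x (l i)) * τ (.move x))
    (move_in : ∀ x h (s : Finset (C × C)) (l r : C × C → C), ∑ i ∈ s, l i ⊗ₜ[ℂ] r i = comul h →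
      ∑ i ∈ s, τ (.move x) * (postMul V A (a (rev x) (r i)) * preComp V A (n (l i))) =
        postMul V A (a (rev x) h) * τ (.move x))
    {c₀ : C} (hc₀ : TensorProduct.comm ℂ C C (comul c₀) = comul c₀)
    {s : X} {c : List X} (hc : IsCycleList σ s c)
    {p q : X} (hp : ¬ σ.SameCycle s p) (hq : ¬ σ.SameCycle s q) {l : List (Step X)}
    (hl : Step.Path σ⁻¹ rev p l q) (hd : l.Pairwise (Step.Apart rev)) :
    Commute (l.map τ).prod (postMul V A (sweedlerProd comul (c.map a) c₀)) :=
  commute_map_sweedlerProd_inv (B := Module.End ℂ (V →ₗ[ℂ] A)) (P := postMul V A)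
    (n := preComp V A ∘ₗ n) hrev hne postMul_mul ha
    (fun x g => (postMul_commute_preComp x (n g)).symm)
    turn_comm turn_braid move_comm move_out move_in hc₀ hc hp hq hl hd

end General

variable {W : Type*} [Ring W] [Algebra ℂ W] [WeakHopfAlgebra W] [FiniteDimensional ℂ W]
variable {E : Type*} [DecidableEq E]

lemma disjoint_region {d d' e e' : Dart E}
    (h : Disjoint ({(d, true), (e, false)} : Set (Dart E × Bool)) {(d', true), (e', false)}) :
    d ≠ d' ∧ e ≠ e' := by
  rw [Set.disjoint_left] at h
  refine ⟨fun h1 => h (Or.inl rfl) (Or.inl (by rw [h1])),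
    fun h1 => h (Or.inr rfl) (Or.inr (by rw [h1]; rfl))⟩

variable {L : Cellulation E} {ρ : Ribbon L} {h : W} {s : Site E}

theorem commute_vertexOp_typeA [Finite E] (hS : ∀ x : W, S W (S W x) = x) (hρ : ρ.type = .A)
    (hh : IsCocommutative h) (h0 : ¬ L.rot.SameCycle s ρ.initialSite)
    (h1 : ¬ L.rot.SameCycle s ρ.finalSite) :
    Commute (ρ.triangles.map (starOp W)).prod (postMul (RibbonSpace W) _ (vertexOp L s h)) := by
  -- Type A turns counterclockwise about a vertex, as the legs of `h` do. The site `d` lies just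
  -- before the end `rot d`, which is therefore its label; a left-handed direct triangle leaves the
  -- end `d` by running against `rev d`.
  let tri : Step (Dart E) → Triangle E
    | .turn d => .dualR d
    | .move d => .directL (Dart.rev d)
  obtain ⟨l, hl, hpath, hapart⟩ := exists_path ρ (σ := L.rot) (label := L.rot) (tri := tri)
    (by rintro (d | d) <;> simp [tri, Triangle.source, Step.src, Cellulation.next, Dart.rev_rev])
    (by rintro (d | d) <;> rfl)
    (by
      rintro (d | d) (d' | d') hd
      · exact (disjoint_region hd).1
      · have := disjoint_region hd
        rw [Dart.rev_rev] at this
        exact this.symm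
      · have := disjoint_region hd
        rw [Dart.rev_rev] at this
        exact ⟨this.2.symm, this.1.symm⟩
      · exact fun h => (disjoint_region hd).1 (congrArg Dart.rev h))
    (by
      rw [hρ]
      rintro (d | d | d | d) hd
      · cases hd
      · exact ⟨.move (Dart.rev d), congrArg _ (Dart.rev_rev d)⟩
      · exact ⟨.turn d, rfl⟩
      · cases hd)
  rw [vertexOp, ← hl, List.map_map]
  refine commute_starProd Dart.rev.injective Dart.rev_ne (n := (lam W).ofConv)
    (fun x y hxy g h => vertexAct_commute hS hxy g h) ?_ ?_ ?_ ?_ ?_ hh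
    (isCycleList_star s) ?_ ?_ hpath hapart
  · exact fun x y hxy h => starVertex_commute fun g => vertexAct_commute hS hxy.symm g h
  · exact fun x h s l r e => starVertex_braid ⟨s, l, r, e⟩ hS (vertexAct_mul hS x)
  · exact fun x y hxy hxy' h => starFace_commute fun φ =>
      (onEdge_commute (Dart.fst_ne hxy hxy') _ _).symm
  · intro x h s l r e
    refine starFace_move_out (x := vertexAct W x h) (y := fun i => vertexAct W x (r i)) fun φ => ?_
    have := fOp'_mul_vOp ⟨s, l, r, e⟩ hS (!x.2) φ
    rw [Bool.not_not] at this
    have := congrArg (onEdge W x.1) this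
    simp only [map_sum, onEdge_mul] at this
    exact this
  · intro x h s l r e
    refine starFace_move_in (x := vertexAct W (Dart.rev x) h)
      (y := fun i => vertexAct W (Dart.rev x) (l i)) fun φ => ?_
    have := sum_fOp'_mul_vOp ⟨s, l, r, e⟩ hS (!x.2) φ
    have := congrArg (onEdge W x.1) this
    simp only [map_sum, onEdge_mul] at this
    exact this
  · rwa [Equiv.Perm.sameCycle_apply_right]
  · rwa [Equiv.Perm.sameCycle_apply_right]

lemma onEdge_comp_vOp' (hS : ∀ x : W, S W (S W x) = x) (x : Dart E) :
    onEdge W x.1 ∘ₗ vOp' W x.2 = vertexAct W x ∘ₗ S W :=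
  LinearMap.ext fun g => congrArg (onEdge W x.1) (vOp'_eq hS x.2 g)

theorem commute_vertexOp_typeB [Finite E] (hS : ∀ x : W, S W (S W x) = x) (hρ : ρ.type = .B)
    (hh : IsCocommutative h) (h0 : ¬ L.rot.SameCycle s ρ.initialSite)
    (h1 : ¬ L.rot.SameCycle s ρ.finalSite) :
    Commute (ρ.triangles.map (starOp W)).prod (postMul (RibbonSpace W) _ (vertexOp L s h)) := by
  -- Type B turns clockwise, so `σ = rot⁻¹`. The site `d` lies just before `d` in this sense, and
  -- the co-opposite version of the transport applies.
  let tri : Step (Dart E) → Triangle E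
    | .turn d => .dualL d
    | .move d => .directR d
  obtain ⟨l, hl, hpath, hapart⟩ := exists_path ρ (σ := L.rot⁻¹) (label := 1) (tri := tri)
    (by rintro (d | d) <;> rfl)
    (by rintro (d | d) <;> rfl)
    (by
      rintro (d | d) (d' | d') hd
      · exact (disjoint_region hd).1
      · exact disjoint_region hd
      · exact ⟨(disjoint_region hd).1.symm, (disjoint_region hd).2.symm⟩
      · exact (disjoint_region hd).1)
    (by
      rw [hρ]
      rintro (d | d | d | d) hd
      · exact ⟨.move d, rfl⟩
      · cases hd
      · cases hd
      · exact ⟨.turn d, rfl⟩)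
  rw [vertexOp, ← hl, List.map_map]
  refine commute_starProd_inv Dart.rev.injective Dart.rev_ne (n := (lam W).ofConv)
    (fun x y hxy g h => vertexAct_commute hS hxy g h) ?_ ?_ ?_ ?_ ?_ hh
    (isCycleList_star s) h0 h1 hpath hapart
  · intro x y hxy h
    refine starVertex_commute fun g => ?_
    rw [onEdge_comp_vOp' hS]
    exact vertexAct_commute hS hxy.symm _ h
  · intro x h s l r e
    have := starVertex_antipode_braid (A := Module.End ℂ (TotalSpace W E)) (a := vertexAct W x)
      ⟨s, l, r, e⟩ hS (vertexAct_mul hS x)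
    rw [← onEdge_comp_vOp' hS] at this
    exact this
  · exact fun x y hxy hxy' h => starFace_commute fun φ =>
      (onEdge_commute (Dart.fst_ne hxy hxy') _ _).symm
  · intro x h s l r e
    refine starFace_move_out (x := vertexAct W x h) (y := fun i => vertexAct W x (l i))
      fun φ => ?_
    have := fOp_mul_vOp ⟨s, l, r, e⟩ hS x.2 φ
    have := congrArg (onEdge W x.1) this
    simp only [map_sum, onEdge_mul] at this
    exact this
  · intro x h s l r e
    refine starFace_move_in (x := vertexAct W (Dart.rev x) h)
      (y := fun i => vertexAct W (Dart.rev x) (r i)) fun φ => ?_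
    have := sum_fOp_mul_vOp ⟨s, l, r, e⟩ hS x.2 φ
    have := congrArg (onEdge W x.1) this
    simp only [map_sum, onEdge_mul] at this
    exact this

end Commutation

/-! ### Ribbons and face operators. -/

section FaceCommutation

variable {W : Type*} [Ring W] [Algebra ℂ W] [WeakHopfAlgebra W] [FiniteDimensional ℂ W]
variable {E : Type*} [DecidableEq E] {L : Cellulation E} {ρ : Ribbon L} {φ : Dual ℂ W} {s : Site E}

lemma sum_smul_faceAct {ι : Type*} {s : Finset ι} {l r : ι → Dual ℂ W} {φ : Dual ℂ W}
    (e : ∑ i ∈ s, l i ⊗ₜ[ℂ] r i = dualComul W φ) (d : Dart E) (g : W) :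
    ∑ i ∈ s, l i g • faceAct W d (r i) = faceAct W d (φ ∘ₗ LinearMap.mulLeft ℂ g) := by
  simp only [← map_smul, ← map_sum]
  congr 1
  ext x
  simpa using sum_dualComul e g x

lemma sum_smul_faceAct' {ι : Type*} {s : Finset ι} {l r : ι → Dual ℂ W} {φ : Dual ℂ W}
    (e : ∑ i ∈ s, l i ⊗ₜ[ℂ] r i = dualComul W φ) (d : Dart E) (g : W) :
    ∑ i ∈ s, r i g • faceAct W d (l i) = faceAct W d (φ ∘ₗ LinearMap.mulRight ℂ g) := by
  simp only [← map_smul, ← map_sum]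
  congr 1
  ext x
  simpa [mul_comm] using sum_dualComul e x g

variable (W) in
/-- `g ↦ faceAct (φ(g •))` -/
def faceActMulLeft (d : Dart E) (φ : Dual ℂ W) : W →ₗ[ℂ] Module.End ℂ (TotalSpace W E) :=
  faceAct W d ∘ₗ (LinearMap.llcomp ℂ W W ℂ φ) ∘ₗ LinearMap.mul ℂ W

variable (W) in
/-- `g ↦ faceAct (φ(• g))` -/
def faceActMulRight (d : Dart E) (φ : Dual ℂ W) : W →ₗ[ℂ] Module.End ℂ (TotalSpace W E) :=
  faceAct W d ∘ₗ (LinearMap.llcomp ℂ W W ℂ φ) ∘ₗ (LinearMap.mul ℂ W).flip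

lemma mul'_map_comul {A : Type*} [Ring A] [Algebra ℂ A] (f g : W →ₗ[ℂ] A) (h : W) :
    LinearMap.mul' ℂ A (TensorProduct.map f g (Δ W h)) =
      ∑ i ∈ (ℛ ℂ h).index, f ((ℛ ℂ h).left i) * g ((ℛ ℂ h).right i) := by
  conv_lhs => rw [← (ℛ ℂ h).eq]
  simp

theorem commute_faceOp_typeA [Finite E] (hS : ∀ x : W, S W (S W x) = x) (hρ : ρ.type = .A)
    (hφ : IsDualCocommutative φ) (h0 : ¬ L.next.SameCycle s ρ.initialSite)
    (h1 : ¬ L.next.SameCycle s ρ.finalSite) :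
    Commute (ρ.triangles.map (starOp W)).prod (postMul (RibbonSpace W) _ (faceOp L s φ)) := by
  -- For faces the roles are exchanged: direct triangles turn around the face and dual triangles
  -- move to the face across an edge. Type A runs clockwise around faces, hence `σ = next⁻¹` and the
  -- co-opposite of `Ŵ`.
  let tri : Step (Dart E) → Triangle E
    | .turn d => .directL d
    | .move d => .dualR (Dart.rev d)
  obtain ⟨l, hl, hpath, hapart⟩ := exists_path ρ (σ := L.next⁻¹) (label := L.next⁻¹) (tri := tri)
    (by
      rintro (d | d)
      · exact L.next.symm_apply_apply d
      · exact L.next.symm_apply_apply d)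
    (by rintro (d | d) <;> rfl)
    (by
      rintro (d | d) (d' | d') hd
      · exact (disjoint_region hd).1
      · have := disjoint_region hd
        exact ⟨fun h => this.2 (congrArg Dart.rev h), this.1⟩
      · have := disjoint_region hd
        exact ⟨fun h => this.2 (congrArg Dart.rev h.symm), this.1.symm⟩
      · exact fun h => (disjoint_region hd).1 (congrArg Dart.rev h))
    (by
      rw [hρ]
      rintro (d | d | d | d) hd
      · cases hd
      · exact ⟨.turn d, rfl⟩
      · exact ⟨.move (Dart.rev d), congrArg _ (Dart.rev_rev d)⟩
      · cases hd)
  let _ := dualCoalgebra W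
  rw [faceOp, ← hl, List.map_map]
  refine commute_starProd_inv Dart.rev.injective Dart.rev_ne (n := coactDual W)
    (fun x y hxy g h => faceAct_commute hxy g h) ?_ ?_ ?_ ?_ ?_ hφ
    (isCycleList_boundary s) ?_ ?_ hpath hapart
  · intro x y hxy h
    refine starFace_commute fun g => ?_
    rw [LinearMap.comp_apply, fOp'_eq hS]
    exact faceAct_commute hxy.symm _ h
  · exact fun x h s l r e => starFace_antipode_braid hS (faceAct_mul hS x)
      (fun φ => congrArg (onEdge W x.1) (fOp'_eq hS x.2 φ)) (sum_dualComul e)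
  · exact fun x y hxy hxy' h => starVertex_commute fun φ =>
      (onEdge_commute (Dart.fst_ne hxy hxy') _ _).symm
  -- The edge identities of the vertex case are reused with emission and absorption interchanged:
  -- `sum_fOp_mul_vOp` now serves for leaving and `fOp_mul_vOp` for arriving.
  · intro x h s l r e
    refine starVertex_move_out (B := faceActMulRight W x h) (x := faceAct W x h)
      (y := fun i => faceAct W x (l i)) (n := r) (fun g => sum_smul_faceAct' e x g) fun g => ?_
    have := congrArg (onEdge W x.1) (sum_fOp_mul_vOp (ℛ ℂ g) hS x.2 h)
    simp only [map_sum, onEdge_mul] at this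
    rw [mul'_map_comul]
    exact this.symm
  · intro x h s l r e
    refine starVertex_move_in (B := faceActMulLeft W (Dart.rev x) h) (x := faceAct W (Dart.rev x) h)
      (y := fun i => faceAct W (Dart.rev x) (r i)) (n := l)
      (fun g => sum_smul_faceAct e (Dart.rev x) g) fun g => ?_
    have := congrArg (onEdge W x.1) (fOp_mul_vOp (ℛ ℂ g) hS (!x.2) h)
    simp only [map_sum, onEdge_mul] at this
    rw [mul'_map_comul]
    exact this.symm
  · exact fun h => h0 (Equiv.Perm.sameCycle_symm_apply_right.1 h)
  · exact fun h => h1 (Equiv.Perm.sameCycle_symm_apply_right.1 h)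

theorem commute_faceOp_typeB [Finite E] (hS : ∀ x : W, S W (S W x) = x) (hρ : ρ.type = .B)
    (hφ : IsDualCocommutative φ) (h0 : ¬ L.next.SameCycle s ρ.initialSite)
    (h1 : ¬ L.next.SameCycle s ρ.finalSite) :
    Commute (ρ.triangles.map (starOp W)).prod (postMul (RibbonSpace W) _ (faceOp L s φ)) := by
  -- Type B runs counterclockwise around faces, in the order of the legs of `φ`. Crossing `d`
  -- clockwise about its vertex leads from `d` to `next (rev d)`, which is a move.
  let tri : Step (Dart E) → Triangle E
    | .turn d => .directR d
    | .move d => .dualL d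
  obtain ⟨l, hl, hpath, hapart⟩ := exists_path ρ (σ := L.next) (label := 1) (tri := tri)
    (by rintro (d | d) <;> rfl)
    (by
      rintro (d | d)
      · rfl
      · exact congrArg L.rot.symm (Dart.rev_rev d).symm)
    (by
      rintro (d | d) (d' | d') hd
      · exact (disjoint_region hd).1
      · have := disjoint_region hd
        exact ⟨this.1, fun h => this.2 ((congrArg Dart.rev h).trans (Dart.rev_rev d'))⟩
      · have := disjoint_region hd
        exact ⟨this.1.symm, fun h => this.2 ((Dart.rev_rev d).symm.trans (congrArg Dart.rev h.symm))⟩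
      · exact (disjoint_region hd).1)
    (by
      rw [hρ]
      rintro (d | d | d | d) hd
      · exact ⟨.turn d, rfl⟩
      · cases hd
      · cases hd
      · exact ⟨.move d, rfl⟩)
  let _ := dualCoalgebra W
  rw [faceOp, ← hl, List.map_map]
  refine commute_starProd Dart.rev.injective Dart.rev_ne (n := coactDual W)
    (fun x y hxy g h => faceAct_commute hxy g h) ?_ ?_ ?_ ?_ ?_ hφ
    (isCycleList_boundary s) h0 h1 hpath hapart
  · exact fun x y hxy h => starFace_commute fun g => faceAct_commute hxy.symm _ h
  · exact fun x h s l r e => starFace_braid hS (faceAct_mul hS x) (sum_dualComul e)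
  · exact fun x y hxy hxy' h => starVertex_commute fun φ =>
      (onEdge_commute (Dart.fst_ne hxy hxy') _ _).symm
  · intro x h s l r e
    refine starVertex_move_out (B := faceActMulLeft W x h) (x := faceAct W x h)
      (y := fun i => faceAct W x (r i)) (n := l) (fun g => sum_smul_faceAct e x g) fun g => ?_
    have := congrArg (onEdge W x.1) (vOp'_mul_fOp (ℛ ℂ g) hS x.2 h)
    simp only [map_sum, onEdge_mul] at this
    rw [mul'_map_comul]
    exact this
  · intro x h s l r e
    refine starVertex_move_in (B := faceActMulRight W (Dart.rev x) h)
      (x := faceAct W (Dart.rev x) h) (y := fun i => faceAct W (Dart.rev x) (l i)) (n := r)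
      (fun g => sum_smul_faceAct' e (Dart.rev x) g) fun g => ?_
    have := congrArg (onEdge W x.1) (fOp_mul_vOp' (ℛ ℂ g) hS x.2 h)
    simp only [map_sum, onEdge_mul] at this
    rw [mul'_map_comul]
    exact this.symm

end FaceCommutation

end WeakHopf

end

theorem mainTheorem6 {W : Type*} [Ring W] [Algebra ℂ W] [WeakHopfAlgebra W]
    [FiniteDimensional ℂ W]
    (l : W) (hl : WeakHopf.IsHaarIntegral l) (hlc : WeakHopf.IsCocommutative l)
    {E : Type*} [Finite E] [DecidableEq E] (L : WeakHopf.Cellulation E)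
    (ρ : WeakHopf.Ribbon L)
    (t : W ⊗[ℂ] Module.Dual ℂ W) (ht : t ∈ WeakHopf.doubleDual W)
    (h : W) (hh : WeakHopf.IsCocommutative h)
    (φ : Module.Dual ℂ W) (hφ : WeakHopf.IsDualCocommutative φ)
    (s : WeakHopf.Site E) :
    (L.vertex s ≠ L.vertex ρ.initialSite → L.vertex s ≠ L.vertex ρ.finalSite →
      WeakHopf.vertexOp L s h * WeakHopf.ribbonOp ρ t =
        WeakHopf.ribbonOp ρ t * WeakHopf.vertexOp L s h) ∧
    (L.face s ≠ L.face ρ.initialSite → L.face s ≠ L.face ρ.finalSite →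
      WeakHopf.faceOp L s φ * WeakHopf.ribbonOp ρ t =
        WeakHopf.ribbonOp ρ t * WeakHopf.faceOp L s φ) := by
  have hS := WeakHopf.antipode_antipode_of_haar hl hlc
  refine ⟨fun h0 h1 => WeakHopf.commute_ribbonOp hS ρ ht ?_,
    fun h0 h1 => WeakHopf.commute_ribbonOp hS ρ ht ?_⟩
  · replace h0 : ¬ L.rot.SameCycle s ρ.initialSite := fun e => h0 (Quotient.sound e)
    replace h1 : ¬ L.rot.SameCycle s ρ.finalSite := fun e => h1 (Quotient.sound e)
    cases hρ : ρ.type with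
    | A => exact WeakHopf.commute_vertexOp_typeA hS hρ hh h0 h1
    | B => exact WeakHopf.commute_vertexOp_typeB hS hρ hh h0 h1
  · replace h0 : ¬ L.next.SameCycle s ρ.initialSite := fun e => h0 (Quotient.sound e)
    replace h1 : ¬ L.next.SameCycle s ρ.finalSite := fun e => h1 (Quotient.sound e)
    cases hρ : ρ.type with
    | A => exact WeakHopf.commute_faceOp_typeA hS hρ hφ h0 h1
    | B => exact WeakHopf.commute_faceOp_typeB hS hρ hφ h0 h1
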